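/- A distance preservation game (DPG) $\Gamma=(A,(M_a)_{a\in A},(d_a)_{a\in A},G)$ consists of a finite set $A$ of agents, relationship sets $M_a\subseteq A\setminus\{a\}$, functions $d_a\colon M_a\to\{1,2,3,\dots\}$ (the ideal distances), and a finite simple undirected connected graph $G=(V,E)$, the topology, with $|V|\ge|A|$. An allocation is an injective map $\pi\colon A\to V$; the cost of an agent $a$ is $\operatorname{cost}(a,\pi)=\sum_{b\in M_a}\bigl|d_a(b)-\operatorname{dist}_G(\pi(a),\pi(b))\bigr|$. The allocation $\pi$ is envy-free if there are no agents $a,b\in A$ with $\operatorname{cost}(a,\pi)>\operatorname{cost}(a,\pi^{a\leftrightarrow b})$, where $\pi^{a\leftrightarrow b}$ is obtained from $\pi$ by swapping the positions of $a$ and $b$. The modular-width $\operatorname{mw}(G)$ is the least $m$ such that $G$ can be obtained, up to isomorphism, by an algebraic expression over the operations (i) create an isolated vertex, (ii) disjoint union of two graphs, (iii) complete join of two graphs, (iv) substitution of graphs $G_1,\dots,G_n$ for the vertices of a pattern graph $H$ on $\{1,\dots,n\}$ (vertices of $G_i$ and $G_j$, $i\ne j$, are adjacent if and only if $ij\in E(H)$),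 in which every substitution has at most $m$ operands. **Theorem.** Deciding whether a given distance preservation game $\Gamma$ admits an envy-free allocation is fixed-parameter tractable with respect to $|A|+\operatorname{mw}(G)$. That is, there are a single algorithm, a computable function $f\colon\mathbb N\to\mathbb N$ and a constant $c$ such that the algorithm, given any distance preservation game $\Gamma$ (no modular decomposition is given with it), decides correctly whether $\Gamma$ admits an envy-free allocation, and makes at most $f(|A|+\operatorname{mw}(G))\cdot|\Gamma|^{c}$ steps, where $|\Gamma|$ is the length of $\Gamma$ in bits, numbers being written in binary. (The algorithm is a program of a random access machine with uniform cost measure whose arithmetic operations are addition, truncated subtraction and halving.) -/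

import Mathlib

/-! ## Random access machines with the uniform cost measure

Programs of a random access machine over the natural numbers, in structured form.  A machine has
registers and memory banks (a program mentions only finitely many of either); a memory cell is
addressed by the content of a register.  The arithmetic instructions are addition, truncated
subtraction and halving (no multiplication), so that numbers gain at most one bit per step and the
uniform cost is polynomially related to the running time of a Turing machine. -/

namespace RAM

/-- The memory of the machine: register `r` holds `reg r`, cell `i` of bank `k` holds `mem k i`. -/
structure State where
  reg : ℕ → ℕ
  mem : ℕ → ℕ → ℕ

/-- The elementary instructions. -/
inductive Instr where
  /-- `R[r] := c` -/
  | const (r c : ℕ)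
  /-- `R[r] := R[s]` -/
  | copy (r s : ℕ)
  /-- `R[r] := R[s] + R[u]` -/
  | add (r s u : ℕ)
  /-- `R[r] := max (R[s] - R[u]) 0` -/
  | sub (r s u : ℕ)
  /-- `R[r] := ⌊R[s] / 2⌋` -/
  | half (r s : ℕ)
  /-- `R[r] := M_k[R[s]]` -/
  | load (r k s : ℕ)
  /-- `M_k[R[s]] := R[u]` -/
  | store (k s u : ℕ)

/-- The effect of an elementary instruction. -/
def Instr.apply : Instr → State → State
  | .const r c, σ => { σ with reg := Function.update σ.reg r c }
  | .copy r s, σ => { σ with reg := Function.update σ.reg r (σ.reg s) }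
  | .add r s u, σ => { σ with reg := Function.update σ.reg r (σ.reg s + σ.reg u) }
  | .sub r s u, σ => { σ with reg := Function.update σ.reg r (σ.reg s - σ.reg u) }
  | .half r s, σ => { σ with reg := Function.update σ.reg r (σ.reg s / 2) }
  | .load r k s, σ => { σ with reg := Function.update σ.reg r (σ.mem k (σ.reg s)) }
  | .store k s u, σ =>
      { σ with mem := Function.update σ.mem k (Function.update (σ.mem k) (σ.reg s) (σ.reg u)) }

/-- Programs. -/
inductive Program where
  | skip
  | instr (i : Instr)
  | seq (p q : Program)
  /-- if `R[r] ≠ 0` then `p` else `q` -/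
  | cond (r : ℕ) (p q : Program)
  /-- while `R[r] ≠ 0` do `p` -/
  | loop (r : ℕ) (p : Program)

/-- `Runs p σ τ t`: started in `σ`, the program `p` halts in `τ` after exactly `t` steps.  Each
elementary instruction and each test of a register is one step. -/
inductive Runs : Program → State → State → ℕ → Prop
  | skip (σ : State) : Runs .skip σ σ 1
  | instr (i : Instr) (σ : State) : Runs (.instr i) σ (i.apply σ) 1
  | seq {p q : Program} {σ τ ρ : State} {t t' : ℕ} :
      Runs p σ τ t → Runs q τ ρ t' → Runs (.seq p q) σ ρ (t + t')
  | cond_true {r : ℕ} {p q : Program} {σ τ : State} {t : ℕ} :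
      σ.reg r ≠ 0 → Runs p σ τ t → Runs (.cond r p q) σ τ (t + 1)
  | cond_false {r : ℕ} {p q : Program} {σ τ : State} {t : ℕ} :
      σ.reg r = 0 → Runs q σ τ t → Runs (.cond r p q) σ τ (t + 1)
  | loop_true {r : ℕ} {p : Program} {σ τ ρ : State} {t t' : ℕ} :
      σ.reg r ≠ 0 → Runs p σ τ t → Runs (.loop r p) τ ρ t' → Runs (.loop r p) σ ρ (t + t' + 1)
  | loop_false {r : ℕ} {p : Program} {σ : State} :
      σ.reg r = 0 → Runs (.loop r p) σ σ 1

/-- The initial state on input `x`: bank `0` holds the entries of `x`, register `0` holds their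
number, and everything else is `0`. -/
def init (x : List ℕ) : State where
  reg := fun r => if r = 0 then x.length else 0
  mem := fun k i => if k = 0 then x.getD i 0 else 0

/-- The size of an input in bits: every entry in binary, plus one separating symbol for each. -/
def inputSize (x : List ℕ) : ℕ := (x.map fun a => Nat.size a + 1).sum

end RAM

/-- Fixed-parameter tractability of the decision problem `P` on instances of type `I`, given to the
machine through `encode`, with respect to the parameter `κ`: a single program decides `P`
(a nonzero register `0` at the end means "yes") within `f (κ x) * |x| ^ c` steps for every instance
`x`, where `f` is a computable function and `c` is a constant. -/
def IsFPT {I : Type*} (encode : I → List ℕ) (κ : I → ℕ) (P : I → Prop) : Prop :=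
  ∃ (p : RAM.Program) (f : ℕ → ℕ) (c : ℕ), Computable f ∧
    ∀ x : I, ∃ (τ : RAM.State) (t : ℕ),
      RAM.Runs p (RAM.init (encode x)) τ t ∧
      t ≤ f (κ x) * RAM.inputSize (encode x) ^ c ∧
      (τ.reg 0 ≠ 0 ↔ P x)

/-! ## Modular-width -/

/-- Algebraic expressions over the operations: create an isolated vertex, disjoint union, complete
join, and substitution of graphs for the vertices of a pattern graph `H`. -/
inductive ModularExpr : Type where
  | vertex : ModularExpr
  | union (e₁ e₂ : ModularExpr) : ModularExpr
  | join (e₁ e₂ : ModularExpr) : ModularExpr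
  | subst (n : ℕ) (H : SimpleGraph (Fin n)) (e : Fin n → ModularExpr) : ModularExpr

namespace ModularExpr

/-- The vertices of the graph that an expression creates. -/
def Verts : ModularExpr → Type
  | vertex => Unit
  | union e₁ e₂ => e₁.Verts ⊕ e₂.Verts
  | join e₁ e₂ => e₁.Verts ⊕ e₂.Verts
  | subst n _ e => (i : Fin n) × (e i).Verts

/-- Adjacency in the graph that an expression creates. -/
def Adj : (e : ModularExpr) → e.Verts → e.Verts → Prop
  | vertex, _, _ => False
  | union e₁ _, .inl u, .inl v => e₁.Adj u v
  | union _ e₂, .inr u, .inr v => e₂.Adj u v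
  | union _ _, .inl _, .inr _ => False
  | union _ _, .inr _, .inl _ => False
  | join e₁ _, .inl u, .inl v => e₁.Adj u v
  | join _ e₂, .inr u, .inr v => e₂.Adj u v
  | join _ _, .inl _, .inr _ => True
  | join _ _, .inr _, .inl _ => True
  | subst _ H e, ⟨i, u⟩, ⟨j, v⟩ => H.Adj i j ∨ ∃ h : i = j, (e j).Adj (h ▸ u) v

/-- The width of an expression: the largest number of operands of a substitution in it. -/
def width : ModularExpr → ℕ
  | vertex => 0
  | union e₁ e₂ => max e₁.width e₂.width
  | join e₁ e₂ => max e₁.width e₂.width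
  | subst n _ e => max n (Finset.univ.sup fun i => (e i).width)

end ModularExpr

/-- The modular-width of a graph: the least width of an expression that creates the graph, up to
isomorphism. -/
noncomputable def SimpleGraph.modularWidth {V : Type*} (G : SimpleGraph V) : ℕ :=
  sInf {m | ∃ e : ModularExpr, e.width = m ∧
    ∃ φ : V ≃ e.Verts, ∀ u v, G.Adj u v ↔ e.Adj (φ u) (φ v)}

/-! ## Distance preservation games -/

/-- A distance preservation game with the set of agents `A` on a topology with vertex set `V`. -/
structure DistancePreservationGame (A V : Type*) [Fintype A] [Fintype V] where
  /-- the relationship sets `M_a` -/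
  rel : A → Finset A
  notMem_rel : ∀ a, a ∉ rel a
  /-- the ideal distances `d_a : M_a → {1, 2, ...}` -/
  ideal : (a : A) → {b // b ∈ rel a} → ℕ+
  topology : SimpleGraph V
  connected : topology.Connected
  card_le : Fintype.card A ≤ Fintype.card V

namespace DistancePreservationGame

variable {A V : Type*} [Fintype A] [Fintype V]

/-- The cost of agent `a` in the allocation `π`. -/
noncomputable def cost (Γ : DistancePreservationGame A V) (a : A) (π : A ↪ V) : ℤ :=
  ∑ b : {b // b ∈ Γ.rel a}, |((Γ.ideal a b : ℕ) : ℤ) - (Γ.topology.dist (π a) (π b) : ℤ)|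

/-- The allocation in which `a` and `b` have swapped their positions. -/
def swap [DecidableEq A] (π : A ↪ V) (a b : A) : A ↪ V :=
  (Equiv.swap a b).toEmbedding.trans π

/-- No agent has a smaller cost after swapping positions with another agent. -/
def EnvyFree [DecidableEq A] (Γ : DistancePreservationGame A V) (π : A ↪ V) : Prop :=
  ¬ ∃ a b, Γ.cost a π > Γ.cost a (swap π a b)

open Classical in
/-- The ideal distance of `a` from `b` if `b ∈ M_a`, and `0` otherwise. -/
noncomputable def idealEntry (Γ : DistancePreservationGame A V) (a b : A) : ℕ :=
  if h : b ∈ Γ.rel a then (Γ.ideal a ⟨b, h⟩ : ℕ) else 0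

open Classical in
/-- The entries of the adjacency matrix of the topology. -/
noncomputable def adjEntry (Γ : DistancePreservationGame A V) (u v : V) : ℕ :=
  if Γ.topology.Adj u v then 1 else 0

end DistancePreservationGame

/-- Distance preservation games as inputs of an algorithm: agents and vertices are numbered. -/
structure DPGInstance where
  numAgents : ℕ
  numVertices : ℕ
  game : DistancePreservationGame (Fin numAgents) (Fin numVertices)

namespace DPGInstance

/-- The encoding of an instance: the number of agents, the number of vertices, the matrix of ideal
distances (`0` where there is none) and the adjacency matrix of the topology, row by row. -/
noncomputable def encode (x : DPGInstance) : List ℕ :=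
  [x.numAgents, x.numVertices]
    ++ List.ofFn (fun i : Fin (x.numAgents * x.numAgents) => x.game.idealEntry i.divNat i.modNat)
    ++ List.ofFn (fun i : Fin (x.numVertices * x.numVertices) =>
        x.game.adjEntry i.divNat i.modNat)

/-- The instance admits an envy-free allocation. -/
def HasEnvyFree (x : DPGInstance) : Prop :=
  ∃ π : Fin x.numAgents ↪ Fin x.numVertices, x.game.EnvyFree π

/-- The combined parameter: the number of agents plus the modular-width of the topology. -/
noncomputable def parameter (x : DPGInstance) : ℕ :=
  x.numAgents + x.game.topology.modularWidth

end DPGInstance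

/-! ## A small imperative language and its compilation to the machine -/

/-! Let `k` be the number of agents. Whether an allocation is envy-free depends only on the `k × k`
matrix of distances between the occupied vertices, because a swap merely permutes these vertices
(`DistancePreservationGame.exists_envyFree_iff`). It therefore suffices to find a set of vertices
whose size is bounded in the parameter and which realises every distance matrix of a `k`-tuple of
vertices, and then to try all its tuples.

Two facts on modular-width make this possible. Descending in an optimal expression shows that every
set `K` of at least two vertices contains a set of at least 2 and at most `max mw 2` vertices that
no other vertex of `K` distinguishes (`ModularExpr.exists_module`). A module for adjacency is also
one for distances (`SimpleGraph.dist_le_of_module`), so no decomposition is needed later, only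
distances. Moreover, a geodesic with at least four vertices has no nontrivial module for distances,
so all distances are bounded in `mw` (`SimpleGraph.dist_lt_of_modules`), and with them the number of
distance matrices.

The algorithm maintains surviving vertices, partitioned into distance modules of at most `g`
vertices (`IsKernel`). Each round takes a module of few representatives, namely a smallest closure
of a pair. In the union of the corresponding parts it keeps the vertices of one tuple for each
distance matrix. Outside vertices do not distinguish vertices of the union, so exchanging the
portion of a tuple inside it for a copy preserves all distances (`IsKernel.merge`). The size of the
new part is bounded by the number of matrices, not by the sizes of the merged parts, so the same `g`
serves in every round. After at most `n` rounds a single part is left.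

For the running time, programs are written in a small language with bounded loops. If every register
of the program stays at most `B`, the compiled program needs time polynomial in `B`
(`RAM.Stmt.compile_within`, `RAM.Stmt.polyBounded_cost`). Here `B` is a function of the parameter
times the input size. -/

namespace RAM

/-- Started in `σ`, the program `p` halts within `c` steps in a state that satisfies `Q`. -/
def Within (p : Program) (σ : State) (c : ℕ) (Q : State → Prop) : Prop :=
  ∃ τ t, Runs p σ τ t ∧ t ≤ c ∧ Q τ

theorem Within.mono {p : Program} {σ : State} {c c' : ℕ} {Q Q' : State → Prop}
    (h : Within p σ c Q) (hc : c ≤ c') (hQ : ∀ τ, Q τ → Q' τ) : Within p σ c' Q' := by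
  obtain ⟨τ, t, hr, ht, hq⟩ := h
  exact ⟨τ, t, hr, ht.trans hc, hQ τ hq⟩

theorem Within.instr {i : Instr} {σ : State} {Q : State → Prop} (h : Q (i.apply σ)) :
    Within (.instr i) σ 1 Q :=
  ⟨_, 1, .instr i σ, le_rfl, h⟩

theorem Within.seq {p q : Program} {σ : State} {c c' : ℕ} {Q : State → Prop}
    (h : Within p σ c fun τ => Within q τ c' Q) : Within (.seq p q) σ (c + c') Q := by
  obtain ⟨τ, t, hr, ht, ρ, t', hr', ht', hq⟩ := h
  exact ⟨ρ, t + t', .seq hr hr', Nat.add_le_add ht ht', hq⟩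

theorem Within.cond {r : ℕ} {p q : Program} {σ : State} {c c' : ℕ} {Q : State → Prop}
    (h : σ.reg r ≠ 0 → Within p σ c Q) (h' : σ.reg r = 0 → Within q σ c' Q) :
    Within (.cond r p q) σ (c + c' + 1) Q := by
  by_cases hr : σ.reg r = 0
  · obtain ⟨τ, t, h1, h2, h3⟩ := h' hr
    exact ⟨τ, t + 1, .cond_false hr h1, by omega, h3⟩
  · obtain ⟨τ, t, h1, h2, h3⟩ := h hr
    exact ⟨τ, t + 1, .cond_true hr h1, by omega, h3⟩

/-- The invariant is indexed by the number of iterations that remain, which is the content of the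
tested register. Each iteration pays one step for the test, and the last test accounts for the final
`+ 1`. -/
theorem Within.loop {r : ℕ} {p : Program} {c : ℕ} (I : ℕ → State → Prop)
    (hI : ∀ i σ, I i σ → σ.reg r = i)
    (h : ∀ i σ, I (i + 1) σ → Within p σ c (I i)) :
    ∀ i σ, I i σ → Within (.loop r p) σ (i * (c + 1) + 1) (I 0) := by
  intro i
  induction i with
  | zero => exact fun σ hσ => ⟨σ, 1, .loop_false (hI 0 σ hσ), by omega, hσ⟩
  | succ i ih =>
    intro σ hσ
    obtain ⟨τ, t, h1, h2, h3⟩ := h i σ hσ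
    obtain ⟨ρ, t', h1', h2', h3'⟩ := ih τ h3
    refine ⟨ρ, t + t' + 1, .loop_true ?_ h1 h1', ?_, h3'⟩
    · rw [hI _ σ hσ]; omega
    · rw [Nat.succ_mul]; omega

/-- Expressions: `mul r e` is `R[r] * e`, and `sum x r e` is the sum of the values of `e` for
`R[x] = 0, ..., R[r] - 1`. -/
inductive Expr where
  | var (x : ℕ)
  | const (c : ℕ)
  | add (e₁ e₂ : Expr)
  | sub (e₁ e₂ : Expr)
  | load (k : ℕ) (e : Expr)
  | ite (e₁ e₂ e₃ : Expr)
  | mul (r : ℕ) (e : Expr)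
  | sum (x r : ℕ) (e : Expr)

namespace Expr

/-- The value of an expression. -/
def eval : Expr → (ℕ → ℕ) → (ℕ → ℕ → ℕ) → ℕ
  | var x, ρ, _ => ρ x
  | const c, _, _ => c
  | add e₁ e₂, ρ, μ => e₁.eval ρ μ + e₂.eval ρ μ
  | sub e₁ e₂, ρ, μ => e₁.eval ρ μ - e₂.eval ρ μ
  | load k e, ρ, μ => μ k (e.eval ρ μ)
  | ite e₁ e₂ e₃, ρ, μ => if e₁.eval ρ μ ≠ 0 then e₂.eval ρ μ else e₃.eval ρ μ
  | mul r e, ρ, μ => ρ r * e.eval ρ μ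
  | sum x r e, ρ, μ => ∑ i ∈ Finset.range (ρ r), e.eval (Function.update ρ x i) μ

/-- All registers that the expression mentions are below this number. -/
def bound : Expr → ℕ
  | var x => x + 1
  | const _ => 0
  | add e₁ e₂ => max e₁.bound e₂.bound
  | sub e₁ e₂ => max e₁.bound e₂.bound
  | load _ e => e.bound
  | ite e₁ e₂ e₃ => max e₁.bound (max e₂.bound e₃.bound)
  | mul r e => max (r + 1) e.bound
  | sum x r e => max (max (x + 1) (r + 1)) e.bound

/-- The expression does not read the bank `k`. -/
def avoids (k : ℕ) : Expr → Bool
  | var _ => true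
  | const _ => true
  | add e₁ e₂ => e₁.avoids k && e₂.avoids k
  | sub e₁ e₂ => e₁.avoids k && e₂.avoids k
  | load k' e => k' != k && e.avoids k
  | ite e₁ e₂ e₃ => e₁.avoids k && (e₂.avoids k && e₃.avoids k)
  | mul _ e => e.avoids k
  | sum _ _ e => e.avoids k

/-- A bound of the running time if all registers have values of at most `B`. -/
def cost (B : ℕ) : Expr → ℕ
  | var _ => 1
  | const _ => 1
  | add e₁ e₂ => e₁.cost B + (e₂.cost B + 1)
  | sub e₁ e₂ => e₁.cost B + (e₂.cost B + 1)
  | load _ e => e.cost B + 1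
  | ite e₁ e₂ e₃ => e₁.cost B + (e₂.cost B + e₃.cost B + 1)
  | mul _ e => e.cost B + (B * 3 + 4)
  | sum _ _ e => B * (e.cost B + 5) + 6

/-- The program that puts the value of an expression into the register `b`, using the registers
from `b` on. -/
def compile : Expr → ℕ → Program
  | var x, b => .instr (.copy b x)
  | const c, b => .instr (.const b c)
  | add e₁ e₂, b => .seq (e₁.compile b) (.seq (e₂.compile (b + 1)) (.instr (.add b b (b + 1))))
  | sub e₁ e₂, b => .seq (e₁.compile b) (.seq (e₂.compile (b + 1)) (.instr (.sub b b (b + 1))))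
  | load k e, b => .seq (e.compile b) (.instr (.load b k b))
  | ite e₁ e₂ e₃, b => .seq (e₁.compile b) (.cond b (e₂.compile b) (e₃.compile b))
  | mul r e, b =>
    .seq (e.compile (b + 1)) (.seq (.instr (.copy (b + 2) r)) (.seq (.instr (.const b 0))
      (.seq (.instr (.const (b + 3) 1))
        (.loop (b + 2) (.seq (.instr (.add b b (b + 1)))
          (.instr (.sub (b + 2) (b + 2) (b + 3))))))))
  | sum x r e, b =>
    .seq (.instr (.copy (b + 1) r)) (.seq (.instr (.const b 0)) (.seq (.instr (.copy (b + 2) x))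
      (.seq (.instr (.const x 0))
      (.seq (.loop (b + 1) (.seq (e.compile (b + 4)) (.seq (.instr (.add b b (b + 4)))
          (.seq (.instr (.const (b + 3) 1)) (.seq (.instr (.add x x (b + 3)))
            (.instr (.sub (b + 1) (b + 1) (b + 3))))))))
        (.instr (.copy x (b + 2)))))))

theorem eval_congr_reg (e : Expr) {ρ ρ' : ℕ → ℕ} (μ : ℕ → ℕ → ℕ)
    (h : ∀ r < e.bound, ρ r = ρ' r) : e.eval ρ μ = e.eval ρ' μ := by
  induction e generalizing ρ ρ' with
  | var x => exact h x (by simp [bound])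
  | const c => rfl
  | add e₁ e₂ h₁ h₂ | sub e₁ e₂ h₁ h₂ =>
    simp only [bound, lt_sup_iff] at h
    simp only [eval]
    rw [h₁ fun r hr => h r (.inl hr), h₂ fun r hr => h r (.inr hr)]
  | load k e he => simp only [eval]; rw [he h]
  | ite e₁ e₂ e₃ h₁ h₂ h₃ =>
    simp only [bound, lt_sup_iff] at h
    simp only [eval]
    rw [h₁ fun r hr => h r (.inl hr), h₂ fun r hr => h r (.inr (.inl hr)),
      h₃ fun r hr => h r (.inr (.inr hr))]
  | mul r e he =>
    simp only [bound, lt_sup_iff] at h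
    simp only [eval]
    rw [h r (.inl (by omega)), he fun r hr => h r (.inr hr)]
  | sum x r e he =>
    simp only [bound, lt_sup_iff] at h
    simp only [eval]
    rw [h r (.inl (.inr (by omega)))]
    refine Finset.sum_congr rfl fun i _ => he fun s hs => ?_
    by_cases hx : s = x
    · simp [hx]
    · simp [hx, h s (.inr hs)]

/-- Needed for tables: writing entries of a bank must not change the entries that are still to be
computed. -/
theorem eval_congr_mem (e : Expr) {k : ℕ} (hk : e.avoids k = true) (ρ : ℕ → ℕ)
    {μ μ' : ℕ → ℕ → ℕ} (h : ∀ k' ≠ k, μ k' = μ' k') : e.eval ρ μ = e.eval ρ μ' := by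
  induction e generalizing ρ with
  | var x => rfl
  | const c => rfl
  | add e₁ e₂ h₁ h₂ | sub e₁ e₂ h₁ h₂ =>
    simp only [avoids, Bool.and_eq_true] at hk
    simp only [eval, h₁ hk.1, h₂ hk.2]
  | load k' e he =>
    simp only [avoids, Bool.and_eq_true, bne_iff_ne] at hk
    simp only [eval, he hk.2, h k' hk.1]
  | ite e₁ e₂ e₃ h₁ h₂ h₃ =>
    simp only [avoids, Bool.and_eq_true] at hk
    simp only [eval, h₁ hk.1, h₂ hk.2.1, h₃ hk.2.2]
  | mul r e he => simp only [eval, he hk]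
  | sum x r e he => simp only [eval, he hk]

/-- Scratch registers form a stack: `b` is its top and grows with the depth, while `b₀` separates
the program's own registers from it. Only registers below `b₀` have to be bounded by `B`, since they
alone determine numbers of iterations. Intermediate values and memory cells, such as ideal distances
written in binary, may be arbitrarily large. -/
theorem compile_within (e : Expr) {B b₀ : ℕ} (hb₀ : e.bound ≤ b₀) (b : ℕ) (hb : b₀ ≤ b) (σ : State)
    (hB : ∀ r < b₀, σ.reg r ≤ B) :
    Within (e.compile b) σ (e.cost B) fun τ =>
      τ.reg b = e.eval σ.reg σ.mem ∧ (∀ r < b, τ.reg r = σ.reg r) ∧ τ.mem = σ.mem := by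
  induction e generalizing b σ with
  | var x =>
    refine Within.instr ⟨by simp [Instr.apply, eval], fun r hr => ?_, rfl⟩
    simp [Instr.apply, hr.ne]
  | const c =>
    refine Within.instr ⟨by simp [Instr.apply, eval], fun r hr => ?_, rfl⟩
    simp [Instr.apply, hr.ne]
  | add e₁ e₂ h₁ h₂ | sub e₁ e₂ h₁ h₂ =>
    simp only [bound, sup_le_iff] at hb₀
    refine Within.seq ((h₁ hb₀.1 b hb σ hB).mono le_rfl fun τ hτ => Within.seq ?_)
    refine (h₂ hb₀.2 (b + 1) (by omega) τ fun r hr => ?_).mono le_rfl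
      fun υ hυ => Within.instr ⟨?_, fun r hr => ?_, ?_⟩
    · rw [hτ.2.1 r (by omega)]; exact hB r hr
    · simp only [Instr.apply, Function.update_self, eval]
      rw [hυ.1, hυ.2.1 b (by omega), hτ.1, hτ.2.2,
        e₂.eval_congr_reg _ fun r hr => hτ.2.1 r (by omega)]
    · simp only [Instr.apply]
      rw [Function.update_of_ne hr.ne, hυ.2.1 r (by omega), hτ.2.1 r hr]
    · simp only [Instr.apply]; rw [hυ.2.2, hτ.2.2]
  | load k e he =>
    refine Within.seq ((he hb₀ b hb σ hB).mono le_rfl fun τ hτ => Within.instr ⟨?_, fun r hr => ?_, ?_⟩)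
    · simp [Instr.apply, hτ, eval]
    · simp only [Instr.apply]
      rw [Function.update_of_ne hr.ne, hτ.2.1 r hr]
    · simp only [Instr.apply]; rw [hτ.2.2]
  | ite e₁ e₂ e₃ h₁ h₂ h₃ =>
    simp only [bound, sup_le_iff] at hb₀
    refine Within.seq ((h₁ hb₀.1 b hb σ hB).mono le_rfl fun τ hτ => Within.cond ?_ ?_)
    all_goals
      intro hc
      rw [hτ.1] at hc
    · refine (h₂ hb₀.2.1 b hb τ fun r hr => ?_).mono le_rfl fun υ hυ => ⟨?_, fun r hr => ?_, ?_⟩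
      · rw [hτ.2.1 r (by omega)]; exact hB r hr
      · simp only [eval, if_pos hc]
        rw [hυ.1, hτ.2.2, e₂.eval_congr_reg _ fun r hr => hτ.2.1 r (by omega)]
      · rw [hυ.2.1 r hr, hτ.2.1 r hr]
      · rw [hυ.2.2, hτ.2.2]
    · refine (h₃ hb₀.2.2 b hb τ fun r hr => ?_).mono le_rfl fun υ hυ => ⟨?_, fun r hr => ?_, ?_⟩
      · rw [hτ.2.1 r (by omega)]; exact hB r hr
      · simp only [eval, hc, ne_eq, not_true_eq_false, if_false]
        rw [hυ.1, hτ.2.2, e₃.eval_congr_reg _ fun r hr => hτ.2.1 r (by omega)]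
      · rw [hυ.2.1 r hr, hτ.2.1 r hr]
      · rw [hυ.2.2, hτ.2.2]
  | mul r e he =>
    simp only [bound, sup_le_iff] at hb₀
    have hr := hB r (by omega)
    have e1 : (mul r e).cost B = e.cost B + (1 + (1 + (1 + (B * (2 + 1) + 1)))) := by
      simp only [cost]; omega
    rw [e1]
    refine Within.seq ((he hb₀.2 (b + 1) (by omega) σ hB).mono le_rfl fun τ hτ => Within.seq
      (Within.instr (Within.seq (Within.instr (Within.seq (Within.instr ?_))))))
    -- The counter is a copy of the register `r`, so the time does not depend on the value of `e`,
    -- which is added repeatedly.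
    refine (Within.loop (c := 1 + 1) (fun i υ => υ.reg (b + 2) = i ∧ υ.reg (b + 3) = 1 ∧
      υ.reg (b + 1) = e.eval σ.reg σ.mem ∧ i ≤ σ.reg r ∧
      υ.reg b = (σ.reg r - i) * e.eval σ.reg σ.mem ∧
      (∀ r < b, υ.reg r = σ.reg r) ∧ υ.mem = σ.mem) (fun i σ h => h.1) ?_ (σ.reg r) _ ?_).mono
      (by gcongr) ?_
    · rintro i υ ⟨h1, h2, h3, h4, h5, h6, h7⟩
      refine Within.seq (Within.instr (Within.instr ?_))
      refine ⟨?_, ?_, ?_, by omega, ?_, fun s hs => ?_, ?_⟩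
      · simp [Instr.apply, h1, h2]
      · simp [Instr.apply, h2]
      · simp [Instr.apply, h3]
      · simp only [Instr.apply]
        rw [Function.update_of_ne (by omega), Function.update_self, h5, h3,
          show σ.reg r - i = (σ.reg r - (i + 1)) + 1 by omega, Nat.succ_mul]
      · simp only [Instr.apply]
        rw [Function.update_of_ne (by omega), Function.update_of_ne (by omega), h6 s hs]
      · simp [Instr.apply, h7]
    · refine ⟨?_, ?_, ?_, le_rfl, ?_, fun s hs => ?_, ?_⟩
      · simp [Instr.apply, hτ.2.1 r (by omega)]
      · simp [Instr.apply]
      · simp [Instr.apply, hτ.1]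
      · simp [Instr.apply]
      · simp only [Instr.apply]
        rw [Function.update_of_ne (by omega), Function.update_of_ne (by omega),
          Function.update_of_ne (by omega), hτ.2.1 s (by omega)]
      · simp [Instr.apply, hτ.2.2]
    · rintro υ ⟨h1, h2, h3, h4, h5, h6, h7⟩
      exact ⟨by simpa [eval] using h5, h6, h7⟩
  | sum x r e he =>
    simp only [bound, sup_le_iff] at hb₀
    have hr := hB r (by omega)
    have e1 : (sum x r e).cost B = 1 + (1 + (1 + (1 +
        (B * ((e.cost B + (1 + (1 + (1 + 1)))) + 1) + 1 + 1)))) := by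
      simp only [cost, Nat.reduceAdd, add_assoc]; omega
    rw [e1]
    refine Within.seq (Within.instr (Within.seq (Within.instr (Within.seq (Within.instr
      (Within.seq (Within.instr (Within.seq ?_))))))))
    -- The summation variable `x` runs upwards in its own register; its old value waits in `b + 2`
    -- and is restored at the end, so the invariant exempts `x` from the unchanged registers.
    refine (Within.loop (c := e.cost B + (1 + (1 + (1 + 1)))) (fun i υ => υ.reg (b + 1) = i ∧
      υ.reg (b + 2) = σ.reg x ∧ i ≤ σ.reg r ∧ υ.reg x = σ.reg r - i ∧
      υ.reg b = ∑ j ∈ Finset.range (σ.reg r - i), e.eval (Function.update σ.reg x j) σ.mem ∧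
      (∀ r < b, r ≠ x → υ.reg r = σ.reg r) ∧ υ.mem = σ.mem) (fun i σ h => h.1) ?_ (σ.reg r) _
      ?_).mono (by gcongr) ?_
    · rintro i υ ⟨h1, h2, h3, h4, h5, h6, h7⟩
      refine Within.seq ((he hb₀.2 (b + 4) (by omega) υ fun s hs => ?_).mono le_rfl fun τ hτ =>
        Within.seq (Within.instr (Within.seq (Within.instr (Within.seq
          (Within.instr (Within.instr ?_)))))))
      · by_cases hx : s = x
        · rw [hx, h4]; omega
        · rw [h6 s (by omega) hx]; exact hB s hs
      have hval : e.eval υ.reg υ.mem = e.eval (Function.update σ.reg x (σ.reg r - (i + 1))) σ.mem := by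
        rw [h7]
        refine e.eval_congr_reg _ fun s hs => ?_
        by_cases hx : s = x
        · simp [hx, h4]
        · simp [hx, h6 s (by omega) hx]
      have hx1 : x ≠ b + 1 := by omega
      have hx3 : x ≠ b + 3 := by omega
      have hxb : x ≠ b := by omega
      refine ⟨?_, ?_, by omega, ?_, ?_, fun s hs hx => ?_, ?_⟩
      · simp [Instr.apply, hx1.symm, hx3.symm, hτ.2.1 (b + 1) (by omega), h1]
      · simp only [Instr.apply]
        rw [Function.update_of_ne (by omega), Function.update_of_ne (by omega),
          Function.update_of_ne (by omega), Function.update_of_ne (by omega),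
          hτ.2.1 (b + 2) (by omega), h2]
      · simp [Instr.apply, hx1, hx3, hxb, hτ.2.1 x (by omega), h4]
        omega
      · simp [Instr.apply, hxb.symm, hτ.2.1 b (by omega), h5, hτ.1, hval]
        rw [show σ.reg r - i = (σ.reg r - (i + 1)) + 1 by omega, Finset.sum_range_succ]
      · simp only [Instr.apply]
        rw [Function.update_of_ne (by omega), Function.update_of_ne (by omega),
          Function.update_of_ne (by omega), Function.update_of_ne (by omega),
          hτ.2.1 s (by omega), h6 s hs hx]
      · simp [Instr.apply, hτ.2.2, h7]
    · have hx1 : x ≠ b + 1 := by omega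
      have hx2 : x ≠ b + 2 := by omega
      have hxb : x ≠ b := by omega
      refine ⟨?_, ?_, le_rfl, ?_, ?_, fun s hs hx => ?_, ?_⟩
      · simp [Instr.apply, hx1.symm]
      · simp [Instr.apply, hx2.symm, hx1, hxb]
      · simp [Instr.apply]
      · simp [Instr.apply, hxb.symm]
      · simp only [Instr.apply]
        rw [Function.update_of_ne (by omega), Function.update_of_ne (by omega),
          Function.update_of_ne (by omega), Function.update_of_ne (by omega)]
      · simp [Instr.apply]
    · rintro υ ⟨h1, h2, h3, h4, h5, h6, h7⟩
      refine Within.instr ⟨?_, fun s hs => ?_, ?_⟩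
      · simp only [Instr.apply]
        rw [Function.update_of_ne (by omega), h5]
        simp [eval]
      · by_cases hx : s = x
        · simp [Instr.apply, hx, h2]
        · simp [Instr.apply, hx, h6 s hs hx]
      · simp [Instr.apply, h7]

end Expr

end RAM

/-! ### Statements, their semantics and their compilation. -/

namespace RAM

/-- Statements: `tab k x r y s e` fills the bank `k` with the `R[r] × R[s]` table, row by row, of
the values of `e` with row index `R[x]` and column index `R[y]`, and `iter r p` repeats the
statement `p` for `R[r]` times. -/
inductive Stmt where
  | assign (x : ℕ) (e : Expr)
  | store (k : ℕ) (e₁ e₂ : Expr)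
  | tab (k x r y s : ℕ) (e : Expr)
  | seq (p q : Stmt)
  | iter (r : ℕ) (p : Stmt)

/-- The contents of a bank after an `m`-element table has been written to it. -/
def overwrite (m : ℕ) (v w : ℕ → ℕ) : ℕ → ℕ := fun a => if a < m then v a else w a

namespace Stmt

/-- The effect of a statement. -/
def exec : Stmt → State → State
  | assign x e, σ => { σ with reg := Function.update σ.reg x (e.eval σ.reg σ.mem) }
  | store k e₁ e₂, σ =>
    ⟨σ.reg, Function.update σ.mem k
      (Function.update (σ.mem k) (e₁.eval σ.reg σ.mem) (e₂.eval σ.reg σ.mem))⟩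
  | tab k x r y s e, σ =>
    ⟨σ.reg, Function.update σ.mem k (overwrite (σ.reg r * σ.reg s)
      (fun a => e.eval (Function.update (Function.update σ.reg x (a / σ.reg s)) y (a % σ.reg s))
        σ.mem) (σ.mem k))⟩
  | seq p q, σ => q.exec (p.exec σ)
  | iter r p, σ => p.exec^[σ.reg r] σ

/-- All registers that the statement mentions are below this number. -/
def bound : Stmt → ℕ
  | assign x e => max (x + 1) e.bound
  | store _ e₁ e₂ => max e₁.bound e₂.bound
  | tab _ x r y s e => max (max (max (x + 1) (r + 1)) (max (y + 1) (s + 1))) e.bound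
  | seq p q => max p.bound q.bound
  | iter r p => max (r + 1) p.bound

/-- The entries of a table do not depend on the bank they are written to. -/
def valid : Stmt → Bool
  | assign _ _ => true
  | store _ _ _ => true
  | tab k x _ y _ e => x != y && e.avoids k
  | seq p q => p.valid && q.valid
  | iter _ p => p.valid

/-- All values that are assigned to registers are at most `B`. -/
def Small (B : ℕ) : Stmt → State → Prop
  | assign _ e, σ => e.eval σ.reg σ.mem ≤ B
  | store _ _ _, _ => True
  | tab _ _ _ _ _ _, _ => True
  | seq p q, σ => p.Small B σ ∧ q.Small B (p.exec σ)
  | iter r p, σ => ∀ i < σ.reg r, p.Small B (p.exec^[i] σ)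

/-- A bound of the running time if all registers have values of at most `B`. -/
def cost (B : ℕ) : Stmt → ℕ
  | assign _ e => e.cost B + 1
  | store _ e₁ e₂ => e₁.cost B + (e₂.cost B + 1)
  | tab _ _ _ _ _ e => B * (B * (e.cost B + 5) + 6) + 10
  | seq p q => p.cost B + q.cost B
  | iter _ p => B * (p.cost B + 3) + 2

/-- The program that carries out a statement, using the registers from `b` on as scratch space. -/
def compile : Stmt → ℕ → Program
  | assign x e, b => .seq (e.compile b) (.instr (.copy x b))
  | store k e₁ e₂, b =>
    .seq (e₁.compile b) (.seq (e₂.compile (b + 1)) (.instr (.store k b (b + 1))))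
  | tab k x r y s e, b =>
    .seq (.instr (.const b 0)) (.seq (.instr (.copy (b + 1) r)) (.seq (.instr (.copy (b + 2) s))
    (.seq (.instr (.copy (b + 3) x)) (.seq (.instr (.copy (b + 4) y)) (.seq (.instr (.const (b + 5) 1))
    (.seq (.instr (.const x 0))
    (.seq (.loop (b + 1)
      (.seq (.instr (.copy (b + 6) (b + 2))) (.seq (.instr (.const y 0))
      (.seq (.loop (b + 6)
        (.seq (e.compile (b + 7)) (.seq (.instr (.store k b (b + 7)))
          (.seq (.instr (.add b b (b + 5))) (.seq (.instr (.add y y (b + 5)))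
            (.instr (.sub (b + 6) (b + 6) (b + 5))))))))
      (.seq (.instr (.add x x (b + 5))) (.instr (.sub (b + 1) (b + 1) (b + 5))))))))
    (.seq (.instr (.copy x (b + 3))) (.instr (.copy y (b + 4)))))))))))
  | seq p q, b => .seq (p.compile b) (q.compile b)
  | iter r p, b =>
    .seq (.instr (.copy b r)) (.loop b (.seq (p.compile (b + 2)) (.seq (.instr (.const (b + 1) 1))
      (.instr (.sub b b (b + 1))))))

theorem overwrite_zero (v w : ℕ → ℕ) : overwrite 0 v w = w := by
  funext a; simp [overwrite]

theorem update_overwrite (m : ℕ) (v w : ℕ → ℕ) :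
    Function.update (overwrite m v w) m (v m) = overwrite (m + 1) v w := by
  funext a
  rcases lt_trichotomy a m with h | h | h
  · simp [overwrite, h.ne, h, Nat.lt_succ_of_lt h]
  · simp [overwrite, h]
  · simp [overwrite, h.ne', not_lt.2 h.le, not_lt.2 (Nat.succ_le_of_lt h)]

/-- The inner loop of a table. The address in register `b` runs on from row to row, so no
multiplication is needed to locate an entry. -/
theorem tab_row_within {k y b B : ℕ} {e : Expr} (hk : e.avoids k = true) (hy : y < b)
    {b₀ : ℕ} (he : e.bound ≤ b₀) (hb₀ : b₀ ≤ b) (σ : State) (hB : ∀ r < b₀, σ.reg r ≤ B) (S j : ℕ) (hS : S ≤ B) (w : ℕ → ℕ)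
    (v : ℕ → ℕ) (hv : ∀ l < S, v (j * S + l) = e.eval (Function.update σ.reg y l) σ.mem)
    (hb : σ.reg b = j * S) (h5 : σ.reg (b + 5) = 1)
    (hm : σ.mem k = overwrite (j * S) v w) (h6 : σ.reg (b + 6) = S) (h0 : σ.reg y = 0) :
    Within (.loop (b + 6)
        (.seq (e.compile (b + 7)) (.seq (.instr (.store k b (b + 7)))
          (.seq (.instr (.add b b (b + 5))) (.seq (.instr (.add y y (b + 5)))
            (.instr (.sub (b + 6) (b + 6) (b + 5)))))))) σ (B * (e.cost B + 5) + 1) fun τ =>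
      τ.reg b = (j + 1) * S ∧ (∀ r < b, r ≠ y → τ.reg r = σ.reg r) ∧
      (∀ r, b < r → r < b + 6 → τ.reg r = σ.reg r) ∧
      τ.mem = Function.update σ.mem k (overwrite ((j + 1) * S) v w) := by
  refine (Within.loop (c := e.cost B + (1 + (1 + (1 + 1)))) (fun i υ => υ.reg (b + 6) = i ∧
    i ≤ S ∧ υ.reg y = S - i ∧ υ.reg b = j * S + (S - i) ∧
    (∀ r < b, r ≠ y → υ.reg r = σ.reg r) ∧ (∀ r, b < r → r < b + 6 → υ.reg r = σ.reg r) ∧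
    υ.mem = Function.update σ.mem k (overwrite (j * S + (S - i)) v w)) (fun i σ h => h.1) ?_ S _
    ?_).mono (by gcongr) ?_
  · rintro i υ ⟨h1, h2, h3, h4, h5', h6', h7⟩
    refine Within.seq ((e.compile_within he (b + 7) (by omega) υ fun s hs => ?_).mono le_rfl
      fun τ hτ => Within.seq (Within.instr (Within.seq (Within.instr (Within.seq
          (Within.instr (Within.instr ?_)))))))
    · by_cases hx : s = y
      · rw [hx, h3]; omega
      · rw [h5' s (by omega) hx]; exact hB s hs
    have hval : e.eval υ.reg υ.mem = v (j * S + (S - (i + 1))) := by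
      rw [hv _ (by omega), e.eval_congr_mem hk _ (μ' := σ.mem)
        (fun k' hk' => by rw [h7, Function.update_of_ne hk'])]
      refine e.eval_congr_reg _ fun s hs => ?_
      by_cases hx : s = y
      · simp [hx, h3]
      · simp [hx, h5' s (by omega) hx]
    have hyb : y ≠ b := by omega
    have hyb5 : y ≠ b + 5 := by omega
    have hyb6 : y ≠ b + 6 := by omega
    have h55 : τ.reg (b + 5) = 1 := by rw [hτ.2.1 _ (by omega), h6' _ (by omega) (by omega), h5]
    refine ⟨?_, by omega, ?_, ?_, fun s hs hx => ?_, fun s hs hs' => ?_, ?_⟩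
    · simp [Instr.apply, hyb6.symm, hyb5.symm, hτ.2.1 (b + 6) (by omega), h1, h55]
    · simp [Instr.apply, hyb, hyb6, h55, hτ.2.1 y (by omega), h3]
      omega
    · simp [Instr.apply, hyb.symm, h55, hτ.2.1 b (by omega), h4]
      omega
    · simp only [Instr.apply]
      rw [Function.update_of_ne (by omega), Function.update_of_ne (by omega),
        Function.update_of_ne (by omega), hτ.2.1 s (by omega), h5' s hs hx]
    · simp only [Instr.apply]
      rw [Function.update_of_ne (by omega), Function.update_of_ne (by omega),
        Function.update_of_ne (by omega), hτ.2.1 s (by omega), h6' s hs hs']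
    · simp only [Instr.apply, hτ.2.1 b (by omega), hτ.1, hval, hτ.2.2, h4]
      rw [h7, Function.update_self, Function.update_idem, update_overwrite]
      rw [show j * S + (S - (i + 1)) + 1 = j * S + (S - i) by omega]
  · refine ⟨h6, le_rfl, by simp [h0], by simp [hb], fun _ _ _ => rfl, fun _ _ _ => rfl, ?_⟩
    simp [← hm]
  · rintro υ ⟨h1, h2, h3, h4, h5', h6', h7⟩
    rw [Nat.sub_zero, ← Nat.succ_mul] at h4 h7
    exact ⟨h4, h5', h6', h7⟩

theorem tab_within {k x r y s b₀ b B : ℕ} {e : Expr} (hxy : x ≠ y) (hk : e.avoids k = true)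
    (hx : x < b₀) (hr : r < b₀) (hy : y < b₀) (hs : s < b₀) (he : e.bound ≤ b₀) (hb : b₀ ≤ b)
    (σ : State) (hB : ∀ r < b₀, σ.reg r ≤ B) :
    Within ((tab k x r y s e).compile b) σ ((tab k x r y s e).cost B) fun τ =>
      (∀ r < b, τ.reg r = ((tab k x r y s e).exec σ).reg r) ∧
        τ.mem = ((tab k x r y s e).exec σ).mem := by
  have e1 : (tab k x r y s e).cost B = 1 + (1 + (1 + (1 + (1 + (1 + (1 +
      (B * (1 + (1 + (B * (e.cost B + 5) + 1 + (1 + 1))) + 1) + 1 + (1 + 1)))))))) := by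
    have : 1 + (1 + (B * (e.cost B + 5) + 1 + (1 + 1))) + 1 = B * (e.cost B + 5) + 6 := by omega
    simp only [cost]; rw [this]; omega
  have hS := hB s hs
  have hR := hB r hr
  set v : ℕ → ℕ := fun a => e.eval
    (Function.update (Function.update σ.reg x (a / σ.reg s)) y (a % σ.reg s)) σ.mem with hv
  rw [e1]
  refine Within.seq (Within.instr (Within.seq (Within.instr (Within.seq (Within.instr
    (Within.seq (Within.instr (Within.seq (Within.instr (Within.seq (Within.instr
    (Within.seq (Within.instr (Within.seq ?_))))))))))))))
  refine (Within.loop (c := 1 + (1 + (B * (e.cost B + 5) + 1 + (1 + 1)))) (fun i υ =>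
    υ.reg (b + 1) = i ∧ i ≤ σ.reg r ∧ υ.reg x = σ.reg r - i ∧
    υ.reg b = (σ.reg r - i) * σ.reg s ∧ υ.reg (b + 2) = σ.reg s ∧ υ.reg (b + 3) = σ.reg x ∧
    υ.reg (b + 4) = σ.reg y ∧ υ.reg (b + 5) = 1 ∧
    (∀ r < b, r ≠ y → r ≠ x → υ.reg r = σ.reg r) ∧
    υ.mem = Function.update σ.mem k (overwrite ((σ.reg r - i) * σ.reg s) v (σ.mem k)))
    (fun i σ h => h.1) ?_ (σ.reg r) _ ?_).mono (by gcongr) ?_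
  · rintro i υ ⟨h1, h2, h3, h4, h5, h6, h7, h8, h10, h11⟩
    refine Within.seq (Within.instr (Within.seq (Within.instr (Within.seq ?_))))
    have hyb6 : y ≠ b + 6 := by omega
    refine (tab_row_within (B := B) (S := σ.reg s) (j := σ.reg r - (i + 1)) (w := σ.mem k) (v := v)
      hk (by omega) he hb _ (fun t ht => ?_) hS ?_ ?_ ?_ ?_ ?_ ?_).mono le_rfl fun τ hτ =>
        Within.seq (Within.instr (Within.instr ?_))
    · simp only [Instr.apply]
      rcases eq_or_ne t y with rfl | hty
      · simp
      · rw [Function.update_of_ne hty, Function.update_of_ne (by omega)]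
        rcases eq_or_ne t x with rfl | htx
        · rw [h3]; omega
        · rw [h10 t (by omega) hty htx]; exact hB t ht
    · intro l hl
      have hl' : 0 < σ.reg s := by omega
      simp only [hv, Instr.apply, Function.update_idem]
      rw [Nat.mul_add_mod', Nat.mod_eq_of_lt hl, Nat.mul_comm, Nat.mul_add_div hl',
        Nat.div_eq_of_lt hl, Nat.add_zero]
      rw [e.eval_congr_mem hk _ (μ' := υ.mem)
        (fun k' hk' => by rw [h11, Function.update_of_ne hk'])]
      refine e.eval_congr_reg _ fun t ht => ?_
      rcases eq_or_ne t y with rfl | hty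
      · simp
      · rw [Function.update_of_ne hty, Function.update_of_ne hty,
          Function.update_of_ne (by omega : t ≠ b + 6)]
        rcases eq_or_ne t x with rfl | htx
        · simp [h3]
        · rw [Function.update_of_ne htx, h10 t (by omega) hty htx]
    · simp only [Instr.apply]
      rw [Function.update_of_ne (by omega), Function.update_of_ne (by omega), h4]
    · simp only [Instr.apply]
      rw [Function.update_of_ne (by omega), Function.update_of_ne (by omega), h8]
    · simp [Instr.apply, h11]
    · simp [Instr.apply, hyb6.symm, h5]
    · simp [Instr.apply]
    · simp only [Instr.apply] at hτ ⊢
      obtain ⟨g1, g2, g3, g4⟩ := hτ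
      have g : ∀ t, b < t → t < b + 6 → τ.reg t = υ.reg t := fun t ht ht' => by
        rw [g3 t ht ht', Function.update_of_ne (by omega), Function.update_of_ne (by omega)]
      have g' : ∀ t < b, t ≠ y → τ.reg t = υ.reg t := fun t ht hty => by
        rw [g2 t ht hty, Function.update_of_ne hty, Function.update_of_ne (by omega)]
      have hxb : x ≠ b := by omega
      have hxb1 : x ≠ b + 1 := by omega
      have hxb5 : x ≠ b + 5 := by omega
      have hj : σ.reg r - (i + 1) + 1 = σ.reg r - i := by omega
      rw [hj] at g1 g4
      refine ⟨?_, by omega, ?_, ?_, ?_, ?_, ?_, ?_, fun t ht hty htx => ?_, ?_⟩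
      · simp [hxb1.symm, hxb5.symm, g (b + 5), g (b + 1), h1, h8]
      · simp [hxb1, g (b + 5), g' x (by omega) hxy, h3, h8, hj]
      · simp [hxb.symm, g1]
      · rw [Function.update_of_ne (by omega), Function.update_of_ne (by omega),
          g _ (by omega) (by omega), h5]
      · rw [Function.update_of_ne (by omega), Function.update_of_ne (by omega),
          g _ (by omega) (by omega), h6]
      · rw [Function.update_of_ne (by omega), Function.update_of_ne (by omega),
          g _ (by omega) (by omega), h7]
      · rw [Function.update_of_ne (by omega), Function.update_of_ne (by omega),
          g _ (by omega) (by omega), h8]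
      · rw [Function.update_of_ne (by omega), Function.update_of_ne htx, g' t ht hty, h10 t ht hty htx]
      · rw [g4, h11, Function.update_idem]
  · have hxb : x ≠ b := by omega
    refine ⟨?_, le_rfl, ?_, ?_, ?_, ?_, ?_, ?_, fun t ht hty htx => ?_, ?_⟩
    all_goals simp only [Instr.apply]
    · rw [Function.update_of_ne (by omega), Function.update_of_ne (by omega),
        Function.update_of_ne (by omega), Function.update_of_ne (by omega),
        Function.update_of_ne (by omega), Function.update_self, Function.update_of_ne (by omega)]
    · simp
    · simp [hxb.symm]
    · rw [Function.update_of_ne (by omega), Function.update_of_ne (by omega),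
        Function.update_of_ne (by omega), Function.update_of_ne (by omega), Function.update_self,
        Function.update_of_ne (by omega), Function.update_of_ne (by omega)]
    · rw [Function.update_of_ne (by omega), Function.update_of_ne (by omega),
        Function.update_of_ne (by omega), Function.update_self, Function.update_of_ne (by omega),
        Function.update_of_ne (by omega), Function.update_of_ne (by omega)]
    · rw [Function.update_of_ne (by omega), Function.update_of_ne (by omega), Function.update_self,
        Function.update_of_ne (by omega), Function.update_of_ne (by omega),
        Function.update_of_ne (by omega), Function.update_of_ne (by omega)]
    · rw [Function.update_of_ne (by omega), Function.update_self]
    · rw [Function.update_of_ne htx, Function.update_of_ne (by omega),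
        Function.update_of_ne (by omega), Function.update_of_ne (by omega),
        Function.update_of_ne (by omega), Function.update_of_ne (by omega),
        Function.update_of_ne (by omega)]
    · simp [overwrite_zero]
  · rintro υ ⟨h1, h2, h3, h4, h5, h6, h7, h8, h10, h11⟩
    refine Within.seq (Within.instr (Within.instr ⟨fun t ht => ?_, ?_⟩))
    · simp only [Instr.apply, exec]
      rcases eq_or_ne t y with rfl | hty
      · rw [Function.update_self, Function.update_of_ne (by omega), h7]
      · rw [Function.update_of_ne hty]
        rcases eq_or_ne t x with rfl | htx
        · rw [Function.update_self, h6]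
        · rw [Function.update_of_ne htx, h10 t ht hty htx]
    · simp only [Instr.apply, exec, h11, Nat.sub_zero, hv]

/-- The semantics knows nothing of scratch registers, so the machine runs from a state `σ'` that
agrees with `σ` only below `b₀` and in memory. That registers from `b₀` up to `b` are kept protects
the counters of enclosing loops. The bound on the final registers is carried along to serve the
following statement. -/
theorem compile_within (p : Stmt) {B b₀ : ℕ} (hb₀ : p.bound ≤ b₀) (hv : p.valid = true) (b : ℕ)
    (hb : b₀ ≤ b) (σ σ' : State) (hr : ∀ r < b₀, σ'.reg r = σ.reg r) (hm : σ'.mem = σ.mem)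
    (hB : ∀ r < b₀, σ.reg r ≤ B) (hs : p.Small B σ) :
    Within (p.compile b) σ' (p.cost B) (fun τ =>
      (∀ r < b₀, τ.reg r = (p.exec σ).reg r) ∧ (∀ r < b, b₀ ≤ r → τ.reg r = σ'.reg r) ∧
        τ.mem = (p.exec σ).mem) ∧
    ∀ r < b₀, (p.exec σ).reg r ≤ B := by
  induction p generalizing σ σ' b with
  | assign x e =>
    simp only [bound, sup_le_iff] at hb₀
    refine ⟨Within.seq ((e.compile_within hb₀.2 b hb σ' fun r h => (hr r h).trans_le
      (hB r h)).mono le_rfl fun τ hτ => Within.instr ⟨fun r h => ?_, fun r h h' => ?_, ?_⟩),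
      fun r h => ?_⟩
    · have he := e.eval_congr_reg σ.mem fun r h => hr r (by omega)
      rcases eq_or_ne r x with rfl | hx
      · simp [Instr.apply, exec, hτ.1, hm, he]
      · simp [Instr.apply, exec, hx, hτ.2.1 r (by omega), hr r h]
    · simp [Instr.apply, hτ.2.1 r h, show r ≠ x by omega]
    · simp [Instr.apply, exec, hτ.2.2, hm]
    · rcases eq_or_ne r x with rfl | hx
      · simpa [exec, Small] using hs
      · simpa [exec, hx] using hB r h
  | store k e₁ e₂ =>
    simp only [bound, sup_le_iff] at hb₀
    have hr' : ∀ τ : State, (∀ r < b, τ.reg r = σ'.reg r) → ∀ r < b₀, τ.reg r = σ.reg r :=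
      fun τ h r h' => (h r (by omega)).trans (hr r h')
    refine ⟨Within.seq ((e₁.compile_within hb₀.1 b hb σ' fun r h => (hr r h).trans_le
      (hB r h)).mono le_rfl fun τ hτ => Within.seq ((e₂.compile_within hb₀.2 (b + 1) (by omega) τ
      fun r h => (hr' τ hτ.2.1 r h).trans_le (hB r h)).mono le_rfl
      fun υ hυ => Within.instr ⟨fun r h => ?_, fun r h h' => ?_, ?_⟩)), fun r h => hB r h⟩
    · simp [Instr.apply, exec, hυ.2.1 r (by omega), hτ.2.1 r (by omega), hr r h]
    · simp [Instr.apply, hυ.2.1 r (by omega), hτ.2.1 r (by omega)]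
    · have he := e₁.eval_congr_reg σ.mem fun r h => hr r (by omega)
      have he' := e₂.eval_congr_reg σ.mem fun r h => hr' τ hτ.2.1 r (by omega)
      simp [Instr.apply, exec, hυ.2.2, hυ.1, hυ.2.1 b, hτ.1, hτ.2.2, hm, he, he']
  | tab k x r y s e =>
    simp only [bound, sup_le_iff] at hb₀
    simp only [valid, Bool.and_eq_true, bne_iff_ne] at hv
    refine ⟨(tab_within hv.1 hv.2 (by omega) (by omega) (by omega) (by omega) hb₀.2 hb σ'
      fun r h => (hr r h).trans_le (hB r h)).mono le_rfl fun τ hτ =>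
        ⟨fun t h => ?_, fun t h _ => hτ.1 t h, ?_⟩, fun r h => hB r h⟩
    · rw [hτ.1 t (by omega)]; exact hr t h
    · rw [hτ.2]
      simp only [exec, hm, hr r (by omega), hr s (by omega)]
      congr 2
      funext a
      refine e.eval_congr_reg _ fun t ht => ?_
      simp only [Function.update_apply, hr t (by omega)]
  | seq p q hp hq =>
    simp only [bound, sup_le_iff] at hb₀
    simp only [valid, Bool.and_eq_true] at hv
    obtain ⟨h1, h2⟩ := hp hb₀.1 hv.1 b hb σ σ' hr hm hB hs.1
    refine ⟨Within.seq (h1.mono le_rfl fun τ hτ =>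
      (hq hb₀.2 hv.2 b hb _ τ hτ.1 hτ.2.2 h2 hs.2).1.mono le_rfl fun υ hυ =>
        ⟨hυ.1, fun r h h' => (hυ.2.1 r h h').trans (hτ.2.1 r h h'), hυ.2.2⟩),
      (hq hb₀.2 hv.2 b hb _ _ (fun _ _ => rfl) rfl h2 hs.2).2⟩
  | iter s p hp =>
    simp only [bound, sup_le_iff] at hb₀
    have hsB := hB s (by omega)
    -- The bound `B` has to be known after every number of rounds before the compiled loop can be
    -- analysed.
    have hall : ∀ i ≤ σ.reg s, ∀ r < b₀, (p.exec^[i] σ).reg r ≤ B := by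
      intro i
      induction i with
      | zero => exact fun _ => hB
      | succ i ih =>
        intro hi
        rw [Function.iterate_succ_apply']
        exact (hp hb₀.2 hv b hb _ _ (fun _ _ => rfl) rfl (ih (by omega)) (hs i hi)).2
    refine ⟨?_, hall _ le_rfl⟩
    rw [show (iter s p).cost B = 1 + (B * ((p.cost B + (1 + 1)) + 1) + 1) by
      simp only [cost, Nat.reduceAdd, add_assoc]; omega]
    refine Within.seq (Within.instr ?_)
    refine (Within.loop (c := p.cost B + (1 + 1)) (fun i υ => υ.reg b = i ∧ i ≤ σ.reg s ∧
      (∀ r < b₀, υ.reg r = (p.exec^[σ.reg s - i] σ).reg r) ∧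
      (∀ r < b, b₀ ≤ r → υ.reg r = σ'.reg r) ∧
      υ.mem = (p.exec^[σ.reg s - i] σ).mem) (fun i σ h => h.1) ?_ (σ.reg s) _ ?_).mono
      (by gcongr) ?_
    · rintro i υ ⟨h1, h2, h3, h4, h5⟩
      refine Within.seq ((hp hb₀.2 hv (b + 2) (by omega) _ υ h3 h5 (hall _ (by omega))
        (hs _ (by omega))).1.mono le_rfl fun τ hτ => Within.seq (Within.instr (Within.instr ?_)))
      rw [← Function.iterate_succ_apply' p.exec,
        show (σ.reg s - (i + 1)).succ = σ.reg s - i by omega] at hτ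
      refine ⟨?_, by omega, fun r h => ?_, fun r h h' => ?_, hτ.2.2⟩
      · simp [Instr.apply, hτ.2.1 b (by omega) hb, h1]
      · simp only [Instr.apply]
        rw [Function.update_of_ne (by omega), Function.update_of_ne (by omega), hτ.1 r h]
      · simp only [Instr.apply]
        rw [Function.update_of_ne (by omega), Function.update_of_ne (by omega),
          hτ.2.1 r (by omega) h', h4 r h h']
    · refine ⟨by simp [Instr.apply, hr s (by omega)], le_rfl, fun r h => ?_, fun r h h' => ?_, ?_⟩
      · simp [Instr.apply, show r ≠ b by omega, hr r h]
      · simp [Instr.apply, h.ne]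
      · simp [Instr.apply, hm]
    · rintro υ ⟨h1, h2, h3, h4, h5⟩
      exact ⟨h3, h4, h5⟩

end Stmt

end RAM

/-! ## Modules of distance functions and kernels -/

/-- `M` is a module of `K`: the vertices outside of `M` do not distinguish vertices of `M`. -/
def IsModule {α : Type*} (d : α → α → ℕ) (K M : Finset α) : Prop :=
  M ⊆ K ∧ ∀ x ∈ K, x ∉ M → ∀ y ∈ M, ∀ z ∈ M, d x y = d x z

/-- Two `k`-tuples have the same distances. -/
def SameDist (d : ℕ → ℕ → ℕ) (k : ℕ) (t t' : ℕ → ℕ) : Prop :=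
  ∀ i < k, ∀ j < k, d (t i) (t j) = d (t' i) (t' j)

theorem SameDist.trans {d : ℕ → ℕ → ℕ} {k : ℕ} {t t' t'' : ℕ → ℕ} (h : SameDist d k t t')
    (h' : SameDist d k t' t'') : SameDist d k t t'' :=
  fun i hi j hj => (h i hi j hj).trans (h' i hi j hj)

theorem SameDist.symm {d : ℕ → ℕ → ℕ} {k : ℕ} {t t' : ℕ → ℕ} (h : SameDist d k t t') :
    SameDist d k t' t :=
  fun i hi j hj => (h i hi j hj).symm

/-- An inflationary map on the subsets of an `n`-element set becomes stationary within `n` steps. -/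
theorem iterate_isFixedPt {α : Type*} [DecidableEq α] (U : Finset α) (f : Finset α → Finset α)
    (h : ∀ s ⊆ U, s ⊆ f s ∧ f s ⊆ U) (s : Finset α) (hs : s ⊆ U) {n : ℕ} (hn : U.card ≤ n) :
    f (f^[n] s) = f^[n] s := by
  have hU : ∀ i, f^[i] s ⊆ U := by
    intro i
    induction i with
    | zero => exact hs
    | succ i ih => rw [Function.iterate_succ_apply']; exact (h _ ih).2
  -- Until it is stationary, the sequence gains at least one element in each step.
  have key : ∀ i, f (f^[i] s) = f^[i] s ∨ i ≤ (f^[i] s).card := by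
    intro i
    induction i with
    | zero => exact .inr (Nat.zero_le _)
    | succ i ih =>
      rw [Function.iterate_succ_apply']
      by_cases hf : f (f^[i] s) = f^[i] s
      · left; rw [hf, hf]
      · right
        have h1 := ih.resolve_left hf
        have h2 := Finset.card_lt_card ((h _ (hU i)).1.ssubset_of_ne (Ne.symm hf))
        omega
  rcases key n with h1 | h1
  · exact h1
  · have h2 : f^[n] s = U := Finset.eq_of_subset_of_card_le (hU n) (hn.trans h1)
    have h3 := h _ (hU n)
    rw [h2] at h3 ⊢
    exact h3.2.antisymm h3.1

/-- One step of the computation of the least module that contains `u`. -/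
def closeStep {α : Type*} [DecidableEq α] (d : α → α → ℕ) (K : Finset α) (u : α) (s : Finset α) :
    Finset α :=
  s ∪ K.filter fun x => ∃ y ∈ s, d x y ≠ d x u

/-- A module containing `u` absorbs each step: a vertex outside it has the same distance from `u` as
from every other member, so it is never added. The closure of a pair is thus below every module that
contains the pair. -/
theorem closeStep_subset_module {α : Type*} [DecidableEq α] {d : α → α → ℕ} {K M : Finset α} {u : α}
    (hM : IsModule d K M) (hu : u ∈ M) {s : Finset α} (hs : s ⊆ M) (i : ℕ) :
    (closeStep d K u)^[i] s ⊆ M := by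
  induction i with
  | zero => exact hs
  | succ i ih =>
    rw [Function.iterate_succ_apply']
    refine Finset.union_subset ih fun x hx => ?_
    obtain ⟨hx, y, hy, hne⟩ := Finset.mem_filter.1 hx
    by_contra h
    exact hne (hM.2 x hx h y (ih hy) u hu)

theorem subset_closeStep_iterate {α : Type*} [DecidableEq α] (d : α → α → ℕ) (K : Finset α) (u : α)
    (s : Finset α) (i : ℕ) : s ⊆ (closeStep d K u)^[i] s := by
  induction i with
  | zero => exact subset_rfl
  | succ i ih =>
    rw [Function.iterate_succ_apply']
    exact ih.trans Finset.subset_union_left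

/-- At the fixed point an outside vertex has the same distance from each member as from `u`, hence
the same distance from any two members. -/
theorem closeStep_isModule {α : Type*} [DecidableEq α] (d : α → α → ℕ) {K s : Finset α} {u : α}
    (hs : s ⊆ K) {n : ℕ} (hn : K.card ≤ n) :
    IsModule d K ((closeStep d K u)^[n] s) := by
  have hfix := iterate_isFixedPt K (closeStep d K u)
    (fun t ht => ⟨Finset.subset_union_left, Finset.union_subset ht (Finset.filter_subset _ _)⟩) s hs hn
  have hK : ∀ i, (closeStep d K u)^[i] s ⊆ K := fun i => by
    induction i with
    | zero => exact hs
    | succ i ih =>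
      rw [Function.iterate_succ_apply']
      exact Finset.union_subset ih (Finset.filter_subset _ _)
  refine ⟨hK n, fun x hx hxM y hy z hz => ?_⟩
  have : ∀ y ∈ (closeStep d K u)^[n] s, d x y = d x u := by
    intro y hy
    by_contra hne
    apply hxM
    rw [← hfix]
    exact Finset.mem_union_right _ (Finset.mem_filter.2 ⟨hx, y, hy, hne⟩)
  rw [this y hy, this z hz]

/-! ### The representatives of a family of tuples -/

open Classical in
/-- The vertices of those of the first `T` tuples that differ from all earlier ones. -/
noncomputable def keptVerts (d : ℕ → ℕ → ℕ) (k T : ℕ) (τ : ℕ → ℕ → ℕ) : Finset ℕ :=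
  ((Finset.range T).filter fun j => ∀ j' < j, ¬ SameDist d k (τ j') (τ j)).biUnion
    fun j => (Finset.range k).image (τ j)

theorem mem_keptVerts {d : ℕ → ℕ → ℕ} {k T : ℕ} {τ : ℕ → ℕ → ℕ} {x : ℕ} :
    x ∈ keptVerts d k T τ ↔
      ∃ j < T, (∃ i < k, τ j i = x) ∧ ∀ j' < j, ¬ SameDist d k (τ j') (τ j) := by
  simp only [keptVerts, Finset.mem_biUnion, Finset.mem_filter, Finset.mem_range, Finset.mem_image]
  exact ⟨fun ⟨j, ⟨h1, h2⟩, h3⟩ => ⟨j, h1, h3, h2⟩, fun ⟨j, h1, h3, h2⟩ => ⟨j, ⟨h1, h2⟩, h3⟩⟩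

/-- The first tuple with the given distance matrix is always kept. -/
theorem exists_sameDist_keptVerts {d : ℕ → ℕ → ℕ} {k T : ℕ} {τ : ℕ → ℕ → ℕ} {j : ℕ} (hj : j < T) :
    ∃ t : ℕ → ℕ, (∀ i < k, t i ∈ keptVerts d k T τ) ∧ SameDist d k (τ j) t := by
  classical
  have hex : ∃ j', SameDist d k (τ j') (τ j) := ⟨j, fun _ _ _ _ => rfl⟩
  have hle : Nat.find hex ≤ j := Nat.find_min' hex fun _ _ _ _ => rfl
  refine ⟨τ (Nat.find hex), fun i hi => mem_keptVerts.2 ⟨_, by omega, ⟨i, hi, rfl⟩, ?_⟩,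
    (Nat.find_spec hex).symm⟩
  intro j' hj' h
  exact Nat.find_min hex hj' (h.trans (Nat.find_spec hex))

/-- Kept tuples have pairwise different distance matrices with entries below `q`, so there are at
most `q ^ (k * k)` of them, each with at most `k` vertices. -/
theorem card_keptVerts_le {d : ℕ → ℕ → ℕ} {k T q : ℕ} {τ : ℕ → ℕ → ℕ}
    (hq : ∀ j < T, ∀ i < k, ∀ i' < k, d (τ j i) (τ j i') < q) :
    (keptVerts d k T τ).card ≤ k * q ^ (k * k) := by
  classical
  set J := (Finset.range T).filter fun j => ∀ j' < j, ¬ SameDist d k (τ j') (τ j) with hJ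
  have hJc : J.card ≤ q ^ (k * k) := by
    have : J.card ≤ (Fintype.piFinset fun _ : Fin k × Fin k => Finset.range q).card := by
      refine Finset.card_le_card_of_injOn (fun j p => d (τ j p.1) (τ j p.2)) (fun j hj => ?_)
        fun j hj j' hj' he => ?_
      · rw [Finset.mem_coe, Finset.mem_filter, Finset.mem_range] at hj
        rw [Finset.mem_coe, Fintype.mem_piFinset]
        exact fun p => Finset.mem_range.2 (hq j hj.1 _ p.1.2 _ p.2.2)
      · have hs : SameDist d k (τ j) (τ j') := fun a ha b hb => congrFun he (⟨a, ha⟩, ⟨b, hb⟩)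
        have h1 := (Finset.mem_filter.1 (Finset.mem_coe.1 hj)).2
        have h2 := (Finset.mem_filter.1 (Finset.mem_coe.1 hj')).2
        by_contra hne
        rcases lt_or_gt_of_ne hne with h | h
        · exact h2 j h hs
        · exact h1 j' h hs.symm
    simpa using this
  calc (keptVerts d k T τ).card ≤ J.card * k :=
        Finset.card_biUnion_le_card_mul _ _ _ fun j _ => Finset.card_image_le.trans (by simp)
    _ ≤ k * q ^ (k * k) := by rw [mul_comm]; gcongr

/-! ### Partitions into small modules -/

/-- `rep` describes a set of at most `n` vertices that contains a copy of each `k`-tuple, and a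
partition of this set into modules of at most `g` vertices: `rep x` is the representative of the
part of `x` if `x` belongs to the set, and at least `n` otherwise. -/
structure IsKernel (d : ℕ → ℕ → ℕ) (n k g : ℕ) (rep : ℕ → ℕ) : Prop where
  idem : ∀ x < n, rep x < n → rep (rep x) = rep x
  module : ∀ x < n, ∀ y < n, ∀ z < n, rep x < n → rep y < n → rep y = rep z → rep x ≠ rep y →
    d x y = d x z
  card_le : ∀ r < n, ((Finset.range n).filter fun x => rep x = r).card ≤ g
  cover : ∀ t : ℕ → ℕ, (∀ i < k, t i < n) →
    ∃ t' : ℕ → ℕ, (∀ i < k, t' i < n ∧ rep (t' i) < n) ∧ SameDist d k t t'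

/-- The representatives of the parts. -/
def repSet (n : ℕ) (rep : ℕ → ℕ) : Finset ℕ := (Finset.range n).filter fun x => rep x = x

/-- The union of the parts that are represented in `S`. -/
def partUnion (n : ℕ) (rep : ℕ → ℕ) (S : Finset ℕ) : Finset ℕ :=
  (Finset.range n).filter fun x => rep x ∈ S

theorem mem_repSet {n : ℕ} {rep : ℕ → ℕ} {x : ℕ} : x ∈ repSet n rep ↔ x < n ∧ rep x = x := by
  simp [repSet]

theorem mem_partUnion {n : ℕ} {rep : ℕ → ℕ} {S : Finset ℕ} {x : ℕ} :
    x ∈ partUnion n rep S ↔ x < n ∧ rep x ∈ S := by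
  simp [partUnion]

theorem isKernel_id {d : ℕ → ℕ → ℕ} {n k g : ℕ} (hg : 1 ≤ g) : IsKernel d n k g fun x => x where
  idem _ _ _ := rfl
  module x _ y _ z _ _ _ h _ := by rw [h]
  card_le r _ := by
    refine (Finset.card_le_one.2 fun a ha b hb => ?_).trans hg
    rw [(Finset.mem_filter.1 ha).2, (Finset.mem_filter.1 hb).2]
  cover t ht := ⟨t, fun i hi => ⟨ht i hi, ht i hi⟩, fun _ _ _ _ => rfl⟩

theorem IsKernel.card_partUnion_le {d : ℕ → ℕ → ℕ} {n k g : ℕ} {rep : ℕ → ℕ}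
    (h : IsKernel d n k g rep) {S : Finset ℕ} (hS : S ⊆ repSet n rep) :
    (partUnion n rep S).card ≤ S.card * g := by
  have : partUnion n rep S = S.biUnion fun r => (Finset.range n).filter fun x => rep x = r := by
    ext x
    simp only [mem_partUnion, Finset.mem_biUnion, Finset.mem_filter, Finset.mem_range]
    constructor
    · exact fun ⟨h1, h2⟩ => ⟨_, h2, h1, rfl⟩
    · rintro ⟨r, hr, h1, rfl⟩; exact ⟨h1, hr⟩
  rw [this]
  exact Finset.card_biUnion_le_card_mul _ _ _ fun r hr => h.card_le r (mem_repSet.1 (hS hr)).1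

/-- Distances between different parts equal those between their representatives: the module property
is applied once on either side, with symmetry of `d` in between. So a module of representatives
lifts to the union of its parts. -/
theorem IsKernel.isModule_partUnion {d : ℕ → ℕ → ℕ} {n k g : ℕ} {rep : ℕ → ℕ}
    (hd : ∀ x y, d x y = d y x) (h : IsKernel d n k g rep) {S : Finset ℕ}
    (hS : IsModule d (repSet n rep) S) :
    ∀ x < n, rep x < n → rep x ∉ S → ∀ y ∈ partUnion n rep S, ∀ z ∈ partUnion n rep S,
      d x y = d x z := by
  intro x hx hxn hxS
  have key : ∀ y ∈ partUnion n rep S, d x y = d (rep x) (rep y) := by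
    intro y hy
    obtain ⟨hy, hyS⟩ := mem_partUnion.1 hy
    have hyn : rep y < n := (mem_repSet.1 (hS.1 hyS)).1
    have hne : rep x ≠ rep y := fun he => hxS (he ▸ hyS)
    have hyi := h.idem y hy hyn
    have hxi := h.idem x hx hxn
    rw [h.module x hx y hy (rep y) hyn hxn hyn hyi.symm hne, hd x, hd (rep x)]
    exact h.module _ hyn x hx _ hxn (by rwa [hyi]) hxn hxi.symm (by rw [hyi]; exact hne.symm)
  intro y hy z hz
  rw [key y hy, key z hz]
  exact hS.2 _ (mem_repSet.2 ⟨hxn, h.idem x hx hxn⟩) hxS _ (mem_partUnion.1 hy).2 _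
    (mem_partUnion.1 hz).2

open Classical in
/-- The parts that are represented in `S` are replaced by a single part `C'` that is represented
by `r`. -/
noncomputable def mergeParts (n : ℕ) (rep : ℕ → ℕ) (S C' : Finset ℕ) (r : ℕ) (x : ℕ) : ℕ :=
  if rep x ∈ S then if x ∈ C' then r else n else rep x

/-- The replacement step. A tuple is split into its entries inside and outside of the union of the
parts in `S`; the inner entries are replaced by a copy in `C'`. Distances among inner entries are
those of the copy, and mixed distances do not change because the union is a module among the
surviving vertices. -/
theorem IsKernel.merge {d : ℕ → ℕ → ℕ} {n k g : ℕ} {rep : ℕ → ℕ}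
    (hd : ∀ x y, d x y = d y x) (h : IsKernel d n k g rep) {S C' : Finset ℕ} {r : ℕ}
    (hS : IsModule d (repSet n rep) S) (hC' : C' ⊆ partUnion n rep S) (hr : C'.Nonempty → r ∈ C')
    (hg : C'.card ≤ g)
    (hcov : ∀ t : ℕ → ℕ, (∀ i < k, t i ∈ partUnion n rep S) →
      ∃ t' : ℕ → ℕ, (∀ i < k, t' i ∈ C') ∧ SameDist d k t t') :
    IsKernel d n k g (mergeParts n rep S C' r) := by
  classical
  have hmod := h.isModule_partUnion hd hS
  have hrS : ∀ x ∈ C', rep r ∈ S ∧ r < n ∧ r ∈ C' := fun x hx =>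
    ⟨(mem_partUnion.1 (hC' (hr ⟨x, hx⟩))).2, (mem_partUnion.1 (hC' (hr ⟨x, hx⟩))).1, hr ⟨x, hx⟩⟩
  have hSn : ∀ x ∈ S, x < n ∧ rep x = x := fun x hx => mem_repSet.1 (hS.1 hx)
  have hm1 : ∀ x, rep x ∈ S → mergeParts n rep S C' r x < n → x ∈ C' := by
    intro x hx h'
    by_contra hc
    simp [mergeParts, hx, hc] at h'
  have hm2 : ∀ x, x ∈ C' → mergeParts n rep S C' r x = r := by
    intro x hx
    simp [mergeParts, hx, (mem_partUnion.1 (hC' hx)).2]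
  have hm3 : ∀ x, rep x ∉ S → mergeParts n rep S C' r x = rep x := by
    intro x hx
    simp [mergeParts, hx]
  -- A surviving vertex either lies in the new part or keeps its old part outside of `S`.
  have hm4 : ∀ x, x < n → mergeParts n rep S C' r x < n →
      (x ∈ C' ∧ mergeParts n rep S C' r x = r) ∨
      (rep x ∉ S ∧ rep x < n ∧ mergeParts n rep S C' r x = rep x) := by
    intro x hx hxn
    by_cases hxS : rep x ∈ S
    · exact .inl ⟨hm1 x hxS hxn, hm2 x (hm1 x hxS hxn)⟩
    · refine .inr ⟨hxS, ?_, hm3 x hxS⟩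
      rwa [hm3 x hxS] at hxn
  refine ⟨fun x hx hxn => ?_, fun x hx y hy z hz hxn hyn hyz hxy => ?_, fun s hs => ?_, fun t ht => ?_⟩
  · rcases hm4 x hx hxn with ⟨h1, h2⟩ | ⟨h1, h2, h3⟩
    · rw [h2, hm2 r (hrS x h1).2.2]
    · rw [h3, hm3 _ (by rwa [h.idem x hx h2]), h.idem x hx h2]
  · have hzn := hyn
    rw [hyz] at hzn
    rcases hm4 x hx hxn with ⟨hx1, hx2⟩ | ⟨hx1, hx2, hx3⟩ <;>
    rcases hm4 y hy hyn with ⟨hy1, hy2⟩ | ⟨hy1, hy2, hy3⟩ <;>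
    rcases hm4 z hz hzn with ⟨hz1, hz2⟩ | ⟨hz1, hz2, hz3⟩
    · exact absurd (hx2.trans hy2.symm) hxy
    · exact absurd (hx2.trans hy2.symm) hxy
    · refine absurd (hx2.trans (hz2.symm.trans hyz.symm)) hxy
    · refine h.module x hx y hy z hz ?_ hy2 (hy3.symm.trans (hyz.trans hz3)) ?_
      · exact (hSn _ (mem_partUnion.1 (hC' hx1)).2).1
      · intro he
        exact hy1 (he ▸ (mem_partUnion.1 (hC' hx1)).2)
    · exact hmod x hx hx2 hx1 y (hC' hy1) z (hC' hz1)
    -- The new representative `r` cannot coincide with the representative of an untouched part: that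
    -- would be its own representative and lie outside of `S`, whereas `rep r` is in `S`.
    · exfalso
      rw [hy2, hz3] at hyz
      have := h.idem z hz hz2
      rw [← hyz] at this
      exact hz1 (hyz ▸ (by rw [← this]; exact (hrS y hy1).1))
    · exfalso
      rw [hy3, hz2] at hyz
      have := h.idem y hy hy2
      rw [hyz] at this
      exact hy1 (hyz ▸ (by rw [← this]; exact (hrS z hz1).1))
    · exact h.module x hx y hy z hz hx2 hy2 (hy3.symm.trans (hyz.trans hz3))
        (by rw [← hx3, ← hy3]; exact hxy)
  · by_cases hrs : s = r ∧ C'.Nonempty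
    · refine (Finset.card_le_card fun x hx => ?_).trans hg
      obtain ⟨hx, hxs⟩ := Finset.mem_filter.1 hx
      rw [Finset.mem_range] at hx
      rcases hm4 x hx (by rwa [hxs]) with ⟨h1, h2⟩ | ⟨h1, h2, h3⟩
      · exact h1
      · exfalso
        have h4 := h.idem x hx h2
        rw [← h3, hxs, hrs.1] at h4
        obtain ⟨y, hy⟩ := hrs.2
        refine h1 ?_
        rw [← h3, hxs, hrs.1, ← h4]
        exact (hrS y hy).1
    · refine (Finset.card_le_card fun x hx => ?_).trans (h.card_le s hs)
      obtain ⟨hx, hxs⟩ := Finset.mem_filter.1 hx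
      refine Finset.mem_filter.2 ⟨hx, ?_⟩
      rw [Finset.mem_range] at hx
      rcases hm4 x hx (by rwa [hxs]) with ⟨h1, h2⟩ | ⟨h1, h2, h3⟩
      · exact absurd ⟨hxs.symm.trans h2, ⟨x, h1⟩⟩ hrs
      · rw [← h3, hxs]
  · obtain ⟨u, hu, hut⟩ := h.cover t ht
    by_cases hex : ∃ i₀ < k, rep (u i₀) ∈ S
    · obtain ⟨i₀, hi₀, hS₀⟩ := hex
      -- Copies are available only for full `k`-tuples in the union, so positions outside are padded
      -- with the vertex `u i₀` and ignored afterwards.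
      obtain ⟨v, hv, huv⟩ := hcov (fun i => if rep (u i) ∈ S then u i else u i₀) (fun i hi => by
        split_ifs with hc
        · exact mem_partUnion.2 ⟨(hu i hi).1, hc⟩
        · exact mem_partUnion.2 ⟨(hu i₀ hi₀).1, hS₀⟩)
      refine ⟨fun i => if rep (u i) ∈ S then v i else u i, fun i hi => ?_, hut.trans ?_⟩
      · beta_reduce
        split_ifs with hc
        · have := hv i hi
          rw [hm2 _ this]
          exact ⟨(mem_partUnion.1 (hC' this)).1, (hrS _ this).2.1⟩
        · rw [hm3 _ hc]; exact hu i hi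
      · intro i hi j hj
        have hij := huv i hi j hj
        by_cases h1 : rep (u i) ∈ S <;> by_cases h2 : rep (u j) ∈ S <;>
          simp only [h1, h2, if_true, if_false] at hij ⊢
        · exact hij
        · rw [hd _ (u j), hd _ (u j)]
          exact hmod _ (hu j hj).1 (hu j hj).2 h2 _ (mem_partUnion.2 ⟨(hu i hi).1, h1⟩) _
            (hC' (hv i hi))
        · exact hmod _ (hu i hi).1 (hu i hi).2 h1 _ (mem_partUnion.2 ⟨(hu j hj).1, h2⟩) _
            (hC' (hv j hj))
    · push Not at hex
      refine ⟨u, fun i hi => ⟨(hu i hi).1, ?_⟩, hut⟩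
      rw [hm3 _ (hex i hi)]; exact (hu i hi).2

/-- All of `S` disappears as representatives and at most `r` is new; deleted vertices carry the
value `n` and represent nothing. -/
theorem card_repSet_merge {n : ℕ} {rep : ℕ → ℕ} {S C' : Finset ℕ} {r : ℕ}
    (hS : S ⊆ repSet n rep) :
    (repSet n (mergeParts n rep S C' r)).card + S.card ≤ (repSet n rep).card + 1 := by
  classical
  have : repSet n (mergeParts n rep S C' r) ⊆ insert r (repSet n rep \ S) := by
    intro x hx
    obtain ⟨hx, hxr⟩ := mem_repSet.1 hx
    simp only [mergeParts] at hxr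
    split_ifs at hxr with h1 h2
    · simp [hxr]
    · omega
    · refine Finset.mem_insert_of_mem (Finset.mem_sdiff.2 ⟨mem_repSet.2 ⟨hx, hxr⟩, ?_⟩)
      rwa [hxr] at h1
  have h1 := (Finset.card_le_card this).trans (Finset.card_insert_le _ _)
  have h2 := Finset.card_sdiff_add_card_eq_card hS
  omega

/-! ## Modules of graphs of small modular-width -/

theorem card_filter_mem_image {α β : Type*} (f : α → β) (hf : Function.Injective f)
    (K : Finset β) (M : Set α) [DecidablePred (· ∈ f '' M)] [DecidablePred (· ∈ M)] :
    (K.filter (· ∈ f '' M)).card = ((K.preimage f hf.injOn).filter (· ∈ M)).card := by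
  classical
  rw [← Finset.card_image_of_injective _ hf]
  congr 1
  ext x
  simp only [Finset.mem_filter, Finset.mem_image, Finset.mem_preimage, Set.mem_image]
  constructor
  · rintro ⟨hx, a, ha, rfl⟩; exact ⟨a, ⟨hx, ha⟩, rfl⟩
  · rintro ⟨a, ⟨hx, ha⟩, rfl⟩; exact ⟨hx, a, ha, rfl⟩

open Classical in
-- If some part contains two elements of `K`, a module of that part is a module of the whole, as
-- vertices outside the part do not distinguish its vertices. Otherwise `K` has at most one element
-- in each part, hence at most `w` elements, and the set of all vertices serves as the module.
theorem exists_module_of_parts {ι α : Type*} [Fintype ι] {β : ι → Type*} (f : ∀ i, β i → α)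
    (hf : ∀ i, Function.Injective (f i)) (hcov : ∀ a, ∃ i b, f i b = a) (adj : α → α → Prop)
    (adj' : ∀ i, β i → β i → Prop) {w : ℕ}
    (hout : ∀ i, ∀ x ∉ Set.range (f i), ∀ y z, adj x (f i y) ↔ adj x (f i z))
    (hin : ∀ i x y, adj (f i x) (f i y) ↔ adj' i x y)
    (ih : ∀ i, ∀ K : Finset (β i), 2 ≤ K.card →
      ∃ M : Set (β i), (∀ x ∉ M, ∀ y ∈ M, ∀ z ∈ M, adj' i x y ↔ adj' i x z) ∧
        2 ≤ (K.filter (· ∈ M)).card ∧ (K.filter (· ∈ M)).card ≤ w)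
    (hι : Fintype.card ι ≤ w) (K : Finset α) (hK : 2 ≤ K.card) :
    ∃ M : Set α, (∀ x ∉ M, ∀ y ∈ M, ∀ z ∈ M, adj x y ↔ adj x z) ∧
      2 ≤ (K.filter (· ∈ M)).card ∧ (K.filter (· ∈ M)).card ≤ w := by
  by_cases hc : ∃ i, 2 ≤ (K.preimage (f i) (hf i).injOn).card
  · obtain ⟨i, hi⟩ := hc
    obtain ⟨M, hM, hM2, hMw⟩ := ih i _ hi
    refine ⟨f i '' M, ?_, by rwa [card_filter_mem_image _ (hf i)],
      by rwa [card_filter_mem_image _ (hf i)]⟩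
    rintro x hx _ ⟨y, hy, rfl⟩ _ ⟨z, hz, rfl⟩
    by_cases hx' : x ∈ Set.range (f i)
    · obtain ⟨x, rfl⟩ := hx'
      rw [hin, hin]
      exact hM x (fun h => hx ⟨x, h, rfl⟩) y hy z hz
    · exact hout i x hx' y z
  · have hu : ∀ inst : DecidablePred (· ∈ (Set.univ : Set α)),
        (@Finset.filter α (· ∈ (Set.univ : Set α)) inst K).card = K.card := by
      intro inst
      rw [Finset.filter_true_of_mem fun x _ => Set.mem_univ x]
    refine ⟨Set.univ, fun x hx => absurd (Set.mem_univ x) hx, hK.trans (hu _).ge, (hu _).le.trans (le_trans ?_ hι)⟩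
    choose g b hgb using hcov
    refine Finset.card_le_card_of_injOn g (fun _ _ => Finset.mem_coe.2 (Finset.mem_univ _)) ?_
    intro x hx y hy h
    have h1 : (K.preimage (f (g x)) (hf (g x)).injOn).card ≤ 1 := by
      have := not_exists.1 hc (g x)
      omega
    obtain ⟨c, hc⟩ : ∃ c, f (g x) c = y := h ▸ ⟨b y, hgb y⟩
    rw [← hgb x, ← hc, Finset.card_le_one.1 h1 (b x) (Finset.mem_preimage.2 ?_) c
      (Finset.mem_preimage.2 ?_)]
    · rw [hgb]; exact hx
    · rw [hc]; exact hy

open Classical in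
-- Only the elements of `K` in the module are counted; the module itself may be large. Unions and
-- joins have two operands but do not count for the width, whence the hypothesis `2 ≤ w`.
theorem ModularExpr.exists_module (e : ModularExpr) {w : ℕ} (hw : e.width ≤ w) (h2 : 2 ≤ w)
    (K : Finset e.Verts) (hK : 2 ≤ K.card) :
    ∃ M : Set e.Verts, (∀ x ∉ M, ∀ y ∈ M, ∀ z ∈ M, e.Adj x y ↔ e.Adj x z) ∧
      2 ≤ (K.filter (· ∈ M)).card ∧ (K.filter (· ∈ M)).card ≤ w := by
  induction e with
  | vertex =>
    have : K.card ≤ 1 := Finset.card_le_one.2 fun a _ b _ => rfl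
    omega
  | union e₁ e₂ h₁ h₂ =>
    simp only [width, sup_le_iff] at hw
    refine exists_module_of_parts (ι := Bool) (β := fun b => (cond b e₁ e₂).Verts)
      (fun b => match b with | true => Sum.inl | false => Sum.inr) ?_ ?_ _
      (fun b => (cond b e₁ e₂).Adj) ?_ ?_ ?_ (by simpa using h2) K hK
    · rintro (_ | _)
      exacts [Sum.inr_injective, Sum.inl_injective]
    · rintro (a | a)
      exacts [⟨true, a, rfl⟩, ⟨false, a, rfl⟩]
    · rintro (_ | _) (x | x) hx y z
      exacts [Iff.rfl, absurd ⟨x, rfl⟩ hx, absurd ⟨x, rfl⟩ hx, Iff.rfl]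
    · rintro (_ | _) x y <;> exact Iff.rfl
    · rintro (_ | _)
      exacts [h₂ hw.2, h₁ hw.1]
  | join e₁ e₂ h₁ h₂ =>
    simp only [width, sup_le_iff] at hw
    refine exists_module_of_parts (ι := Bool) (β := fun b => (cond b e₁ e₂).Verts)
      (fun b => match b with | true => Sum.inl | false => Sum.inr) ?_ ?_ _
      (fun b => (cond b e₁ e₂).Adj) ?_ ?_ ?_ (by simpa using h2) K hK
    · rintro (_ | _)
      exacts [Sum.inr_injective, Sum.inl_injective]
    · rintro (a | a)
      exacts [⟨true, a, rfl⟩, ⟨false, a, rfl⟩]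
    · rintro (_ | _) (x | x) hx y z
      exacts [Iff.rfl, absurd ⟨x, rfl⟩ hx, absurd ⟨x, rfl⟩ hx, Iff.rfl]
    · rintro (_ | _) x y <;> exact Iff.rfl
    · rintro (_ | _)
      exacts [h₂ hw.2, h₁ hw.1]
  | subst n H e he =>
    simp only [width, sup_le_iff] at hw
    refine exists_module_of_parts (β := fun i => (e i).Verts) (fun i x => (⟨i, x⟩ : (i : Fin n) × (e i).Verts))
      (fun _ _ _ h => eq_of_heq (Sigma.mk.inj h).2) ?_ _ (fun i => (e i).Adj) ?_ ?_
      (fun i => he i ((Finset.le_sup (f := fun i => (e i).width) (Finset.mem_univ i)).trans hw.2))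
      (by simpa using hw.1) K hK
    · rintro ⟨i, x⟩
      exact ⟨i, x, rfl⟩
    · rintro i ⟨j, x⟩ hx y z
      refine or_congr_right ⟨?_, ?_⟩ <;>
      · rintro ⟨rfl, h⟩
        exact absurd ⟨x, rfl⟩ hx
    · intro i x y
      refine ⟨?_, fun h => .inr ⟨rfl, h⟩⟩
      rintro (h | ⟨_, h⟩)
      · exact absurd h (H.irrefl)
      · exact h

/-! ### Modules of the distance function and the bound on distances. -/

namespace SimpleGraph

theorem exists_expr_width_eq {n : ℕ} (G : SimpleGraph (Fin n)) :
    ∃ e : ModularExpr, e.width = G.modularWidth ∧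
      ∃ φ : Fin n ≃ e.Verts, ∀ u v, G.Adj u v ↔ e.Adj (φ u) (φ v) := by
  refine Nat.sInf_mem (s := {m | ∃ e : ModularExpr, e.width = m ∧
    ∃ φ : Fin n ≃ e.Verts, ∀ u v, G.Adj u v ↔ e.Adj (φ u) (φ v)}) ?_
  -- The infimum is attained because the set of widths is nonempty: every graph is its own pattern.
  refine ⟨_, .subst n G fun _ => .vertex, rfl,
    ⟨fun u => ⟨u, ()⟩, fun x => x.1, fun _ => rfl, fun _ => rfl⟩, fun u v => ⟨.inl, ?_⟩⟩
  rintro (h | ⟨_, h⟩)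
  · exact h
  · exact h.elim

/-- A walk from `x` to `z` enters `M` at some first edge. Its outer endpoint is adjacent to `y` as
well, so the walk can be cut there and redirected to `y`. -/
theorem dist_le_of_module {V : Type*} {G : SimpleGraph V} (hG : G.Connected) {M : Set V}
    (hM : ∀ x ∉ M, ∀ y ∈ M, ∀ z ∈ M, G.Adj x y ↔ G.Adj x z) {x y z : V} (hx : x ∉ M) (hy : y ∈ M)
    (hz : z ∈ M) : G.dist x y ≤ G.dist x z := by
  have key : ∀ {x z : V} (p : G.Walk x z), x ∉ M → z ∈ M → ∃ q : G.Walk x y, q.length ≤ p.length := by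
    intro x z p
    induction p with
    | nil => exact fun h h' => absurd h' h
    | @cons x x' z h p ih =>
      intro hx hz
      by_cases hx' : x' ∈ M
      · exact ⟨.cons ((hM x hx x' hx' y hy).1 h) .nil, by simp⟩
      · obtain ⟨q, hq⟩ := ih hx' hz
        exact ⟨.cons h q, by simpa using hq⟩
  obtain ⟨p, hp⟩ := hG.exists_walk_length_eq_dist x z
  obtain ⟨q, hq⟩ := key p hx hz
  exact (dist_le q).trans (hq.trans hp.le)

theorem exists_dist_module {n : ℕ} {G : SimpleGraph (Fin n)} (hG : G.Connected)
    (K : Finset (Fin n)) (hK : 2 ≤ K.card) :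
    ∃ M, IsModule G.dist K M ∧ 2 ≤ M.card ∧ M.card ≤ max G.modularWidth 2 := by
  classical
  obtain ⟨e, hw, φ, hφ⟩ := G.exists_expr_width_eq
  obtain ⟨M, hM, hM2, hMw⟩ := e.exists_module (w := max G.modularWidth 2)
    (hw.le.trans (le_max_left _ _)) (le_max_right _ _) (K.map φ.toEmbedding) (by simpa using hK)
  have hM' : ∀ x ∉ φ ⁻¹' M, ∀ y ∈ φ ⁻¹' M, ∀ z ∈ φ ⁻¹' M, G.Adj x y ↔ G.Adj x z := by
    intro x hx y hy z hz
    rw [hφ, hφ]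
    exact hM _ hx _ hy _ hz
  have hcard : (K.filter (· ∈ φ ⁻¹' M)).card = ((K.map φ.toEmbedding).filter (· ∈ M)).card := by
    rw [Finset.filter_map, Finset.card_map]
    rfl
  refine ⟨K.filter (· ∈ φ ⁻¹' M), ⟨Finset.filter_subset _ _, fun x hx hxM y hy z hz => ?_⟩,
    by convert hM2, by convert hMw⟩
  have hxM' : x ∉ φ ⁻¹' M := fun h => hxM (Finset.mem_filter.2 ⟨hx, h⟩)
  have hy' := (Finset.mem_filter.1 hy).2
  have hz' := (Finset.mem_filter.1 hz).2
  exact (dist_le_of_module hG hM' hxM' hy' hz').antisymm (dist_le_of_module hG hM' hxM' hz' hy')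

/-- Along a shortest walk no two vertices can be closer than their indices suggest, for otherwise
the triangle inequality would shorten the whole walk. -/
theorem Connected.exists_geodesic {V : Type*} {G : SimpleGraph V} (hG : G.Connected) (u v : V) :
    ∃ f : ℕ → V, ∀ i j, i ≤ j → j ≤ G.dist u v → G.dist (f i) (f j) = j - i := by
  obtain ⟨p, hp⟩ := hG.exists_walk_length_eq_dist u v
  have hle : ∀ i j, i ≤ j → G.dist (p.getVert i) (p.getVert j) ≤ j - i := by
    intro i j hij
    induction j, hij using Nat.le_induction with
    | base => simp
    | succ j hij ih =>
      have h1 : G.dist (p.getVert j) (p.getVert (j + 1)) ≤ 1 := by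
        by_cases h : j < p.length
        · exact (dist_eq_one_iff_adj.2 (p.adj_getVert_succ h)).le
        · rw [p.getVert_of_length_le (by omega), p.getVert_of_length_le (by omega)]; simp
      have := hG.dist_triangle (u := p.getVert i) (v := p.getVert j) (w := p.getVert (j + 1))
      omega
  refine ⟨p.getVert, fun i j hij hj => (hle i j hij).antisymm ?_⟩
  have h0 := hle 0 i (Nat.zero_le _)
  have h1 := hle j p.length (by omega)
  rw [p.getVert_zero] at h0
  rw [p.getVert_length] at h1
  have h2 := hG.dist_triangle (u := u) (v := p.getVert i) (w := p.getVert j)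
  have h3 := hG.dist_triangle (u := u) (v := p.getVert j) (w := v)
  omega

/-- On the vertex set of a geodesic of length at least 3, a module with two elements is everything,
so the number of vertices of the geodesic is at most `w`. -/
theorem dist_lt_of_modules {V : Type*} {G : SimpleGraph V} (hG : G.Connected) {w : ℕ}
    (h : ∀ K : Finset V, 2 ≤ K.card → ∃ M, IsModule G.dist K M ∧ 2 ≤ M.card ∧ M.card ≤ w) (u v : V) :
    G.dist u v < max w 3 := by
  classical
  obtain ⟨f, hf⟩ := hG.exists_geodesic u v
  set L := G.dist u v
  by_cases hL : L < 3
  · exact hL.trans_le (le_max_right _ _)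
  have hinj : Set.InjOn f (Finset.range (L + 1)) := by
    intro i hi j hj hij
    rw [Finset.mem_coe, Finset.mem_range] at hi hj
    rcases le_total i j with hle | hle
    · have := hf i j hle (by omega)
      rw [hij, dist_self] at this; omega
    · have := hf j i hle (by omega)
      rw [hij, dist_self] at this; omega
  have hcard : ((Finset.range (L + 1)).image f).card = L + 1 := by
    rw [Finset.card_image_of_injOn hinj, Finset.card_range]
  obtain ⟨M, hM, hM2, hMw⟩ := h _ (by rw [hcard]; omega)
  suffices hMK : M = (Finset.range (L + 1)).image f by
    rw [hMK, hcard] at hMw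
    exact (Nat.lt_of_succ_le hMw).trans_le (le_max_left _ _)
  by_contra hne
  obtain ⟨x', hx'K, hx'⟩ := Finset.exists_of_ssubset (hM.1.ssubset_of_ne hne)
  obtain ⟨x, hx, rfl⟩ := Finset.mem_image.1 hx'K
  rw [Finset.mem_range] at hx
  obtain ⟨y', hy', z', hz', hyz'⟩ := Finset.one_lt_card.1 hM2
  obtain ⟨y, hy, rfl⟩ := Finset.mem_image.1 (hM.1 hy')
  obtain ⟨z, hz, rfl⟩ := Finset.mem_image.1 (hM.1 hz')
  rw [Finset.mem_range] at hy hz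
  have hyz : y ≠ z := fun h => hyz' (by rw [h])
  have hd : ∀ i ≤ L, ∀ j ≤ L, G.dist (f i) (f j) = (i - j) + (j - i) := by
    intro i hi j hj
    rcases le_total i j with hle | hle
    · rw [hf i j hle hj]; omega
    · rw [dist_comm, hf j i hle hi]; omega
  -- A vertex outside of `M` is equally far from `f y` and `f z`, hence their midpoint; at most one
  -- vertex of the geodesic can be missing from `M`.
  have hmid : ∀ a ≤ L, f a ∉ M → 2 * a = y + z := by
    intro a ha haM
    have := hM.2 (f a) (Finset.mem_image_of_mem _ (Finset.mem_range.2 (by omega))) haM _ hy' _ hz'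
    rw [hd _ ha _ (by omega), hd _ ha _ (by omega)] at this
    omega
  have hall : ∀ a ≤ L, a ≠ x → f a ∈ M := by
    intro a ha hax
    by_contra hc
    have h1 := hmid a ha hc
    have h2 := hmid x (by omega) hx'
    omega
  -- There are at least four indices, so `M` has a third element `f t`. But at most two vertices of
  -- a geodesic have the same positive distance from `f x`.
  obtain ⟨t, ht, htx, hty, htz⟩ : ∃ t ≤ L, t ≠ x ∧ t ≠ y ∧ t ≠ z := by
    by_contra hc
    push Not at hc
    have h0 := hc 0 (by omega)
    have h1 := hc 1 (by omega)
    have h2 := hc 2 (by omega)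
    have h3 := hc 3 (by omega)
    omega
  have h1 := hM.2 (f x) (Finset.mem_image_of_mem _ (Finset.mem_range.2 (by omega))) hx' _ hy' _
    (hall t ht htx)
  have h2 := hmid x (by omega) hx'
  rw [hd _ (by omega) _ (by omega), hd _ (by omega) _ (by omega)] at h1
  omega

/-- The distance of vertices of a graph on `{0, ..., n - 1}`. -/
noncomputable def natDist {n : ℕ} (G : SimpleGraph (Fin n)) (u v : ℕ) : ℕ :=
  if h : u < n ∧ v < n then G.dist ⟨u, h.1⟩ ⟨v, h.2⟩ else 0

theorem natDist_val {n : ℕ} (G : SimpleGraph (Fin n)) (u v : Fin n) : G.natDist u v = G.dist u v := by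
  simp [natDist]

theorem natDist_comm {n : ℕ} (G : SimpleGraph (Fin n)) (u v : ℕ) : G.natDist u v = G.natDist v u := by
  simp only [natDist, and_comm (a := u < n)]
  split_ifs
  · exact dist_comm
  · rfl

theorem natDist_lt {n : ℕ} {G : SimpleGraph (Fin n)} (hG : G.Connected) (u v : ℕ) :
    G.natDist u v < G.modularWidth + 3 := by
  unfold natDist
  split_ifs
  · refine (dist_lt_of_modules hG (exists_dist_module hG) _ _).trans_le ?_
    simp
  · omega

theorem exists_natDist_module {n : ℕ} {G : SimpleGraph (Fin n)} (hG : G.Connected) (K : Finset ℕ)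
    (hn : ∀ x ∈ K, x < n) (hK : 2 ≤ K.card) :
    ∃ M, IsModule G.natDist K M ∧ 2 ≤ M.card ∧ M.card ≤ G.modularWidth + 2 := by
  obtain ⟨M, hM, hM2, hMw⟩ := exists_dist_module hG (K.attachFin hn) (by simpa using hK)
  refine ⟨M.map Fin.valEmbedding, ⟨fun x hx => ?_, fun x hx hxM y hy z hz => ?_⟩, by simpa using hM2,
    ?_⟩
  · obtain ⟨a, ha, rfl⟩ := Finset.mem_map.1 hx
    exact Finset.mem_attachFin hn |>.1 (hM.1 ha)
  · obtain ⟨a, ha, rfl⟩ := Finset.mem_map.1 hy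
    obtain ⟨b, hb, rfl⟩ := Finset.mem_map.1 hz
    have := hM.2 ⟨x, hn x hx⟩ ((Finset.mem_attachFin hn).2 hx)
      (fun h => hxM (Finset.mem_map.2 ⟨_, h, rfl⟩)) a ha b hb
    rw [← natDist_val, ← natDist_val] at this
    exact this
  · rw [Finset.card_map]
    refine hMw.trans ?_
    simp

end SimpleGraph

/-! ## Derived expressions and statements -/

namespace RAM

namespace Expr

/-- The truth of an expression that is read as a condition. -/
def Holds (e : Expr) (ρ : ℕ → ℕ) (μ : ℕ → ℕ → ℕ) : Prop := e.eval ρ μ ≠ 0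

instance (e : Expr) (ρ : ℕ → ℕ) (μ : ℕ → ℕ → ℕ) : Decidable (e.Holds ρ μ) :=
  inferInstanceAs (Decidable (_ ≠ _))

/-- The truth value of a condition as a number. -/
def test (e : Expr) : Expr := .ite e (.const 1) (.const 0)

/-- Negation. -/
def not (e : Expr) : Expr := .ite e (.const 0) (.const 1)

/-- Conjunction. -/
def and (e₁ e₂ : Expr) : Expr := .ite e₁ e₂ (.const 0)

/-- Disjunction. -/
def or (e₁ e₂ : Expr) : Expr := .ite e₁ (.const 1) e₂

/-- `e₁ < e₂` -/
def lt (e₁ e₂ : Expr) : Expr := .sub e₂ e₁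

/-- `e₁ ≤ e₂` -/
def le (e₁ e₂ : Expr) : Expr := not (lt e₂ e₁)

/-- `e₁ = e₂` -/
def eq (e₁ e₂ : Expr) : Expr := and (le e₁ e₂) (le e₂ e₁)

/-- There is `R[x] < R[r]` with `e`. -/
def ex (x r : ℕ) (e : Expr) : Expr := .sum x r e

/-- All `R[x] < R[r]` satisfy `e`. -/
def all (x r : ℕ) (e : Expr) : Expr := not (ex x r (not e))

/-- The address of an entry of a table with `R[s]` columns. -/
def at2 (s : ℕ) (e₁ e₂ : Expr) : Expr := .add (.mul s e₁) e₂

section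
variable (e e₁ e₂ : Expr) (ρ : ℕ → ℕ) (μ : ℕ → ℕ → ℕ)

@[simp]
theorem eval_ite (e₃ : Expr) : (ite e e₂ e₃).eval ρ μ =
    if e.Holds ρ μ then e₂.eval ρ μ else e₃.eval ρ μ := rfl

@[simp]
theorem eval_var (x : ℕ) : (var x).eval ρ μ = ρ x := rfl

@[simp]
theorem eval_const (c : ℕ) : (const c).eval ρ μ = c := rfl

@[simp]
theorem eval_add : (add e₁ e₂).eval ρ μ = e₁.eval ρ μ + e₂.eval ρ μ := rfl

@[simp]
theorem eval_sub : (sub e₁ e₂).eval ρ μ = e₁.eval ρ μ - e₂.eval ρ μ := rfl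

@[simp]
theorem eval_load (k : ℕ) : (load k e).eval ρ μ = μ k (e.eval ρ μ) := rfl

@[simp]
theorem eval_mul (r : ℕ) : (mul r e).eval ρ μ = ρ r * e.eval ρ μ := rfl

@[simp]
theorem eval_sum (x r : ℕ) : (sum x r e).eval ρ μ =
    ∑ i ∈ Finset.range (ρ r), e.eval (Function.update ρ x i) μ := rfl

@[simp]
theorem eval_test : (test e).eval ρ μ = if e.Holds ρ μ then 1 else 0 := rfl

@[simp]
theorem holds_load (k : ℕ) : (load k e).Holds ρ μ ↔ μ k (e.eval ρ μ) ≠ 0 := Iff.rfl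

@[simp]
theorem holds_not : (not e).Holds ρ μ ↔ ¬ e.Holds ρ μ := by
  simp only [Holds, not, eval]; split_ifs <;> simp_all

@[simp]
theorem holds_and : (and e₁ e₂).Holds ρ μ ↔ e₁.Holds ρ μ ∧ e₂.Holds ρ μ := by
  simp only [Holds, and, eval]; split_ifs <;> simp_all

@[simp]
theorem holds_or : (or e₁ e₂).Holds ρ μ ↔ e₁.Holds ρ μ ∨ e₂.Holds ρ μ := by
  simp only [Holds, or, eval]; split_ifs <;> simp_all

@[simp]
theorem holds_lt : (lt e₁ e₂).Holds ρ μ ↔ e₁.eval ρ μ < e₂.eval ρ μ := by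
  simp only [Holds, lt, eval]; omega

@[simp]
theorem holds_le : (le e₁ e₂).Holds ρ μ ↔ e₁.eval ρ μ ≤ e₂.eval ρ μ := by
  rw [le, holds_not, holds_lt, not_lt]

@[simp]
theorem holds_eq : (eq e₁ e₂).Holds ρ μ ↔ e₁.eval ρ μ = e₂.eval ρ μ := by
  rw [eq, holds_and, holds_le, holds_le]; omega

@[simp]
theorem holds_ex (x r : ℕ) :
    (ex x r e).Holds ρ μ ↔ ∃ i < ρ r, e.Holds (Function.update ρ x i) μ := by
  simp [Holds, ex, Finset.sum_eq_zero_iff]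

@[simp]
theorem holds_all (x r : ℕ) :
    (all x r e).Holds ρ μ ↔ ∀ i < ρ r, e.Holds (Function.update ρ x i) μ := by
  simp [all, holds_not, holds_ex]

@[simp]
theorem eval_at2 (s : ℕ) : (at2 s e₁ e₂).eval ρ μ = ρ s * e₁.eval ρ μ + e₂.eval ρ μ := rfl

end

end Expr

/-! ### Frame properties of statements, and tables filled through a buffer. -/

namespace Stmt

/-- The registers that a statement changes. -/
def regs : Stmt → List ℕ
  | assign x _ => [x]
  | store _ _ _ => []
  | tab _ _ _ _ _ _ => []
  | seq p q => p.regs ++ q.regs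
  | iter _ p => p.regs

/-- The banks that a statement changes. -/
def banks : Stmt → List ℕ
  | assign _ _ => []
  | store k _ _ => [k]
  | tab k _ _ _ _ _ => [k]
  | seq p q => p.banks ++ q.banks
  | iter _ p => p.banks

/-- With `exec_mem` this is the frame rule; for concrete programs its side condition is settled by
`decide`. -/
theorem exec_reg (p : Stmt) (σ : State) {r : ℕ} (hr : r ∉ p.regs) : (p.exec σ).reg r = σ.reg r := by
  induction p generalizing σ with
  | assign x e =>
    rw [regs, List.mem_singleton] at hr
    simp [exec, hr]
  | store | tab => rfl
  | seq p q hp hq =>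
    rw [regs, List.mem_append, not_or] at hr
    rw [exec, hq _ hr.2, hp _ hr.1]
  | iter s p hp =>
    exact Function.Iterate.rec (fun τ : State => τ.reg r = σ.reg r)
      rfl (fun τ h => (hp τ hr).trans h) _

theorem exec_mem (p : Stmt) (σ : State) {k : ℕ} (hk : k ∉ p.banks) : (p.exec σ).mem k = σ.mem k := by
  induction p generalizing σ with
  | assign => rfl
  | store k' | tab k' =>
    rw [banks, List.mem_singleton] at hk
    simp [exec, hk]
  | seq p q hp hq =>
    rw [banks, List.mem_append, not_or] at hk
    rw [exec, hq _ hk.2, hp _ hk.1]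
  | iter s p hp =>
    exact Function.Iterate.rec (fun τ : State => τ.mem k = σ.mem k)
      rfl (fun τ h => (hp τ hk).trans h) _

theorem iterate_reg (p : Stmt) (σ : State) (i : ℕ) {r : ℕ} (hr : r ∉ p.regs) :
    (p.exec^[i] σ).reg r = σ.reg r :=
  Function.Iterate.rec (fun τ : State => τ.reg r = σ.reg r)
    rfl (fun τ h => (exec_reg p τ hr).trans h) _

theorem iterate_mem (p : Stmt) (σ : State) (i : ℕ) {k : ℕ} (hk : k ∉ p.banks) :
    (p.exec^[i] σ).mem k = σ.mem k :=
  Function.Iterate.rec (fun τ : State => τ.mem k = σ.mem k)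
    rfl (fun τ h => (exec_mem p τ hk).trans h) _

/-- Fill the bank `k` with the `R[r] × R[s]` table of the values of `e`, using the bank `3` as
a buffer. -/
def fill (k r s : ℕ) (e : Expr) : Stmt :=
  .seq (.tab 3 10 r 11 s e) (.tab k 10 r 11 s (.load 3 (.at2 s (.var 10) (.var 11))))

theorem fill_small (B k r s : ℕ) (e : Expr) (σ : State) : (fill k r s e).Small B σ :=
  ⟨trivial, trivial⟩

theorem exec_fill_reg (k r s : ℕ) (e : Expr) (σ : State) : ((fill k r s e).exec σ).reg = σ.reg := rfl

theorem mul_add_lt_mul {r s i j : ℕ} (hi : i < r) (hj : j < s) : s * i + j < r * s := by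
  calc s * i + j < s * i + s := by omega
    _ = (i + 1) * s := by ring
    _ ≤ r * s := Nat.mul_le_mul_right _ hi

/-- Thanks to the buffer, `e` may read the bank `k` that is being filled and sees its old contents
throughout. Registers 10 and 11 hold the indices, so the register `s` with the number of columns
must be a different one. -/
theorem exec_fill_mem {k r s : ℕ} (e : Expr) (σ : State) (hs : s < 10) {i j : ℕ} (hi : i < σ.reg r)
    (hj : j < σ.reg s) : ((fill k r s e).exec σ).mem k (σ.reg s * i + j) =
      e.eval (Function.update (Function.update σ.reg 10 i) 11 j) σ.mem := by
  have h1 := mul_add_lt_mul hi hj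
  have h2 : (σ.reg s * i + j) / σ.reg s = i := by
    rw [Nat.mul_add_div (by omega), Nat.div_eq_of_lt hj, Nat.add_zero]
  have h3 : (σ.reg s * i + j) % σ.reg s = j := by
    rw [Nat.mul_add_mod, Nat.mod_eq_of_lt hj]
  have h4 : s ≠ 10 := by omega
  have h5 : s ≠ 11 := by omega
  simp only [fill, exec, Function.update_self, overwrite, h1, if_true, Expr.eval, Expr.eval_at2, h2,
    h3, Function.update_of_ne h5, Function.update_of_ne h4,
    Function.update_of_ne (show (10 : ℕ) ≠ 11 by decide)]

theorem exec_fill_mem_one {k r s : ℕ} (e : Expr) (σ : State) (hs : s < 10) (h1 : σ.reg s = 1) {i : ℕ}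
    (hi : i < σ.reg r) : ((fill k r s e).exec σ).mem k i =
      e.eval (Function.update (Function.update σ.reg 10 i) 11 0) σ.mem := by
  have := exec_fill_mem (k := k) e σ hs hi (j := 0) (by omega)
  rwa [h1, Nat.one_mul] at this

end Stmt

/-! ### The enumeration of all tuples -/

/-- Division by counting, as the language of expressions has no division. -/
theorem sum_le_mul_add {j m : ℕ} (hm : 0 < m) :
    (∑ s ∈ Finset.range j, if s * m + m ≤ j then 1 else 0) = j / m := by
  rw [Finset.sum_boole, Nat.cast_id, ← Finset.card_range (j / m)]
  congr 1
  ext s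
  simp only [Finset.mem_filter, Finset.mem_range]
  rw [← Nat.succ_mul, ← Nat.le_div_iff_mul_le hm, Nat.succ_le_iff]
  exact ⟨fun h => h.2, fun h => ⟨h.trans_le (Nat.div_le_self _ _), h⟩⟩

/-- Tuples over `N` symbols are the `k`-digit numbers in base `N`; this is how they are enumerated.
-/
theorem exists_digits {N k : ℕ} (f : ℕ → ℕ) (hf : ∀ i < k, f i < N) :
    ∃ j < N ^ k, ∀ i < k, j / N ^ i % N = f i := by
  refine ⟨finFunctionFinEquiv fun i : Fin k => (⟨f i, hf i i.2⟩ : Fin N), Fin.is_lt _, fun i hi => ?_⟩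
  have := congrFun (finFunctionFinEquiv.symm_apply_apply fun i : Fin k => (⟨f i, hf i i.2⟩ : Fin N))
    ⟨i, hi⟩
  exact congrArg Fin.val this

theorem div_pow_sub (N j i : ℕ) : j / N ^ i - N * (j / N ^ (i + 1)) = j / N ^ i % N := by
  rw [pow_succ, ← Nat.div_div_eq_div_mul, Nat.mod_eq_sub_mul_div]

/-- The element with index `i` of a set of numbers. -/
theorem sum_nth {n i x : ℕ} (p : ℕ → Prop) [DecidablePred p] (hx : x < n) (hp : p x)
    (hi : Nat.count p x = i) :
    (∑ z ∈ Finset.range n, if p z ∧ Nat.count p z = i then z else 0) = x := by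
  rw [Finset.sum_eq_single x]
  · rw [if_pos ⟨hp, hi⟩]
  · intro z _ hzx
    rw [if_neg]
    rintro ⟨hz, hzi⟩
    exact hzx (Nat.count_injective hz hp (hzi.trans hi.symm))
  · exact fun h => absurd (Finset.mem_range.2 hx) h

end RAM

/-! ### Programs that list all tuples over a stored set. -/

namespace RAM

open RAM.Expr in
/-- One step of the computation of the powers of `R[5]`. -/
def powStep : Stmt :=
  .seq (.store 8 (var 7) (var 6)) (.seq (.assign 7 (.add (var 7) (.const 1)))
    (.assign 6 (.mul 5 (var 6))))

open RAM.Expr in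
/-- The powers of `R[5]` up to the exponent `R[1]` go to the bank `8`. -/
def powers : Stmt :=
  .seq (.assign 6 (.const 1)) (.seq (.assign 7 (.const 0)) (.seq (.iter 1 powStep)
    (.store 8 (var 7) (var 6))))

theorem iterate_powStep (σ : State) (h6 : σ.reg 6 = 1) (h7 : σ.reg 7 = 0) (i : ℕ) :
    (powStep.exec^[i] σ).reg 5 = σ.reg 5 ∧ (powStep.exec^[i] σ).reg 6 = σ.reg 5 ^ i ∧
      (powStep.exec^[i] σ).reg 7 = i ∧ ∀ j < i, (powStep.exec^[i] σ).mem 8 j = σ.reg 5 ^ j := by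
  induction i with
  | zero => simp [h6, h7]
  | succ i ih =>
    rw [Function.iterate_succ_apply']
    obtain ⟨g5, g6, g7, g8⟩ := ih
    generalize powStep.exec^[i] σ = τ at *
    refine ⟨?_, ?_, ?_, fun j hj => ?_⟩
    · simp [powStep, Stmt.exec, g5]
    · simp [powStep, Stmt.exec, Expr.eval, g5, g6, pow_succ']
    · simp [powStep, Stmt.exec, Expr.eval, g7]
    · rcases Nat.lt_succ_iff_lt_or_eq.1 hj with hj | rfl
      · simp [powStep, Stmt.exec, Expr.eval, g7, hj.ne, g8 j hj]
      · simp [powStep, Stmt.exec, Expr.eval, g7, g6]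

theorem exec_powers (σ : State) :
    (powers.exec σ).reg 6 = σ.reg 5 ^ σ.reg 1 ∧
      ∀ j ≤ σ.reg 1, (powers.exec σ).mem 8 j = σ.reg 5 ^ j := by
  have h := iterate_powStep ((Stmt.assign 7 (.const 0)).exec ((Stmt.assign 6 (.const 1)).exec σ))
    rfl rfl (σ.reg 1)
  have h5 : ((Stmt.assign 7 (.const 0)).exec ((Stmt.assign 6 (.const 1)).exec σ)).reg 5 = σ.reg 5 :=
    rfl
  have h1 : ((Stmt.assign 7 (.const 0)).exec ((Stmt.assign 6 (.const 1)).exec σ)).reg 1 = σ.reg 1 :=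
    rfl
  rw [h5] at h
  obtain ⟨g5, g6, g7, g8⟩ := h
  simp only [powers, Stmt.exec] at *
  rw [h1]
  generalize powStep.exec^[σ.reg 1] _ = τ at *
  refine ⟨g6, fun j hj => ?_⟩
  rcases hj.lt_or_eq with hj | rfl
  · simp [g7, hj.ne, g8 j hj]
  · simp [g7, g6]

/-- The base may be 0, for which powers are not monotone in the exponent; hence the comparison with
some `N ≥ 1`. -/
theorem powers_small {B N : ℕ} (σ : State) (hB : 1 ≤ B) (h1 : σ.reg 1 ≤ B) (hN : 1 ≤ N)
    (h5 : σ.reg 5 ≤ N) (hNB : N ^ σ.reg 1 ≤ B) : powers.Small B σ := by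
  refine ⟨hB, Nat.zero_le _, fun i hi => ?_, trivial⟩
  have h := iterate_powStep ((Stmt.assign 7 (.const 0)).exec ((Stmt.assign 6 (.const 1)).exec σ))
    rfl rfl i
  have e5 : ((Stmt.assign 7 (.const 0)).exec ((Stmt.assign 6 (.const 1)).exec σ)).reg 5 = σ.reg 5 :=
    rfl
  have e1 : ((Stmt.assign 7 (.const 0)).exec ((Stmt.assign 6 (.const 1)).exec σ)).reg 1 = σ.reg 1 :=
    rfl
  rw [e5] at h
  rw [e1] at hi
  obtain ⟨g5, g6, g7, g8⟩ := h
  generalize powStep.exec^[i] _ = τ at *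
  refine ⟨trivial, ?_, ?_⟩
  · simp [Stmt.Small, Stmt.exec, g7]; omega
  · simp only [Stmt.Small, Stmt.exec, Expr.eval_mul, Expr.eval_var,
      Function.update_of_ne (show (5 : ℕ) ≠ 7 by decide),
      Function.update_of_ne (show (6 : ℕ) ≠ 7 by decide), g5, g6]
    calc σ.reg 5 * σ.reg 5 ^ i = σ.reg 5 ^ (i + 1) := (pow_succ' _ _).symm
      _ ≤ N ^ (i + 1) := Nat.pow_le_pow_left h5 _
      _ ≤ N ^ σ.reg 1 := Nat.pow_le_pow_right hN hi
      _ ≤ B := hNB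

open RAM.Expr in
/-- The number of elements of the set in bank `6` goes to register `5`. -/
def countFlags : Stmt := .assign 5 (.sum 10 2 (test (load 6 (var 10))))

open RAM.Expr in
/-- The elements of the set in bank `6` go to bank `7`. -/
def listFlags : Stmt :=
  .fill 7 5 4 (.sum 12 2 (.ite (and (load 6 (var 12))
    (eq (.sum 13 12 (test (load 6 (var 13)))) (var 10))) (var 12) (.const 0)))

open RAM.Expr in
/-- The quotient of `R[10]` and the power of `R[5]` with the given exponent. -/
def quotExpr (e : Expr) : Expr :=
  .sum 12 10 (test (le (.add (.mul 12 (load 8 e)) (load 8 e)) (var 10)))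

open RAM.Expr in
/-- The tuples of `R[1]` elements of the set in bank `6` go to bank `9`, and their number to
register `6`. -/
def enumTuples : Stmt :=
  .seq countFlags (.seq listFlags (.seq powers
    (.fill 9 6 1 (load 7 (.sub (quotExpr (var 11)) (.mul 5 (quotExpr (.add (var 11) (.const 1)))))))))

/-- The set that is stored in bank `6`. -/
def flagSet (n : ℕ) (σ : State) : Finset ℕ := (Finset.range n).filter fun x => σ.mem 6 x ≠ 0

theorem count_flag (n : ℕ) (σ : State) : (flagSet n σ).card = Nat.count (fun x => σ.mem 6 x ≠ 0) n := by
  rw [Nat.count_eq_card_filter_range, flagSet]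

theorem exec_countFlags (σ : State) : (countFlags.exec σ).reg 5 = (flagSet (σ.reg 2) σ).card := by
  simp only [countFlags, Stmt.exec, Function.update_self, Expr.eval, Expr.eval_test, Expr.holds_load,
    Finset.sum_boole, Nat.cast_id, flagSet]

theorem exec_listFlags (σ : State) (h4 : σ.reg 4 = 1) {i : ℕ} (hi : i < σ.reg 5) :
    (listFlags.exec σ).mem 7 i = ∑ z ∈ Finset.range (σ.reg 2),
      if σ.mem 6 z ≠ 0 ∧ Nat.count (fun x => σ.mem 6 x ≠ 0) z = i then z else 0 := by
  rw [listFlags, Stmt.exec_fill_mem_one _ _ (by decide) h4 hi]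
  simp [Nat.count_eq_card_filter_range, Finset.card_filter]

theorem eval_quotExpr (e : Expr) (ρ : ℕ → ℕ) (μ : ℕ → ℕ → ℕ) {m : ℕ}
    (he : ∀ s, μ 8 (e.eval (Function.update ρ 12 s) μ) = m) (hm : 0 < m) :
    (quotExpr e).eval ρ μ = ρ 10 / m := by
  simp only [quotExpr, Expr.eval_sum, Expr.eval_test, Expr.holds_le, Expr.eval_add, Expr.eval_mul,
    Expr.eval_load, Expr.eval_var, he, Function.update_self,
    Function.update_of_ne (show (10 : ℕ) ≠ 12 by decide)]
  exact sum_le_mul_add hm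

/-- Entry `i` of tuple `j` is the element of the set whose index is digit `i` of `j` in base the
size of the set. The elements are indexed by `Nat.count`. -/
theorem exec_enumTuples (σ : State) (h4 : σ.reg 4 = 1) {n k : ℕ} (h1 : σ.reg 1 = k)
    (h2 : σ.reg 2 = n) :
    (enumTuples.exec σ).reg 6 = (flagSet n σ).card ^ k ∧
    (∀ j < (flagSet n σ).card ^ k, ∀ i < k, (enumTuples.exec σ).mem 9 (k * j + i) ∈ flagSet n σ) ∧
    ∀ f : ℕ → ℕ, (∀ i < k, f i ∈ flagSet n σ) → ∃ j < (flagSet n σ).card ^ k,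
      ∀ i < k, (enumTuples.exec σ).mem 9 (k * j + i) = f i := by
  set F := flagSet n σ with hF
  set p : ℕ → Prop := fun x => σ.mem 6 x ≠ 0 with hp
  set σ₁ := countFlags.exec σ with hσ₁
  have a5 : σ₁.reg 5 = F.card := by rw [hσ₁, exec_countFlags, h2]
  have a1 : σ₁.reg 1 = k := by rw [hσ₁, Stmt.exec_reg _ _ (by decide), h1]
  have a2 : σ₁.reg 2 = n := by rw [hσ₁, Stmt.exec_reg _ _ (by decide), h2]
  have a4 : σ₁.reg 4 = 1 := by rw [hσ₁, Stmt.exec_reg _ _ (by decide), h4]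
  have a6 : σ₁.mem 6 = σ.mem 6 := by rw [hσ₁, Stmt.exec_mem _ _ (by decide)]
  set σ₂ := listFlags.exec σ₁ with hσ₂
  have b7 : ∀ x ∈ F, σ₂.mem 7 (Nat.count p x) = x ∧ Nat.count p x < F.card := by
    intro x hx
    obtain ⟨hx, hpx⟩ := Finset.mem_filter.1 hx
    rw [Finset.mem_range] at hx
    have hlt : Nat.count p x < F.card := by
      rw [hF, count_flag]; exact Nat.count_strict_mono hpx hx
    refine ⟨?_, hlt⟩
    rw [hσ₂, exec_listFlags _ a4 (by rwa [a5]), a2, a6]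
    exact sum_nth p hx hpx rfl
  have b7' : ∀ i < F.card, σ₂.mem 7 i ∈ F ∧ Nat.count p (σ₂.mem 7 i) = i := by
    intro i hi
    obtain ⟨x, hx, rfl⟩ := Finset.surjOn_of_injOn_of_card_le (s := F) (t := Finset.range F.card)
      (Nat.count p) (fun x hx => Finset.mem_coe.2 (Finset.mem_range.2 (b7 x hx).2))
      (fun x hx y hy hxy => by rw [← (b7 x hx).1, ← (b7 y hy).1, hxy]) (by simp)
      (Finset.mem_coe.2 (Finset.mem_range.2 hi))
    rw [(b7 x hx).1]
    exact ⟨hx, rfl⟩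
  have b5 : σ₂.reg 5 = F.card := a5
  have b1 : σ₂.reg 1 = k := a1
  set σ₃ := powers.exec σ₂ with hσ₃
  obtain ⟨c6, c8⟩ := exec_powers σ₂
  rw [← hσ₃, b5, b1] at c6 c8
  have c5 : σ₃.reg 5 = F.card := by rw [hσ₃, Stmt.exec_reg _ _ (by decide), b5]
  have c1 : σ₃.reg 1 = k := by rw [hσ₃, Stmt.exec_reg _ _ (by decide), b1]
  have c7 : σ₃.mem 7 = σ₂.mem 7 := by rw [hσ₃, Stmt.exec_mem _ _ (by decide)]
  have key : ∀ j < F.card ^ k, ∀ i < k, (enumTuples.exec σ).mem 9 (k * j + i) =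
      σ₂.mem 7 (j / F.card ^ i % F.card) := by
    intro j hj i hi
    have hpos : 0 < F.card := by
      rcases Nat.eq_zero_or_pos F.card with h | h
      · rw [h, zero_pow (by omega)] at hj; omega
      · exact h
    have := Stmt.exec_fill_mem (k := 9) (.load 7 (.sub (quotExpr (.var 11))
      (.mul 5 (quotExpr (.add (.var 11) (.const 1)))))) σ₃ (s := 1) (r := 6) (by decide) (i := j)
      (j := i) (by rwa [c6]) (by rwa [c1])
    rw [c1] at this
    refine this.trans ?_
    simp only [Expr.eval_load, Expr.eval_sub, Expr.eval_mul]
    rw [eval_quotExpr _ _ _ (m := F.card ^ i) ?_ (pow_pos hpos _),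
      eval_quotExpr _ _ _ (m := F.card ^ (i + 1)) ?_ (pow_pos hpos _)]
    · simp only [Function.update_of_ne (show (5 : ℕ) ≠ 11 by decide),
        Function.update_of_ne (show (5 : ℕ) ≠ 10 by decide),
        Function.update_of_ne (show (10 : ℕ) ≠ 11 by decide), Function.update_self, c5, c7, div_pow_sub]
    · intro s
      simp only [Expr.eval_add, Expr.eval_var, Expr.eval_const,
        Function.update_of_ne (show (11 : ℕ) ≠ 12 by decide), Function.update_self]
      exact c8 _ (by omega)
    · intro s
      simp only [Expr.eval_var,
        Function.update_of_ne (show (11 : ℕ) ≠ 12 by decide), Function.update_self]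
      exact c8 _ (by omega)
  refine ⟨c6, fun j hj i hi => ?_, fun f hf => ?_⟩
  · have hpos : 0 < F.card := by
      rcases Nat.eq_zero_or_pos F.card with h | h
      · rw [h, zero_pow (by omega)] at hj; omega
      · exact h
    rw [key j hj i hi]
    exact (b7' _ (Nat.mod_lt _ hpos)).1
  · obtain ⟨j, hj, hji⟩ := exists_digits (fun i => Nat.count p (f i)) fun i hi => (b7 _ (hf i hi)).2
    exact ⟨j, hj, fun i hi => by rw [key j hj i hi, hji i hi, (b7 _ (hf i hi)).1]⟩

theorem enumTuples_small {B N : ℕ} (σ : State) {n k : ℕ} (h1 : σ.reg 1 = k)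
    (h2 : σ.reg 2 = n) (hB : 1 ≤ B) (hkB : k ≤ B) (hnB : n ≤ B) (hN : 1 ≤ N)
    (hF : (flagSet n σ).card ≤ N) (hNB : N ^ k ≤ B) : enumTuples.Small B σ := by
  refine ⟨?_, Stmt.fill_small _ _ _ _ _ _, powers_small (N := N) _ hB ?_ hN ?_ ?_,
    Stmt.fill_small _ _ _ _ _ _⟩
  · have := exec_countFlags σ
    rw [h2] at this
    have h5 : (flagSet n σ).card ≤ n := (Finset.card_filter_le _ _).trans (by simp)
    have h6 : (countFlags.exec σ).reg 5 ≤ B := by rw [this]; omega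
    simpa [countFlags, Stmt.exec, Stmt.Small] using h6
  · exact (show _ = k from h1).trans_le hkB
  · have := exec_countFlags σ
    rw [h2] at this
    exact this.trans_le hF
  · exact (congrArg (N ^ ·) (show _ = k from h1)).trans_le hNB

end RAM

/-! ### Computing all distances by breadth-first search. -/

theorem SimpleGraph.Connected.dist_le_succ_iff {V : Type*} {G : SimpleGraph V} (hG : G.Connected)
    {u v : V} {j : ℕ} : G.dist u v ≤ j + 1 ↔ G.dist u v ≤ j ∨ ∃ w, G.dist u w ≤ j ∧ G.Adj w v := by
  constructor
  · intro h
    by_cases hj : G.dist u v ≤ j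
    · exact .inl hj
    right
    obtain ⟨p, hp⟩ := hG.exists_walk_length_eq_dist v u
    rw [dist_comm] at h hj
    cases p with
    | nil => simp at hj
    | @cons _ w _ hvw p =>
      refine ⟨w, ?_, hvw.symm⟩
      rw [Walk.length_cons] at hp
      have := dist_le p
      rw [dist_comm]
      omega
  · rintro (h | ⟨w, hw, hwv⟩)
    · omega
    · have h1 := hG.dist_triangle (u := u) (v := w) (w := v)
      have h2 := dist_eq_one_iff_adj.2 hwv
      omega

theorem SimpleGraph.Connected.dist_lt_card {n : ℕ} {G : SimpleGraph (Fin n)} (hG : G.Connected)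
    (u v : Fin n) : G.dist u v < n := by
  obtain ⟨p, hp, hl⟩ := hG.exists_path_of_dist u v
  rw [← hl]
  simpa using hp.length_lt

namespace RAM

open RAM.Expr in
/-- The identity matrix of the vertices goes to bank `1`. -/
def initReach : Stmt := .fill 1 2 2 (test (eq (var 10) (var 11)))

open RAM.Expr in
/-- The distances are increased by one where the vertices have not been reached. -/
def updateDist : Stmt :=
  .fill 2 2 2 (.add (load 2 (at2 2 (var 10) (var 11)))
    (not (load 1 (at2 2 (var 10) (var 11)))))

open RAM.Expr in
/-- The adjacency of `R[12]` and `R[11]` in the input. -/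
def adjExpr : Expr :=
  load 0 (.add (.const 2) (.add (.mul 1 (var 1)) (at2 2 (var 12) (var 11))))

open RAM.Expr in
/-- Neighbours of vertices that have been reached are reached. -/
def updateReach : Stmt :=
  .fill 1 2 2 (test (or (load 1 (at2 2 (var 10) (var 11)))
    (ex 12 2 (and (load 1 (at2 2 (var 10) (var 12))) adjExpr))))

/-- The distances of the vertices go to bank `2`. -/
def distances : Stmt := .seq initReach (.iter 2 (.seq updateDist updateReach))

theorem distances_small (B : ℕ) (σ : State) : distances.Small B σ :=
  ⟨Stmt.fill_small _ _ _ _ _ _, fun _ _ => ⟨Stmt.fill_small _ _ _ _ _ _,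
    Stmt.fill_small _ _ _ _ _ _⟩⟩

/-- Before round `j + 1`, bank 1 marks the pairs at distance at most `j` and bank 2 holds distances
truncated at `j`. The distances are updated first, so that exactly the pairs not yet reached by step
`j` gain one. -/
theorem exec_dist_step (σ : State) {n k j : ℕ} (h1 : σ.reg 1 = k) (h2 : σ.reg 2 = n)
    {G : SimpleGraph (Fin n)} (hG : G.Connected)
    (hadj : ∀ u v : Fin n, σ.mem 0 (2 + (k * k + (n * u + v))) ≠ 0 ↔ G.Adj u v)
    (hR : ∀ u v : Fin n, σ.mem 1 (n * u + v) ≠ 0 ↔ G.dist u v ≤ j)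
    (hD : ∀ u v : Fin n, σ.mem 2 (n * u + v) = min j (G.dist u v)) (u v : Fin n) :
    (((Stmt.seq updateDist updateReach).exec σ).mem 1 (n * u + v) ≠ 0 ↔ G.dist u v ≤ j + 1) ∧
      ((Stmt.seq updateDist updateReach).exec σ).mem 2 (n * u + v) = min (j + 1) (G.dist u v) := by
  set τ := updateDist.exec σ with hτ
  have g1 : τ.reg 1 = k := h1
  have g2 : τ.reg 2 = n := h2
  have m0 : τ.mem 0 = σ.mem 0 := Stmt.exec_mem _ _ (by decide)
  have m1 : τ.mem 1 = σ.mem 1 := Stmt.exec_mem _ _ (by decide)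
  constructor
  · have := Stmt.exec_fill_mem (k := 1) (r := 2) (s := 2)
      (.test (.or (.load 1 (.at2 2 (.var 10) (.var 11)))
        (.ex 12 2 (.and (.load 1 (.at2 2 (.var 10) (.var 12))) adjExpr)))) τ (by decide) (i := u)
      (j := v) (by rw [g2]; exact u.2) (by rw [g2]; exact v.2)
    rw [g2] at this
    rw [Stmt.exec, ← hτ, updateReach, this, hG.dist_le_succ_iff]
    simp only [Expr.eval_test, ne_eq, ite_eq_right_iff, one_ne_zero, imp_false, not_not, adjExpr,
      Expr.holds_or, Expr.holds_ex, Expr.holds_and, Expr.holds_load, Expr.eval_at2, Expr.eval_add,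
      Expr.eval_const, Expr.eval_mul, Expr.eval_var, Function.update_self,
      Function.update_of_ne (show (2 : ℕ) ≠ 12 by decide),
      Function.update_of_ne (show (1 : ℕ) ≠ 12 by decide),
      Function.update_of_ne (show (10 : ℕ) ≠ 12 by decide),
      Function.update_of_ne (show (11 : ℕ) ≠ 12 by decide),
      Function.update_of_ne (show (10 : ℕ) ≠ 11 by decide),
      Function.update_of_ne (show (2 : ℕ) ≠ 11 by decide),
      Function.update_of_ne (show (1 : ℕ) ≠ 11 by decide),
      Function.update_of_ne (show (2 : ℕ) ≠ 10 by decide),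
      Function.update_of_ne (show (1 : ℕ) ≠ 10 by decide), g1, g2, m0, m1]
    refine or_congr (hR u v) ⟨?_, ?_⟩
    · rintro ⟨w, hw, h⟩
      exact ⟨⟨w, hw⟩, (hR u ⟨w, hw⟩).1 h.1, (hadj ⟨w, hw⟩ v).1 h.2⟩
    · rintro ⟨w, h⟩
      exact ⟨w, w.2, (hR u w).2 h.1, (hadj w v).2 h.2⟩
  · have := Stmt.exec_fill_mem (k := 2) (r := 2) (s := 2)
      (.add (.load 2 (.at2 2 (.var 10) (.var 11))) (.not (.load 1 (.at2 2 (.var 10) (.var 11)))))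
      σ (by decide) (i := u) (j := v) (by rw [h2]; exact u.2) (by rw [h2]; exact v.2)
    rw [h2] at this
    rw [Stmt.exec, ← hτ, Stmt.exec_mem _ _ (by decide), hτ, updateDist, this]
    simp only [Expr.eval_at2, Expr.eval_add, Expr.eval_load, Expr.not, Expr.eval_ite,
      Expr.holds_load, Expr.eval_const, Expr.eval_var, Function.update_self,
      Function.update_of_ne (show (10 : ℕ) ≠ 11 by decide),
      Function.update_of_ne (show (2 : ℕ) ≠ 11 by decide),
      Function.update_of_ne (show (2 : ℕ) ≠ 10 by decide), h2, hR, hD]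
    split_ifs <;> omega

theorem exec_distances (σ : State) {n k : ℕ} (h1 : σ.reg 1 = k) (h2 : σ.reg 2 = n)
    {G : SimpleGraph (Fin n)} (hG : G.Connected)
    (hadj : ∀ u v : Fin n, σ.mem 0 (2 + (k * k + (n * u + v))) ≠ 0 ↔ G.Adj u v)
    (h0 : ∀ a, σ.mem 2 a = 0) (u v : Fin n) :
    (distances.exec σ).mem 2 (n * u + v) = G.dist u v := by
  set p := Stmt.seq updateDist updateReach with hp
  have key : ∀ j, ∀ u v : Fin n,
      ((p.exec^[j] (initReach.exec σ)).mem 1 (n * u + v) ≠ 0 ↔ G.dist u v ≤ j) ∧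
      (p.exec^[j] (initReach.exec σ)).mem 2 (n * u + v) = min j (G.dist u v) := by
    intro j
    induction j with
    | zero =>
      intro u v
      constructor
      · have := Stmt.exec_fill_mem (k := 1) (r := 2) (s := 2)
          (.test (.eq (.var 10) (.var 11))) σ (by decide) (i := u) (j := v) (by rw [h2]; exact u.2)
          (by rw [h2]; exact v.2)
        rw [h2] at this
        rw [Function.iterate_zero_apply, initReach, this]
        simp [hG.dist_eq_zero_iff, Fin.ext_iff]
      · rw [Function.iterate_zero_apply, Stmt.exec_mem _ _ (by decide), h0]
        simp
    | succ j ih =>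
      intro u v
      rw [Function.iterate_succ_apply']
      refine exec_dist_step _ (k := k) ?_ ?_ hG (fun u v => ?_) (fun u v => (ih u v).1)
        (fun u v => (ih u v).2) u v
      · rw [Stmt.iterate_reg _ _ _ (by decide), Stmt.exec_reg _ _ (by decide), h1]
      · rw [Stmt.iterate_reg _ _ _ (by decide), Stmt.exec_reg _ _ (by decide), h2]
      · rw [Stmt.iterate_mem _ _ _ (by decide), Stmt.exec_mem _ _ (by decide)]
        exact hadj u v
  have := (key n u v).2
  rw [min_eq_right (hG.dist_lt_card u v).le] at this
  rw [← this, distances, Stmt.exec, Stmt.exec, Stmt.exec_reg _ _ (by decide), h2]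

end RAM

/-! ### The memory layout that is preserved throughout, closures and the selection of modules. -/

namespace RAM

/-- The registers and banks with the sizes `k` and `n`, the distances and the pairs of vertices. -/
structure Ready (σ : State) (n k : ℕ) (d : ℕ → ℕ → ℕ) : Prop where
  reg_one : σ.reg 1 = k
  reg_two : σ.reg 2 = n
  reg_three : σ.reg 3 = n * n
  reg_four : σ.reg 4 = 1
  dist : ∀ u < n, ∀ v < n, σ.mem 2 (n * u + v) = d u v
  fst : ∀ u < n, ∀ v < n, σ.mem 10 (n * u + v) = u
  snd : ∀ u < n, ∀ v < n, σ.mem 11 (n * u + v) = v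

/-- Registers up to 4 and the banks 2, 10 and 11 are read-only from here on. -/
theorem Ready.exec {σ : State} {n k : ℕ} {d : ℕ → ℕ → ℕ} (h : Ready σ n k d) (p : Stmt)
    (hr : ∀ r ∈ p.regs, 4 < r) (hb : ∀ i ∈ p.banks, i ≠ 2 ∧ i ≠ 10 ∧ i ≠ 11) :
    Ready (p.exec σ) n k d where
  reg_one := by rw [p.exec_reg _ fun h => absurd (hr _ h) (by decide), h.reg_one]
  reg_two := by rw [p.exec_reg _ fun h => absurd (hr _ h) (by decide), h.reg_two]
  reg_three := by rw [p.exec_reg _ fun h => absurd (hr _ h) (by decide), h.reg_three]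
  reg_four := by rw [p.exec_reg _ fun h => absurd (hr _ h) (by decide), h.reg_four]
  dist := by rw [p.exec_mem _ fun h => (hb _ h).1 rfl]; exact h.dist
  fst := by rw [p.exec_mem _ fun h => (hb _ h).2.1 rfl]; exact h.fst
  snd := by rw [p.exec_mem _ fun h => (hb _ h).2.2 rfl]; exact h.snd

theorem pair_lt {n u v : ℕ} (hu : u < n) (hv : v < n) : n * u + v < n * n :=
  Stmt.mul_add_lt_mul hu hv

/-! ### Closures of pairs -/

open RAM.Expr in
/-- The closure of each pair of vertices is initialised in bank `5`. -/
def initClosure : Stmt :=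
  .fill 5 3 2 (test (or (eq (var 11) (load 10 (var 10))) (eq (var 11) (load 11 (var 10)))))

open RAM.Expr in
/-- One step of the computation of the closures. -/
def stepClosure : Stmt :=
  .fill 5 3 2 (test (or (load 5 (at2 2 (var 10) (var 11)))
    (and (eq (load 4 (var 11)) (var 11))
      (ex 12 2 (and (load 5 (at2 2 (var 10) (var 12)))
        (not (eq (load 2 (at2 2 (var 11) (var 12)))
          (load 2 (at2 2 (var 11) (load 10 (var 10)))))))))))

/-- The closures of all pairs of vertices. -/
def closures : Stmt := .seq initClosure (.iter 2 stepClosure)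

theorem closeStep_iterate_lt {n : ℕ} {rep : ℕ → ℕ} {d : ℕ → ℕ → ℕ} {u v : ℕ} (hu : u < n)
    (hv : v < n) (j : ℕ) {x : ℕ} (hx : x ∈ (closeStep d (repSet n rep) u)^[j] {u, v}) : x < n := by
  revert x
  induction j with
  | zero =>
    intro x hx
    simp only [Function.iterate_zero_apply, Finset.mem_insert, Finset.mem_singleton] at hx
    omega
  | succ j ih =>
    intro x hx
    rw [Function.iterate_succ_apply', closeStep, Finset.mem_union, Finset.mem_filter] at hx
    exact hx.elim ih fun h => (mem_repSet.1 h.1).1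

theorem exec_initClosure {σ : State} {n k : ℕ} {d : ℕ → ℕ → ℕ} (h : Ready σ n k d) {u v x : ℕ}
    (hu : u < n) (hv : v < n) (hx : x < n) :
    (initClosure.exec σ).mem 5 (n * (n * u + v) + x) ≠ 0 ↔ x = u ∨ x = v := by
  have := Stmt.exec_fill_mem (k := 5) (r := 3) (s := 2)
    (.test (.or (.eq (.var 11) (.load 10 (.var 10))) (.eq (.var 11) (.load 11 (.var 10))))) σ
    (by decide) (i := n * u + v) (j := x) (by rw [h.reg_three]; exact pair_lt hu hv)
    (by rwa [h.reg_two])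
  rw [h.reg_two] at this
  rw [initClosure, this]
  simp [h.fst u hu v hv, h.snd u hu v hv, or_iff_not_imp_left]

theorem exec_stepClosure {σ : State} {n k : ℕ} {d : ℕ → ℕ → ℕ} (h : Ready σ n k d) {u v x : ℕ}
    (hu : u < n) (hv : v < n) (hx : x < n) :
    (stepClosure.exec σ).mem 5 (n * (n * u + v) + x) ≠ 0 ↔
      σ.mem 5 (n * (n * u + v) + x) ≠ 0 ∨ (σ.mem 4 x = x ∧
        ∃ y < n, σ.mem 5 (n * (n * u + v) + y) ≠ 0 ∧ d x y ≠ d x u) := by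
  have := Stmt.exec_fill_mem (k := 5) (r := 3) (s := 2)
    (.test (.or (.load 5 (.at2 2 (.var 10) (.var 11)))
      (.and (.eq (.load 4 (.var 11)) (.var 11))
        (.ex 12 2 (.and (.load 5 (.at2 2 (.var 10) (.var 12)))
          (.not (.eq (.load 2 (.at2 2 (.var 11) (.var 12)))
            (.load 2 (.at2 2 (.var 11) (.load 10 (.var 10))))))))))) σ
    (by decide) (i := n * u + v) (j := x) (by rw [h.reg_three]; exact pair_lt hu hv)
    (by rwa [h.reg_two])
  rw [h.reg_two] at this
  rw [stepClosure, this]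
  simp only [Expr.eval_test, ne_eq, ite_eq_right_iff, one_ne_zero, imp_false, not_not]
  simp only [Expr.holds_or, Expr.holds_and, Expr.holds_ex, Expr.holds_not, Expr.holds_eq,
    Expr.holds_load]
  simp [h.fst u hu v hv, h.reg_two, h.dist x hx u hu]
  refine or_congr_right (and_congr_right fun _ => exists_congr fun y =>
    and_congr_right fun hy => and_congr_right fun _ => ?_)
  rw [h.dist x hx y hy]

theorem exec_closures {σ : State} {n k : ℕ} {d : ℕ → ℕ → ℕ} (h : Ready σ n k d) {u v x : ℕ}
    (hu : u < n) (hv : v < n) (hx : x < n) :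
    (closures.exec σ).mem 5 (n * (n * u + v) + x) ≠ 0 ↔
      x ∈ (closeStep d (repSet n (σ.mem 4)) u)^[n] {u, v} := by
  have key : ∀ j, ∀ x < n, ((stepClosure.exec^[j] (initClosure.exec σ)).mem 5
      (n * (n * u + v) + x) ≠ 0 ↔ x ∈ (closeStep d (repSet n (σ.mem 4)) u)^[j] {u, v}) := by
    intro j
    induction j with
    | zero =>
      intro x hx
      rw [Function.iterate_zero_apply, exec_initClosure h hu hv hx]
      simp
    | succ j ih =>
      intro x hx
      have hR : Ready (stepClosure.exec^[j] (initClosure.exec σ)) n k d :=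
        Function.Iterate.rec (fun τ => Ready τ n k d) (h.exec _ (by decide) (by decide))
          (fun τ hτ => hτ.exec _ (by decide) (by decide)) _
      have h4 : (stepClosure.exec^[j] (initClosure.exec σ)).mem 4 = σ.mem 4 := by
        rw [Stmt.iterate_mem _ _ _ (by decide), Stmt.exec_mem _ _ (by decide)]
      rw [Function.iterate_succ_apply', exec_stepClosure hR hu hv hx, ih x hx, h4,
        Function.iterate_succ_apply', closeStep, Finset.mem_union, Finset.mem_filter, mem_repSet]
      refine or_congr_right ?_
      constructor
      · rintro ⟨h1, y, hy, h2, h3⟩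
        exact ⟨⟨hx, h1⟩, y, (ih y hy).1 h2, h3⟩
      · rintro ⟨⟨_, h1⟩, y, h2, h3⟩
        have hy := closeStep_iterate_lt hu hv j h2
        exact ⟨h1, y, hy, (ih y hy).2 h2, h3⟩
  rw [closures, Stmt.exec, Stmt.exec, Stmt.exec_reg _ _ (by decide), h.reg_two]
  exact key n x hx

/-! ### The choice of a smallest closure -/

open RAM.Expr in
/-- The sizes of the closures of the pairs of distinct representatives go to bank `12`. -/
def closureSizes : Stmt :=
  .fill 12 3 4 (.ite (and (not (eq (load 10 (var 10)) (load 11 (var 10))))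
      (and (eq (load 4 (load 10 (var 10))) (load 10 (var 10)))
        (eq (load 4 (load 11 (var 10))) (load 11 (var 10)))))
    (.sum 12 2 (test (load 5 (at2 2 (var 10) (var 12))))) (.add (var 2) (.const 1)))

open RAM.Expr in
/-- The first pair whose closure is smallest goes to register `8`. -/
def choosePair : Stmt :=
  .assign 8 (.sum 10 3 (not (ex 11 3 (and (le (var 11) (var 10))
    (and (le (load 12 (var 11)) (var 2)) (all 13 3 (le (load 12 (var 11)) (load 12 (var 13)))))))))

open RAM.Expr in
/-- The union of the parts that are represented in the closure of the chosen pair goes to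
bank `6`. -/
def flagPart : Stmt :=
  .fill 6 2 4 (test (and (lt (var 8) (var 3)) (and (lt (load 4 (var 10)) (var 2))
    (load 5 (at2 2 (var 8) (load 4 (var 10)))))))

/-- A module of at least two parts is chosen. -/
def selectModule : Stmt := .seq closures (.seq closureSizes (.seq choosePair flagPart))

/-- The first number below `m` that satisfies `P`, or `m` if there is none. -/
def firstBelow (m : ℕ) (P : ℕ → Prop) [DecidablePred P] : ℕ :=
  ∑ q ∈ Finset.range m, if ∃ q' < m, q' ≤ q ∧ P q' then 0 else 1

theorem firstBelow_le (m : ℕ) (P : ℕ → Prop) [DecidablePred P] : firstBelow m P ≤ m := by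
  calc firstBelow m P ≤ ∑ _q ∈ Finset.range m, 1 :=
        Finset.sum_le_sum fun q _ => by split_ifs <;> omega
    _ = m := by simp

/-- The least witness is the number of `q` that have no witness up to `q`. -/
theorem firstBelow_spec {m : ℕ} {P : ℕ → Prop} [DecidablePred P] (h : ∃ q < m, P q) :
    firstBelow m P < m ∧ P (firstBelow m P) := by
  have hf := Nat.find_spec h
  suffices he : firstBelow m P = Nat.find h by rwa [he]
  have : ∀ q ∈ Finset.range m, (if ∃ q' < m, q' ≤ q ∧ P q' then 0 else 1) =
      if q < Nat.find h then 1 else 0 := by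
    intro q hq
    have hiff : (∃ q' < m, q' ≤ q ∧ P q') ↔ ¬ q < Nat.find h := by
      rw [not_lt]
      exact ⟨fun ⟨q', h1, h2, h3⟩ => (Nat.find_min' h ⟨h1, h3⟩).trans h2,
        fun h' => ⟨_, hf.1, h', hf.2⟩⟩
    simp only [hiff, ite_not]
  rw [firstBelow, Finset.sum_congr rfl this, Finset.sum_boole, Nat.cast_id,
    show (Finset.range m).filter (· < Nat.find h) = Finset.range (Nat.find h) by
      ext q; simp only [Finset.mem_filter, Finset.mem_range]; omega, Finset.card_range]

theorem firstBelow_eq {m : ℕ} {P : ℕ → Prop} [DecidablePred P] (h : ¬ ∃ q < m, P q) :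
    firstBelow m P = m := by
  rw [firstBelow, Finset.sum_congr rfl fun q _ => if_neg fun h' => h ?_]
  · simp
  · obtain ⟨q', h1, _, h2⟩ := h'
    exact ⟨q', h1, h2⟩

theorem exec_closureSizes {σ : State} {n k : ℕ} {d : ℕ → ℕ → ℕ} (h : Ready σ n k d) {C : Finset ℕ}
    {u v : ℕ} (hu : u < n) (hv : v < n) (hC : ∀ x ∈ C, x < n)
    (hcl : ∀ x < n, σ.mem 5 (n * (n * u + v) + x) ≠ 0 ↔ x ∈ C) :
    (closureSizes.exec σ).mem 12 (n * u + v) =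
      if u ≠ v ∧ σ.mem 4 u = u ∧ σ.mem 4 v = v then C.card else n + 1 := by
  have hsum : (∑ i ∈ Finset.range n, if σ.mem 5 (n * (n * u + v) + i) = 0 then 0 else 1) = C.card := by
    have : C = (Finset.range n).filter fun x => σ.mem 5 (n * (n * u + v) + x) ≠ 0 := by
      ext x
      rw [Finset.mem_filter, Finset.mem_range]
      exact ⟨fun hx => ⟨hC x hx, (hcl x (hC x hx)).2 hx⟩, fun hx => (hcl x hx.1).1 hx.2⟩
    rw [this, Finset.card_filter]
    exact Finset.sum_congr rfl fun x _ => by split_ifs <;> simp_all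
  rw [closureSizes, Stmt.exec_fill_mem_one _ _ (by decide) h.reg_four
    (by rw [h.reg_three]; exact pair_lt hu hv)]
  simp [h.fst u hu v hv, h.snd u hu v hv, h.reg_two, hsum]

/-- A pair whose entry in bank `12` is smallest and at most `n`. -/
def IsBest (n : ℕ) (s : ℕ → ℕ) (q : ℕ) : Prop := s q ≤ n ∧ ∀ q' < n * n, s q ≤ s q'

instance (n : ℕ) (s : ℕ → ℕ) : DecidablePred (IsBest n s) := fun _ =>
  inferInstanceAs (Decidable (_ ∧ _))

theorem eval_choosePair {σ : State} {n k : ℕ} {d : ℕ → ℕ → ℕ} (h : Ready σ n k d) :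
    (choosePair.exec σ).reg 8 = firstBelow (n * n) (IsBest n (σ.mem 12)) := by
  simp only [choosePair, Stmt.exec, Function.update_self, firstBelow, Expr.eval_sum, h.reg_three]
  refine Finset.sum_congr rfl fun q _ => ?_
  rw [Expr.not, Expr.eval_ite, Expr.eval_const, Expr.eval_const]
  refine if_congr ?_ rfl rfl
  simp [h.reg_two, h.reg_three, IsBest]

theorem exec_flagPart {σ : State} {n k : ℕ} {d : ℕ → ℕ → ℕ} (h : Ready σ n k d) :
    flagSet n (flagPart.exec σ) = (Finset.range n).filter fun x =>
      σ.reg 8 < n * n ∧ σ.mem 4 x < n ∧ σ.mem 5 (n * σ.reg 8 + σ.mem 4 x) ≠ 0 := by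
  refine Finset.filter_congr fun x hx => ?_
  rw [flagPart, Stmt.exec_fill_mem_one _ _ (by decide) h.reg_four
    (by rw [h.reg_two]; exact Finset.mem_range.1 hx)]
  simp [h.reg_two, h.reg_three]

theorem selectModule_small {B : ℕ} {σ : State} {n k : ℕ} {d : ℕ → ℕ → ℕ} (h : Ready σ n k d)
    (hB : n * n ≤ B) : selectModule.Small B σ := by
  refine ⟨⟨Stmt.fill_small _ _ _ _ _ _, fun _ _ => Stmt.fill_small _ _ _ _ _ _⟩,
    Stmt.fill_small _ _ _ _ _ _, ?_, Stmt.fill_small _ _ _ _ _ _⟩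
  have h' : Ready (closureSizes.exec (closures.exec σ)) n k d :=
    (h.exec closures (by decide) (by decide)).exec _ (by decide) (by decide)
  have := eval_choosePair h'
  simp only [choosePair, Stmt.exec, Function.update_self] at this
  exact this.trans_le ((firstBelow_le _ _).trans hB)

/-- A module with two elements contains the closure of a pair of them, so a smallest closure is no
larger than the small module that exists by `hw`. With fewer than two representatives there is no
admissible pair and `S` is empty. -/
theorem exec_selectModule {σ : State} {n k w : ℕ} {d : ℕ → ℕ → ℕ} (h : Ready σ n k d)
    (hw : ∀ K : Finset ℕ, (∀ x ∈ K, x < n) → 2 ≤ K.card →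
      ∃ M, IsModule d K M ∧ 2 ≤ M.card ∧ M.card ≤ w) :
    ∃ S, IsModule d (repSet n (σ.mem 4)) S ∧ S.card ≤ w ∧
      (2 ≤ (repSet n (σ.mem 4)).card → 2 ≤ S.card) ∧
      flagSet n (selectModule.exec σ) = partUnion n (σ.mem 4) S := by
  set rep := σ.mem 4 with hrep
  set R := repSet n rep with hR
  set C : ℕ → ℕ → Finset ℕ := fun u v => (closeStep d R u)^[n] {u, v} with hC
  have hRn : R.card ≤ n := (Finset.card_filter_le _ _).trans (by simp)
  set σ₁ := closures.exec σ with hσ₁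
  have h₁ : Ready σ₁ n k d := h.exec _ (by decide) (by decide)
  have a4 : σ₁.mem 4 = rep := Stmt.exec_mem _ _ (by decide)
  have a5 : ∀ u < n, ∀ v < n, ∀ x < n, σ₁.mem 5 (n * (n * u + v) + x) ≠ 0 ↔ x ∈ C u v :=
    fun u hu v hv x hx => exec_closures h hu hv hx
  set σ₂ := closureSizes.exec σ₁ with hσ₂
  have h₂ : Ready σ₂ n k d := h₁.exec _ (by decide) (by decide)
  have b4 : σ₂.mem 4 = rep := by rw [hσ₂, Stmt.exec_mem _ _ (by decide), a4]
  have b5 : σ₂.mem 5 = σ₁.mem 5 := by rw [hσ₂, Stmt.exec_mem _ _ (by decide)]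
  have b12 : ∀ u < n, ∀ v < n, σ₂.mem 12 (n * u + v) =
      if u ≠ v ∧ rep u = u ∧ rep v = v then (C u v).card else n + 1 := by
    intro u hu v hv
    have := exec_closureSizes h₁ hu hv (fun x hx => closeStep_iterate_lt hu hv n hx)
      (a5 u hu v hv)
    rwa [a4] at this
  set σ₃ := choosePair.exec σ₂ with hσ₃
  have h₃ : Ready σ₃ n k d := h₂.exec _ (by decide) (by decide)
  have c4 : σ₃.mem 4 = rep := b4
  have c5 : σ₃.mem 5 = σ₁.mem 5 := b5
  have c8 : σ₃.reg 8 = firstBelow (n * n) (IsBest n (σ₂.mem 12)) := eval_choosePair h₂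
  have hflag : flagSet n (selectModule.exec σ) = (Finset.range n).filter fun x =>
      σ₃.reg 8 < n * n ∧ rep x < n ∧ σ₁.mem 5 (n * σ₃.reg 8 + rep x) ≠ 0 := by
    rw [← c5, ← c4]; exact exec_flagPart h₃
  have hsub : ∀ u ∈ R, ∀ v ∈ R, ({u, v} : Finset ℕ) ⊆ R := fun u hu v hv =>
    Finset.insert_subset hu (Finset.singleton_subset_iff.2 hv)
  have hmod : ∀ u ∈ R, ∀ v ∈ R, IsModule d R (C u v) := fun u hu v hv =>
    closeStep_isModule d (hsub u hu v hv) hRn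
  have hval : ∀ u ∈ R, ∀ v ∈ R, u ≠ v → σ₂.mem 12 (n * u + v) = (C u v).card := by
    intro u hu v hv huv
    rw [b12 u (mem_repSet.1 hu).1 v (mem_repSet.1 hv).1,
      if_pos ⟨huv, (mem_repSet.1 hu).2, (mem_repSet.1 hv).2⟩]
  by_cases hex : ∃ q < n * n, IsBest n (σ₂.mem 12) q
  · obtain ⟨hp, hbest⟩ := firstBelow_spec hex
    rw [← c8] at hp hbest
    set p := σ₃.reg 8
    have hn : 0 < n := Nat.pos_of_mul_pos_left (by omega : 0 < n * n)
    obtain ⟨u, v, hu, hv, huv⟩ : ∃ u v, u < n ∧ v < n ∧ p = n * u + v :=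
      ⟨p / n, p % n, Nat.div_lt_of_lt_mul hp, Nat.mod_lt _ hn, (Nat.div_add_mod p n).symm⟩
    have hle := hbest.1
    rw [huv, b12 u hu v hv] at hle
    -- The entry `n + 1` of an inadmissible pair exceeds the bound `n` in `IsBest`.
    have hcond : u ≠ v ∧ rep u = u ∧ rep v = v := by
      by_contra hc
      rw [if_neg hc] at hle; omega
    have huR : u ∈ R := mem_repSet.2 ⟨hu, hcond.2.1⟩
    have hvR : v ∈ R := mem_repSet.2 ⟨hv, hcond.2.2⟩
    have h2R : 2 ≤ R.card := Finset.one_lt_card.2 ⟨u, huR, v, hvR, hcond.1⟩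
    have h2C : 2 ≤ (C u v).card := by
      have := subset_closeStep_iterate d R u {u, v} n
      exact Finset.one_lt_card.2 ⟨u, this (by simp), v, this (by simp), hcond.1⟩
    refine ⟨C u v, hmod u huR v hvR, ?_, fun _ => h2C, ?_⟩
    · obtain ⟨M, hM, hM2, hMw⟩ := hw R (fun x hx => (mem_repSet.1 hx).1) h2R
      obtain ⟨a, ha, b, hb, hab⟩ := Finset.one_lt_card.1 hM2
      have h3 := hbest.2 (n * a + b) (pair_lt (mem_repSet.1 (hM.1 ha)).1 (mem_repSet.1 (hM.1 hb)).1)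
      rw [huv, hval u huR v hvR hcond.1, hval a (hM.1 ha) b (hM.1 hb) hab] at h3
      refine h3.trans (le_trans (Finset.card_le_card ?_) hMw)
      exact closeStep_subset_module hM ha
        (Finset.insert_subset ha (Finset.singleton_subset_iff.2 hb)) n
    · rw [hflag]
      refine Finset.filter_congr fun x _ => ?_
      rw [huv]
      constructor
      · rintro ⟨_, h4, h5⟩
        exact (a5 u hu v hv _ h4).1 h5
      · intro h4
        have h5 := closeStep_iterate_lt hu hv n h4
        exact ⟨pair_lt hu hv, h5, (a5 u hu v hv _ h5).2 h4⟩
  · refine ⟨∅, ⟨Finset.empty_subset _, by simp⟩, by simp, fun h2 => ?_, ?_⟩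
    · exfalso
      obtain ⟨a, ha, b, hb, hab⟩ := Finset.one_lt_card.1 h2
      obtain ⟨q, hq, hqmin⟩ := Finset.exists_min_image (Finset.range (n * n)) (σ₂.mem 12)
        ⟨n * a + b, Finset.mem_range.2 (pair_lt (mem_repSet.1 ha).1 (mem_repSet.1 hb).1)⟩
      refine hex ⟨q, Finset.mem_range.1 hq, ?_, fun q' hq' => hqmin q' (Finset.mem_range.2 hq')⟩
      refine (hqmin (n * a + b) (Finset.mem_range.2
        (pair_lt (mem_repSet.1 ha).1 (mem_repSet.1 hb).1))).trans ?_
      rw [hval a ha b hb hab]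
      exact (Finset.card_le_card (hmod a ha b hb).1).trans hRn
    · rw [hflag, c8, firstBelow_eq hex]
      simp [partUnion]

end RAM

/-! ### One round of the reduction, and the kernel. -/

theorem IsKernel.congr {d : ℕ → ℕ → ℕ} {n k g : ℕ} {rep rep' : ℕ → ℕ} (h : IsKernel d n k g rep)
    (he : ∀ x < n, rep' x = rep x) : IsKernel d n k g rep' where
  idem x hx hxn := by
    rw [he x hx] at hxn ⊢
    rw [he _ hxn, h.idem x hx hxn]
  module x hx y hy z hz := by
    rw [he x hx, he y hy, he z hz]
    exact h.module x hx y hy z hz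
  card_le r hr := by
    rw [Finset.filter_congr fun x hx => by rw [he x (Finset.mem_range.1 hx)]]
    exact h.card_le r hr
  cover t ht := by
    obtain ⟨t', h1, h2⟩ := h.cover t ht
    exact ⟨t', fun i hi => ⟨(h1 i hi).1, by rw [he _ (h1 i hi).1]; exact (h1 i hi).2⟩, h2⟩

theorem repSet_congr {n : ℕ} {rep rep' : ℕ → ℕ} (he : ∀ x < n, rep' x = rep x) :
    repSet n rep' = repSet n rep :=
  Finset.filter_congr fun x hx => by rw [he x (Finset.mem_range.1 hx)]

namespace RAM

open RAM.Expr in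
/-- The entry with index `e₂` of the tuple with index `e₁`. -/
def tupleExpr (e₁ e₂ : Expr) : Expr := load 9 (at2 1 e₁ e₂)

open RAM.Expr in
/-- The distance of two entries, with indices `R[15]` and `R[16]`, of a tuple. -/
def tupleDist (e : Expr) : Expr :=
  load 2 (at2 2 (tupleExpr e (var 15)) (tupleExpr e (var 16)))

open RAM.Expr in
/-- The vertices of tuples that differ from all earlier ones are marked in bank `13`. -/
def markKept : Stmt :=
  .fill 13 2 4 (test (ex 12 6 (and (ex 13 1 (eq (tupleExpr (var 12) (var 13)) (var 10)))
    (all 14 12 (not (all 15 1 (all 16 1 (eq (tupleDist (var 14)) (tupleDist (var 12))))))))))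

open RAM.Expr in
/-- The first vertex that is marked in bank `13` goes to register `7`. -/
def firstKept : Stmt :=
  .assign 7 (.sum 10 2 (not (ex 11 2 (and (le (var 11) (var 10)) (load 13 (var 11))))))

open RAM.Expr in
/-- The vertices in bank `6` that are marked in bank `13` become a part, and the other vertices in
bank `6` are deleted. -/
def mergeKept : Stmt :=
  .fill 4 2 4 (.ite (load 6 (var 10)) (.ite (load 13 (var 10)) (var 7) (var 2)) (load 4 (var 10)))

/-- A module of parts is replaced by a single part. -/
def reduce : Stmt :=
  .seq selectModule (.seq enumTuples (.seq markKept (.seq firstKept mergeKept)))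

theorem exec_markKept {σ : State} {n k : ℕ} {d : ℕ → ℕ → ℕ} (h : Ready σ n k d)
    (ht : ∀ j < σ.reg 6, ∀ i < k, σ.mem 9 (k * j + i) < n) {x : ℕ} (hx : x < n) :
    (markKept.exec σ).mem 13 x ≠ 0 ↔
      x ∈ keptVerts d k (σ.reg 6) fun j i => σ.mem 9 (k * j + i) := by
  rw [markKept, Stmt.exec_fill_mem_one _ _ (by decide) h.reg_four (by rwa [h.reg_two]),
    mem_keptVerts]
  simp only [Expr.eval_test, ne_eq, ite_eq_right_iff, one_ne_zero, imp_false, not_not, tupleExpr,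
    tupleDist]
  simp only [Expr.holds_and, Expr.holds_ex, Expr.holds_all, Expr.holds_not, Expr.holds_eq]
  simp [h.reg_one, h.reg_two]
  refine exists_congr fun j => and_congr_right fun hj => and_congr_right fun _ =>
    forall_congr' fun j' => imp_congr_right fun hj' => ?_
  unfold SameDist
  push Not
  refine exists_congr fun a => and_congr_right fun ha => exists_congr fun b =>
    and_congr_right fun hb => ?_
  rw [h.dist _ (ht j' (hj'.trans hj) a ha) _ (ht j' (hj'.trans hj) b hb),
    h.dist _ (ht j hj a ha) _ (ht j hj b hb)]

theorem exec_firstKept {σ : State} {n k : ℕ} {d : ℕ → ℕ → ℕ} (h : Ready σ n k d) :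
    (firstKept.exec σ).reg 7 = firstBelow n fun x => σ.mem 13 x ≠ 0 := by
  simp only [firstKept, Stmt.exec, Function.update_self, firstBelow, Expr.eval_sum, h.reg_two]
  refine Finset.sum_congr rfl fun q _ => ?_
  rw [Expr.not, Expr.eval_ite, Expr.eval_const, Expr.eval_const]
  refine if_congr ?_ rfl rfl
  simp [h.reg_two]

theorem exec_mergeKept {σ : State} {n k : ℕ} {d : ℕ → ℕ → ℕ} (h : Ready σ n k d) {x : ℕ}
    (hx : x < n) : (mergeKept.exec σ).mem 4 x = if σ.mem 6 x ≠ 0 then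
      if σ.mem 13 x ≠ 0 then σ.reg 7 else n else σ.mem 4 x := by
  rw [mergeKept, Stmt.exec_fill_mem_one _ _ (by decide) h.reg_four (by rwa [h.reg_two])]
  simp [h.reg_two]

theorem card_flagSet_le {n w g k : ℕ} {d : ℕ → ℕ → ℕ} {σ : State}
    (hK : IsKernel d n k g (σ.mem 4)) {S : Finset ℕ} (hS : S ⊆ repSet n (σ.mem 4)) (hw : S.card ≤ w)
    {τ : State} (hF : flagSet n τ = partUnion n (σ.mem 4) S) : (flagSet n τ).card ≤ w * g := by
  rw [hF]
  exact (hK.card_partUnion_le hS).trans (Nat.mul_le_mul_right _ hw)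

/-- Here `w` bounds the number of merged parts, `g` the size of a part and `q` the distances. At
most `w * g` vertices take part, so `(w * g) ^ k` bounds the number of tuples listed, and merging at
least two parts lowers the number of parts. -/
theorem exec_reduce {σ : State} {n k w g q B : ℕ} {d : ℕ → ℕ → ℕ} (h : Ready σ n k d)
    (hw : ∀ K : Finset ℕ, (∀ x ∈ K, x < n) → 2 ≤ K.card →
      ∃ M, IsModule d K M ∧ 2 ≤ M.card ∧ M.card ≤ w)
    (hd : ∀ x y, d x y = d y x) (hq : ∀ x y, d x y < q) (hg : k * q ^ (k * k) ≤ g)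
    (hK : IsKernel d n k g (σ.mem 4)) (hwg : 1 ≤ w * g) (hB : 1 ≤ B) (hkB : k ≤ B) (hnB : n ≤ B)
    (hnnB : n * n ≤ B) (hgB : (w * g) ^ k ≤ B) :
    reduce.Small B σ ∧ IsKernel d n k g ((reduce.exec σ).mem 4) ∧
      ((repSet n ((reduce.exec σ).mem 4)).card ≤ 1 ∨
      (repSet n ((reduce.exec σ).mem 4)).card + 1 ≤ (repSet n (σ.mem 4)).card) := by
  obtain ⟨S, hS, hSw, hS2, hF⟩ := exec_selectModule h hw
  set rep := σ.mem 4 with hrep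
  have hFc := card_flagSet_le hK hS.1 hSw hF
  set σ₁ := selectModule.exec σ with hσ₁
  have h₁ : Ready σ₁ n k d := h.exec _ (by decide) (by decide)
  obtain ⟨t6, tmem, tall⟩ := exec_enumTuples σ₁ h₁.reg_four h₁.reg_one h₁.reg_two
  set σ₂ := enumTuples.exec σ₁ with hσ₂
  have h₂ : Ready σ₂ n k d := h₁.exec _ (by decide) (by decide)
  rw [← t6] at tmem tall
  set F := flagSet n σ₁ with hFdef
  set τ : ℕ → ℕ → ℕ := fun j i => σ₂.mem 9 (k * j + i) with hτ
  have hFn : ∀ x ∈ F, x < n := fun x hx => Finset.mem_range.1 (Finset.mem_filter.1 hx).1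
  have k13 : ∀ x < n, (markKept.exec σ₂).mem 13 x ≠ 0 ↔ x ∈ keptVerts d k (σ₂.reg 6) τ :=
    fun x hx => exec_markKept h₂ (fun j hj i hi => hFn _ (tmem j hj i hi)) hx
  set C' := keptVerts d k (σ₂.reg 6) τ with hC'
  set σ₃ := markKept.exec σ₂ with hσ₃
  have h₃ : Ready σ₃ n k d := h₂.exec _ (by decide) (by decide)
  set σ₄ := firstKept.exec σ₃ with hσ₄
  have h₄ : Ready σ₄ n k d := h₃.exec _ (by decide) (by decide)
  have r7 : σ₄.reg 7 = firstBelow n fun x => σ₃.mem 13 x ≠ 0 := exec_firstKept h₃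
  have e13 : σ₄.mem 13 = σ₃.mem 13 := rfl
  have e6 : σ₄.mem 6 = σ₁.mem 6 := by
    rw [hσ₄, Stmt.exec_mem _ _ (by decide), hσ₃, Stmt.exec_mem _ _ (by decide), hσ₂,
      Stmt.exec_mem _ _ (by decide)]
  have e4 : σ₄.mem 4 = rep := by
    rw [hσ₄, Stmt.exec_mem _ _ (by decide), hσ₃, Stmt.exec_mem _ _ (by decide), hσ₂,
      Stmt.exec_mem _ _ (by decide), hσ₁, Stmt.exec_mem _ _ (by decide)]
  have hC'F : C' ⊆ F := by
    intro x hx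
    obtain ⟨j, hj, ⟨i, hi, rfl⟩, _⟩ := mem_keptVerts.1 hx
    exact tmem j hj i hi
  have hmem : ∀ x < n, (reduce.exec σ).mem 4 x = mergeParts n rep S C' (σ₄.reg 7) x := by
    intro x hx
    refine (exec_mergeKept h₄ hx).trans ?_
    have h1 : σ₄.mem 6 x ≠ 0 ↔ rep x ∈ S := by
      have : x ∈ F ↔ rep x ∈ S := by rw [hF, mem_partUnion]; exact and_iff_right hx
      rw [← this, e6, hFdef, flagSet, Finset.mem_filter, Finset.mem_range]
      exact (and_iff_right hx).symm
    have h2 : σ₄.mem 13 x ≠ 0 ↔ x ∈ C' := k13 x hx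
    rw [mergeParts, e4]
    simp only [h1, h2]
  refine ⟨⟨selectModule_small h hnnB, enumTuples_small σ₁ h₁.reg_one h₁.reg_two hB hkB hnB hwg
    hFc hgB, Stmt.fill_small _ _ _ _ _ _, ?_, Stmt.fill_small _ _ _ _ _ _⟩, ?_, ?_⟩
  · have : (firstKept.exec σ₃).reg 7 ≤ B := by
      rw [exec_firstKept h₃]; exact (firstBelow_le _ _).trans hnB
    simpa [firstKept, Stmt.exec, Stmt.Small] using this
  · refine (hK.merge hd hS (r := σ₄.reg 7) (C' := C') ?_ ?_ ?_ ?_).congr hmem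
    · rwa [← hF]
    · rintro ⟨x, hx⟩
      have hxn := hFn x (hC'F hx)
      have := firstBelow_spec (P := fun x => σ₃.mem 13 x ≠ 0) ⟨x, hxn, (k13 x hxn).2 hx⟩
      rw [← r7] at this
      exact (k13 _ this.1).1 this.2
    · exact (card_keptVerts_le fun j _ i _ i' _ => hq _ _).trans hg
    · intro t ht
      obtain ⟨j, hj, hjt⟩ := tall t fun i hi => by rw [hF]; exact ht i hi
      obtain ⟨t', ht', hs⟩ := exists_sameDist_keptVerts (d := d) (k := k) (τ := τ) hj
      refine ⟨t', ht', SameDist.trans (fun a ha b hb => ?_) hs⟩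
      simp only [hτ, hjt a ha, hjt b hb]
  · rw [repSet_congr hmem]
    have := card_repSet_merge (C' := C') (r := σ₄.reg 7) hS.1
    by_cases h2 : 2 ≤ (repSet n rep).card
    · right
      have := hS2 h2
      omega
    -- At most one part is left. Merging the empty family changes nothing; a nonempty one pays for
    -- the new representative.
    · by_cases hS0 : S = ∅
      · left
        refine le_trans (Finset.card_le_card fun x hx => ?_) (by omega : (repSet n rep).card ≤ 1)
        obtain ⟨hx, hxr⟩ := mem_repSet.1 hx
        refine mem_repSet.2 ⟨hx, ?_⟩
        simpa [mergeParts, hS0] using hxr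
      · left
        have := Finset.card_pos.2 (Finset.nonempty_iff_ne_empty.2 hS0)
        omega

open RAM.Expr in
/-- Initially every vertex is a part. -/
def initParts : Stmt := .fill 4 2 4 (var 10)

/-- A set of vertices that contains a copy of each tuple is computed. -/
def kernelize : Stmt := .seq initParts (.iter 2 reduce)

/-- Each round removes a representative as long as there are two, so `n` rounds leave at most one
part. -/
theorem exec_kernelize {σ : State} {n k w g q B : ℕ} {d : ℕ → ℕ → ℕ} (h : Ready σ n k d)
    (hw : ∀ K : Finset ℕ, (∀ x ∈ K, x < n) → 2 ≤ K.card →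
      ∃ M, IsModule d K M ∧ 2 ≤ M.card ∧ M.card ≤ w)
    (hd : ∀ x y, d x y = d y x) (hq : ∀ x y, d x y < q) (hg : k * q ^ (k * k) ≤ g) (hg1 : 1 ≤ g)
    (hw1 : 1 ≤ w) (hB : 1 ≤ B) (hkB : k ≤ B) (hnB : n ≤ B)
    (hnnB : n * n ≤ B) (hgB : (w * g) ^ k ≤ B) :
    kernelize.Small B σ ∧ IsKernel d n k g ((kernelize.exec σ).mem 4) ∧
      (repSet n ((kernelize.exec σ).mem 4)).card ≤ 1 := by
  set σ₀ := initParts.exec σ with hσ₀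
  have h₀ : Ready σ₀ n k d := h.exec _ (by decide) (by decide)
  have hrep : ∀ x < n, σ₀.mem 4 x = x := by
    intro x hx
    rw [hσ₀, initParts, Stmt.exec_fill_mem_one _ _ (by decide) h.reg_four (by rwa [h.reg_two])]
    simp
  have key : ∀ i, Ready (reduce.exec^[i] σ₀) n k d ∧
      IsKernel d n k g ((reduce.exec^[i] σ₀).mem 4) ∧
      (repSet n ((reduce.exec^[i] σ₀).mem 4)).card ≤ max 1 (n - i) := by
    intro i
    induction i with
    | zero =>
      refine ⟨h₀, (isKernel_id hg1).congr hrep, ?_⟩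
      exact (Finset.card_filter_le _ _).trans (by simp)
    | succ i ih =>
      obtain ⟨h1, h2, h3⟩ := ih
      obtain ⟨_, g2, g3⟩ := exec_reduce h1 hw hd hq hg h2 (Nat.mul_pos hw1 hg1) hB hkB hnB hnnB hgB
      rw [Function.iterate_succ_apply']
      refine ⟨h1.exec _ (by decide) (by decide), g2, ?_⟩
      rcases g3 with g3 | g3
      · exact g3.trans (le_max_left _ _)
      · omega
  have hit : kernelize.exec σ = reduce.exec^[n] σ₀ := by
    rw [kernelize, Stmt.exec, Stmt.exec, ← hσ₀, h₀.reg_two]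
  refine ⟨⟨Stmt.fill_small _ _ _ _ _ _, fun i _ => ?_⟩, ?_, ?_⟩
  · obtain ⟨h1, h2, h3⟩ := key i
    exact (exec_reduce h1 hw hd hq hg h2 (Nat.mul_pos hw1 hg1) hB hkB hnB hnnB hgB).1
  · rw [hit]; exact (key n).2.1
  · rw [hit]; exact (key n).2.2.trans (by simp)

end RAM

/-! ## Envy-freeness in terms of distance matrices -/

/-- The cost of the agent `a` who is placed at the position of `a'`, while each agent `c` is placed at
the position of `f c`, if `Δ` is the matrix of the distances of the positions. -/
def matrixCost (I : ℕ → ℕ → ℕ) (k : ℕ) (Δ : ℕ → ℕ → ℕ) (a a' : ℕ) (f : ℕ → ℕ) : ℕ :=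
  ∑ c ∈ Finset.range k, if I a c ≠ 0 then (I a c - Δ a' (f c)) + (Δ a' (f c) - I a c) else 0

/-- The numbers `a` and `b` are swapped. -/
def swapNat (a b c : ℕ) : ℕ := if c = a then b else if c = b then a else c

/-- Positions with the distances `Δ` are distinct and no agent envies another one. -/
def IsStable (I : ℕ → ℕ → ℕ) (k : ℕ) (Δ : ℕ → ℕ → ℕ) : Prop :=
  (∀ a < k, ∀ b < k, a = b ∨ Δ a b ≠ 0) ∧
  ∀ a < k, ∀ b < k, matrixCost I k Δ a a (fun c => c) ≤ matrixCost I k Δ a b (swapNat a b)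

/-- Only entries with indices below `k` are read, as a swap of such indices stays below `k`. This is
why tuples may be replaced by copies. -/
theorem IsStable.congr {I : ℕ → ℕ → ℕ} {k : ℕ} {Δ Δ' : ℕ → ℕ → ℕ}
    (h : ∀ a < k, ∀ b < k, Δ a b = Δ' a b) (hs : IsStable I k Δ) : IsStable I k Δ' := by
  have hc : ∀ a a' f, a' < k → (∀ c < k, f c < k) →
      matrixCost I k Δ a a' f = matrixCost I k Δ' a a' f := by
    intro a a' f ha' hf
    refine Finset.sum_congr rfl fun c hc => ?_
    rw [h a' ha' (f c) (hf c (Finset.mem_range.1 hc))]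
  refine ⟨fun a ha b hb => by rw [← h a ha b hb]; exact hs.1 a ha b hb, fun a ha b hb => ?_⟩
  rw [← hc a a _ ha fun c hc => hc, ← hc a b _ hb fun c hc => ?_]
  · exact hs.2 a ha b hb
  · unfold swapNat; split_ifs <;> assumption

namespace DistancePreservationGame

variable {k n : ℕ} (Γ : DistancePreservationGame (Fin k) (Fin n))

/-- The matrix of ideal distances, with numbers as indices. -/
noncomputable def natIdeal (a c : ℕ) : ℕ :=
  if h : a < k ∧ c < k then Γ.idealEntry ⟨a, h.1⟩ ⟨c, h.2⟩ else 0

theorem natIdeal_val (a c : Fin k) : Γ.natIdeal a c = Γ.idealEntry a c := by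
  simp [natIdeal]

/-- Ideal distances are positive, so 0 can mark a missing relationship. The absolute value is the
sum of both truncated differences, which the machine can compute. -/
theorem cost_eq (a : Fin k) (π : Fin k ↪ Fin n) :
    Γ.cost a π = ((∑ c : Fin k, if Γ.idealEntry a c ≠ 0 then
      (Γ.idealEntry a c - Γ.topology.dist (π a) (π c)) +
        (Γ.topology.dist (π a) (π c) - Γ.idealEntry a c) else 0 : ℕ) : ℤ) := by
  classical
  rw [cost, Nat.cast_sum, ← Finset.sum_subset (Finset.subset_univ (Γ.rel a))]
  · refine Eq.trans (Finset.sum_congr rfl fun b _ => ?_) (Finset.sum_coe_sort (Γ.rel a)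
      fun c => ((if Γ.idealEntry a c ≠ 0 then (Γ.idealEntry a c - Γ.topology.dist (π a) (π c)) +
        (Γ.topology.dist (π a) (π c) - Γ.idealEntry a c) else 0 : ℕ) : ℤ))
    have : Γ.idealEntry a b = Γ.ideal a b := by simp [idealEntry]
    rw [this, if_pos (Γ.ideal a b).pos.ne']
    rcases abs_cases (((Γ.ideal a b : ℕ) : ℤ) - (Γ.topology.dist (π a) (π b) : ℤ)) with h | h <;>
      omega
  · intro c _ hc
    simp [idealEntry, hc]

theorem cost_eq_matrixCost (π ρ : Fin k ↪ Fin n) (t : ℕ → ℕ) (ht : ∀ i : Fin k, t i = π i)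
    (a a' : Fin k) (f : ℕ → ℕ) (ha : ρ a = π a') (hf : ∀ c : Fin k, ∃ c' : Fin k, f c = c' ∧ ρ c = π c') :
    Γ.cost a ρ = (matrixCost Γ.natIdeal k (fun i j => Γ.topology.natDist (t i) (t j)) a a' f : ℤ) := by
  rw [cost_eq, matrixCost, Finset.sum_range]
  congr 1
  refine Finset.sum_congr rfl fun c _ => ?_
  obtain ⟨c', h1, h2⟩ := hf c
  rw [natIdeal_val, h1, ht, ht, SimpleGraph.natDist_val, ha, h2]

/-- After swapping `a` and `b`, agent `a` stands at the position of `b` and each `c` at that of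
`swapNat a b c`, so both costs come from the one matrix of `π`. The distinctness clause holds as `π`
is injective and different vertices of a connected graph have positive distance. -/
theorem envyFree_iff (π : Fin k ↪ Fin n) (t : ℕ → ℕ) (ht : ∀ i : Fin k, t i = π i) :
    Γ.EnvyFree π ↔ IsStable Γ.natIdeal k fun i j => Γ.topology.natDist (t i) (t j) := by
  have h1 : ∀ a, Γ.cost a π = (matrixCost Γ.natIdeal k
      (fun i j => Γ.topology.natDist (t i) (t j)) a a (fun c => c) : ℤ) := fun a =>
    Γ.cost_eq_matrixCost π π t ht a a _ rfl fun c => ⟨c, rfl, rfl⟩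
  have h2 : ∀ a b : Fin k, Γ.cost a (swap π a b) = (matrixCost Γ.natIdeal k
      (fun i j => Γ.topology.natDist (t i) (t j)) a b (swapNat a b) : ℤ) := by
    intro a b
    refine Γ.cost_eq_matrixCost π _ t ht a b _ (by simp [swap]) fun c =>
      ⟨Equiv.swap a b c, ?_, rfl⟩
    simp only [swapNat, Equiv.swap_apply_def, Fin.ext_iff]
    split_ifs <;> rfl
  have h3 : ∀ a < k, ∀ b < k, a = b ∨ Γ.topology.natDist (t a) (t b) ≠ 0 := by
    intro a ha b hb
    rw [ht ⟨a, ha⟩, ht ⟨b, hb⟩, SimpleGraph.natDist_val, or_iff_not_imp_left]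
    intro hab h0
    rw [Γ.connected.dist_eq_zero_iff] at h0
    exact hab (congrArg Fin.val (π.injective h0))
  rw [EnvyFree, IsStable, and_iff_right h3]
  push Not
  constructor
  · intro h a ha b hb
    have := h ⟨a, ha⟩ ⟨b, hb⟩
    rw [h1, h2] at this
    exact_mod_cast this
  · intro h a b
    rw [h1, h2]
    exact_mod_cast h a a.2 b b.2

theorem exists_envyFree_iff : (∃ π, Γ.EnvyFree π) ↔ ∃ t : ℕ → ℕ, (∀ i < k, t i < n) ∧
    IsStable Γ.natIdeal k fun i j => Γ.topology.natDist (t i) (t j) := by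
  constructor
  · rintro ⟨π, hπ⟩
    have ht : ∀ i : Fin k, (fun i => if h : i < k then (π ⟨i, h⟩ : ℕ) else 0) i = π i := by simp
    refine ⟨_, fun i hi => ?_, (Γ.envyFree_iff π (fun i => if h : i < k then π ⟨i, h⟩ else 0) ht).1 hπ⟩
    rw [dif_pos hi]; exact Fin.is_lt _
  · rintro ⟨t, ht, hs⟩
    refine ⟨⟨fun i => ⟨t i, ht i i.2⟩, fun i j hij => ?_⟩, (Γ.envyFree_iff _ t fun i => rfl).2 hs⟩
    have hij' : t i = t j := congrArg Fin.val hij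
    refine Fin.ext ((hs.1 i i.2 j j.2).resolve_right fun h => h ?_)
    beta_reduce
    rw [hij', Γ.topology.natDist_val ⟨t j, ht j j.2⟩ ⟨t j, ht j j.2⟩, SimpleGraph.dist_self]

end DistancePreservationGame

/-! ### The exhaustive test of the tuples of remaining vertices. -/

namespace RAM

open RAM.Expr in
/-- All remaining vertices are put into bank `6`. -/
def flagAll : Stmt := .fill 6 2 4 (test (lt (load 4 (var 10)) (var 2)))

open RAM.Expr in
/-- The ideal distance of `R[13]` from `R[15]` in the input. -/
def idealExpr : Expr := load 0 (.add (.const 2) (at2 1 (var 13) (var 15)))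

open RAM.Expr in
/-- The cost of the agent `R[13]` with the given positions of this agent and of the agents `R[15]`,
as indices of the tuple with index `R[12]`. -/
def costExpr (e e' : Expr) : Expr :=
  .sum 15 1 (.ite idealExpr
    (.add (.sub idealExpr (load 2 (at2 2 (tupleExpr (var 12) e) (tupleExpr (var 12) e'))))
      (.sub (load 2 (at2 2 (tupleExpr (var 12) e) (tupleExpr (var 12) e'))) idealExpr)) (.const 0))

open RAM.Expr in
/-- The position of the agent `R[15]` after swapping `R[13]` and `R[14]`. -/
def swapExpr : Expr :=
  .ite (eq (var 15) (var 13)) (var 14) (.ite (eq (var 15) (var 14)) (var 13) (var 15))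

open RAM.Expr in
/-- Register `0` tells whether one of the tuples is an envy-free allocation. -/
def checkTuples : Stmt :=
  .assign 0 (test (ex 12 6 (and
    (all 13 1 (all 14 1 (or (eq (var 13) (var 14))
      (load 2 (at2 2 (tupleExpr (var 12) (var 13)) (tupleExpr (var 12) (var 14)))))))
    (all 13 1 (all 14 1 (le (costExpr (var 13) (var 15)) (costExpr (var 14) swapExpr)))))))

theorem exec_flagAll {σ : State} {n k : ℕ} {d : ℕ → ℕ → ℕ} (h : Ready σ n k d) :
    flagSet n (flagAll.exec σ) = (Finset.range n).filter fun x => σ.mem 4 x < n := by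
  refine Finset.filter_congr fun x hx => ?_
  rw [flagAll, Stmt.exec_fill_mem_one _ _ (by decide) h.reg_four
    (by rw [h.reg_two]; exact Finset.mem_range.1 hx)]
  simp [h.reg_two]

theorem exec_checkTuples {σ : State} {n k : ℕ} {d I : ℕ → ℕ → ℕ} (h : Ready σ n k d)
    (ht : ∀ j < σ.reg 6, ∀ i < k, σ.mem 9 (k * j + i) < n)
    (hI : ∀ a < k, ∀ c < k, σ.mem 0 (2 + (k * a + c)) = I a c) :
    (checkTuples.exec σ).reg 0 ≠ 0 ↔ ∃ j < σ.reg 6, IsStable I k fun i i' =>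
      d (σ.mem 9 (k * j + i)) (σ.mem 9 (k * j + i')) := by
  simp only [checkTuples, Stmt.exec, Function.update_self, Expr.eval_test, ne_eq, ite_eq_right_iff,
    one_ne_zero, imp_false, not_not, Expr.holds_ex, Expr.holds_and, Expr.holds_all, Expr.holds_or,
    Expr.holds_eq, Expr.holds_load, Expr.holds_le]
  refine exists_congr fun j => and_congr_right fun hj => ?_
  rw [IsStable]
  refine and_congr ?_ ?_
  · simp [h.reg_one, h.reg_two, tupleExpr]
    refine forall_congr' fun a => imp_congr_right fun ha => forall_congr' fun b =>
      imp_congr_right fun hb => ?_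
    rw [h.dist _ (ht j hj a ha) _ (ht j hj b hb)]
  · simp [h.reg_one, h.reg_two, tupleExpr, costExpr, idealExpr, swapExpr]
    refine forall_congr' fun a => imp_congr_right fun ha => forall_congr' fun b =>
      imp_congr_right fun hb => ?_
    have hc : ∀ a' < k, ∀ f : ℕ → ℕ, (∀ c < k, f c < k) →
        (∑ c ∈ Finset.range k, if σ.mem 0 (2 + (k * a + c)) = 0 then 0 else
          σ.mem 0 (2 + (k * a + c)) -
              σ.mem 2 (n * σ.mem 9 (k * j + a') + σ.mem 9 (k * j + f c)) +
            (σ.mem 2 (n * σ.mem 9 (k * j + a') + σ.mem 9 (k * j + f c)) -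
              σ.mem 0 (2 + (k * a + c)))) =
        matrixCost I k (fun i i' => d (σ.mem 9 (k * j + i)) (σ.mem 9 (k * j + i'))) a a' f := by
      intro a' ha' f hf
      refine Finset.sum_congr rfl fun c hc => ?_
      rw [Finset.mem_range] at hc
      rw [hI a ha c hc, h.dist _ (ht j hj a' ha') _ (ht j hj _ (hf c hc)), ite_not]
    rw [← hc a ha _ fun c hc => hc, ← hc b hb _ fun c hc => ?_]
    · rfl
    · unfold swapNat; split_ifs <;> assumption

end RAM

/-! ## The running time -/

/-- The function is bounded by a polynomial. -/
def PolyBounded (f : ℕ → ℕ) : Prop := ∃ C D, ∀ B, f B ≤ C * (B + 1) ^ D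

namespace PolyBounded

variable {f g : ℕ → ℕ}

theorem _root_.polyBounded_const (c : ℕ) : PolyBounded fun _ => c := ⟨c, 0, fun B => by simp⟩

theorem _root_.polyBounded_id : PolyBounded fun B => B := ⟨1, 1, fun B => by simp⟩

theorem add (hf : PolyBounded f) (hg : PolyBounded g) : PolyBounded fun B => f B + g B := by
  obtain ⟨C, D, h⟩ := hf
  obtain ⟨C', D', h'⟩ := hg
  refine ⟨C + C', D + D', fun B => ?_⟩
  rw [add_mul]
  exact Nat.add_le_add
    ((h B).trans (Nat.mul_le_mul_left _ (Nat.pow_le_pow_right B.succ_pos (Nat.le_add_right _ _))))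
    ((h' B).trans (Nat.mul_le_mul_left _ (Nat.pow_le_pow_right B.succ_pos (Nat.le_add_left _ _))))

theorem mul (hf : PolyBounded f) (hg : PolyBounded g) : PolyBounded fun B => f B * g B := by
  obtain ⟨C, D, h⟩ := hf
  obtain ⟨C', D', h'⟩ := hg
  refine ⟨C * C', D + D', fun B => (Nat.mul_le_mul (h B) (h' B)).trans_eq ?_⟩
  ring

end PolyBounded

namespace RAM

theorem Expr.polyBounded_cost (e : Expr) : PolyBounded fun B => e.cost B := by
  induction e with
  | var | const => exact polyBounded_const 1
  | add e₁ e₂ h₁ h₂ | sub e₁ e₂ h₁ h₂ => exact h₁.add (h₂.add (polyBounded_const 1))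
  | load k e h => exact h.add (polyBounded_const 1)
  | ite e₁ e₂ e₃ h₁ h₂ h₃ => exact h₁.add ((h₂.add h₃).add (polyBounded_const 1))
  | mul r e h => exact h.add ((polyBounded_id.mul (polyBounded_const 3)).add (polyBounded_const 4))
  | sum x r e h => exact (polyBounded_id.mul (h.add (polyBounded_const 5))).add (polyBounded_const 6)

theorem Stmt.polyBounded_cost (p : Stmt) : PolyBounded fun B => p.cost B := by
  induction p with
  | assign x e => exact e.polyBounded_cost.add (polyBounded_const 1)
  | store k e₁ e₂ => exact e₁.polyBounded_cost.add (e₂.polyBounded_cost.add (polyBounded_const 1))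
  | tab k x r y s e =>
    exact (polyBounded_id.mul ((polyBounded_id.mul (e.polyBounded_cost.add (polyBounded_const 5))).add (polyBounded_const 6))).add (polyBounded_const 10)
  | seq p q hp hq => exact hp.add hq
  | iter r p hp => exact (polyBounded_id.mul (hp.add (polyBounded_const 3))).add (polyBounded_const 2)

end RAM

/-! ## The encoding of an instance -/

namespace DPGInstance

variable (x : DPGInstance)

theorem length_encode :
    x.encode.length = 2 + x.numAgents * x.numAgents + x.numVertices * x.numVertices := by
  simp [encode]; omega

theorem getD_encode_zero : x.encode.getD 0 0 = x.numAgents := rfl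

theorem getD_encode_one : x.encode.getD 1 0 = x.numVertices := rfl

theorem getD_encode_ideal {a c : ℕ} (ha : a < x.numAgents) (hc : c < x.numAgents) :
    x.encode.getD (2 + (x.numAgents * a + c)) 0 = x.game.natIdeal a c := by
  have h := RAM.Stmt.mul_add_lt_mul ha hc
  rw [encode, List.getD_append _ _ _ _ (by simp; omega), List.getD_append_right _ _ _ _ (by simp),
    DistancePreservationGame.natIdeal, dif_pos ⟨ha, hc⟩]
  simp only [List.length_cons, List.length_nil, Nat.add_sub_cancel_left, Nat.reduceAdd]
  rw [List.getD_eq_getElem _ _ (by simpa using h), List.getElem_ofFn]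
  congr 1 <;> ext
  · simp [Nat.mul_add_div (by omega : 0 < x.numAgents), Nat.div_eq_of_lt hc]
  · simp [Nat.mod_eq_of_lt hc]

theorem getD_encode_adj (u v : Fin x.numVertices) :
    x.encode.getD (2 + (x.numAgents * x.numAgents + (x.numVertices * u + v))) 0 ≠ 0 ↔
      x.game.topology.Adj u v := by
  have h := RAM.Stmt.mul_add_lt_mul u.2 v.2
  rw [encode, List.getD_append_right _ _ _ _ (by simp; omega)]
  have he : 2 + (x.numAgents * x.numAgents + (x.numVertices * u + v)) - ([x.numAgents,
      x.numVertices] ++ List.ofFn fun i : Fin (x.numAgents * x.numAgents) =>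
      x.game.idealEntry i.divNat i.modNat).length = x.numVertices * u + v := by
    simp; omega
  rw [he, List.getD_eq_getElem _ _ (by simpa using h), List.getElem_ofFn]
  have h1 : Fin.divNat (⟨x.numVertices * u + v, h⟩ : Fin (x.numVertices * x.numVertices)) = u := by
    ext; simp [Nat.mul_add_div (Fin.pos u), Nat.div_eq_of_lt v.2]
  have h2 : Fin.modNat (⟨x.numVertices * u + v, h⟩ : Fin (x.numVertices * x.numVertices)) = v := by
    ext; simp [Nat.mod_eq_of_lt v.2]
  rw [h1, h2]
  simp [DistancePreservationGame.adjEntry]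

end DPGInstance

theorem RAM.length_le_inputSize (l : List ℕ) : l.length ≤ inputSize l := by
  induction l with
  | nil => simp
  | cons a l ih =>
    simp only [inputSize, List.map_cons, List.sum_cons, List.length_cons] at ih ⊢
    omega

/-! ## The algorithm -/

namespace RAM

open RAM.Expr in
/-- The sizes and the pairs of vertices go to their registers and banks. -/
def setup : Stmt :=
  .seq (.assign 1 (load 0 (.const 0))) (.seq (.assign 2 (load 0 (.const 1)))
    (.seq (.assign 3 (.mul 2 (var 2))) (.seq (.assign 4 (.const 1))
      (.seq (.fill 10 2 2 (var 10)) (.fill 11 2 2 (var 11))))))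

/-- The algorithm. -/
def searchAllocation : Stmt :=
  .seq setup (.seq distances (.seq kernelize (.seq flagAll (.seq enumTuples checkTuples))))

theorem exec_setup {σ : State} {n k : ℕ} (h0 : σ.mem 0 0 = k) (h1 : σ.mem 0 1 = n) :
    (setup.exec σ).reg 1 = k ∧ (setup.exec σ).reg 2 = n ∧ (setup.exec σ).reg 3 = n * n ∧
      (setup.exec σ).reg 4 = 1 ∧ (∀ u < n, ∀ v < n, (setup.exec σ).mem 10 (n * u + v) = u) ∧
      ∀ u < n, ∀ v < n, (setup.exec σ).mem 11 (n * u + v) = v := by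
  set τ : State := (Stmt.seq (.assign 1 (.load 0 (.const 0))) (.seq (.assign 2 (.load 0 (.const 1)))
    (.seq (.assign 3 (.mul 2 (.var 2))) (.assign 4 (.const 1))))).exec σ with hτ
  have g1 : τ.reg 1 = k := by simp [hτ, Stmt.exec, h0]
  have g2 : τ.reg 2 = n := by simp [hτ, Stmt.exec, h1]
  have g3 : τ.reg 3 = n * n := by simp [hτ, Stmt.exec, h1]
  have g4 : τ.reg 4 = 1 := by simp [hτ, Stmt.exec]
  have hs : setup.exec σ = (Stmt.fill 11 2 2 (.var 11)).exec ((Stmt.fill 10 2 2 (.var 10)).exec τ) :=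
    rfl
  rw [hs]
  refine ⟨g1, g2, g3, g4, fun u hu v hv => ?_, fun u hu v hv => ?_⟩
  · rw [Stmt.exec_mem _ _ (by decide)]
    have := Stmt.exec_fill_mem (k := 10) (r := 2) (s := 2) (.var 10) τ (by decide) (i := u) (j := v)
      (by rwa [g2]) (by rwa [g2])
    rw [g2] at this
    rw [this]; simp
  · have := Stmt.exec_fill_mem (k := 11) (r := 2) (s := 2) (.var 11)
      ((Stmt.fill 10 2 2 (.var 10)).exec τ) (by decide) (i := u) (j := v)
      (by rwa [Stmt.exec_fill_reg, g2]) (by rwa [Stmt.exec_fill_reg, g2])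
    rw [Stmt.exec_fill_reg, g2] at this
    rw [this]; simp

theorem setup_small {σ : State} {n k B : ℕ} (h0 : σ.mem 0 0 = k) (h1 : σ.mem 0 1 = n) (hB : 1 ≤ B)
    (hkB : k ≤ B) (hnB : n ≤ B) (hnnB : n * n ≤ B) : setup.Small B σ := by
  refine ⟨?_, ?_, ?_, ?_, Stmt.fill_small _ _ _ _ _ _, Stmt.fill_small _ _ _ _ _ _⟩ <;>
    simp [Stmt.Small, Stmt.exec, h0, h1] <;> assumption

theorem ready_distances {σ : State} {n k : ℕ} {G : SimpleGraph (Fin n)} (hG : G.Connected)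
    (h0 : σ.mem 0 0 = k) (h1 : σ.mem 0 1 = n)
    (hadj : ∀ u v : Fin n, σ.mem 0 (2 + (k * k + (n * u + v))) ≠ 0 ↔ G.Adj u v)
    (hz : ∀ a, σ.mem 2 a = 0) : Ready (distances.exec (setup.exec σ)) n k G.natDist := by
  obtain ⟨g1, g2, g3, g4, g5, g6⟩ := exec_setup h0 h1
  refine ⟨?_, ?_, ?_, ?_, fun u hu v hv => ?_, ?_, ?_⟩
  · rwa [Stmt.exec_reg _ _ (by decide)]
  · rwa [Stmt.exec_reg _ _ (by decide)]
  · rwa [Stmt.exec_reg _ _ (by decide)]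
  · rwa [Stmt.exec_reg _ _ (by decide)]
  · refine (exec_distances _ g1 g2 hG ?_ ?_ ⟨u, hu⟩ ⟨v, hv⟩).trans
      (G.natDist_val ⟨u, hu⟩ ⟨v, hv⟩).symm
    · rwa [Stmt.exec_mem _ _ (by decide)]
    · rwa [Stmt.exec_mem _ _ (by decide)]
  · rwa [Stmt.exec_mem _ _ (by decide)]
  · rwa [Stmt.exec_mem _ _ (by decide)]

/-- Here `w` bounds module sizes, and distances are at most `w`, which gives `w + 1` possible
entries of a distance matrix. -/
theorem exec_searchAllocation (x : DPGInstance) {w g B : ℕ}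
    (hw : x.game.topology.modularWidth + 2 ≤ w)
    (hg : x.numAgents * (w + 1) ^ (x.numAgents * x.numAgents) ≤ g) (hg1 : 1 ≤ g) (hB : 1 ≤ B)
    (hkB : x.numAgents ≤ B) (hnnB : x.numVertices * x.numVertices ≤ B)
    (hgB : (w * g) ^ x.numAgents ≤ B) :
    searchAllocation.Small B (init x.encode) ∧
      ((searchAllocation.exec (init x.encode)).reg 0 ≠ 0 ↔ x.HasEnvyFree) := by
  have hnB : x.numVertices ≤ B := (Nat.le_mul_self _).trans hnnB
  have i0 : (init x.encode).mem 0 0 = x.numAgents := x.getD_encode_zero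
  have i1 : (init x.encode).mem 0 1 = x.numVertices := x.getD_encode_one
  have hG := x.game.connected
  set k := x.numAgents with hk
  set n := x.numVertices with hn
  set d := x.game.topology.natDist with hd
  set σ₁ := setup.exec (init x.encode) with hσ₁
  set σ₂ := distances.exec σ₁ with hσ₂
  have h₂ : Ready σ₂ n k d := ready_distances hG i0 i1 x.getD_encode_adj fun _ => rfl
  obtain ⟨s₂, hker, hcard⟩ := exec_kernelize h₂ (q := w + 1) (w := w) (g := g) (B := B)
    (fun K hK hK2 => by
      obtain ⟨M, h1, h2, h3⟩ := SimpleGraph.exists_natDist_module hG K hK hK2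
      exact ⟨M, h1, h2, h3.trans hw⟩)
    (SimpleGraph.natDist_comm _) (fun u v => (SimpleGraph.natDist_lt hG u v).trans_le (by omega))
    hg hg1 (by omega) hB hkB hnB hnnB hgB
  set σ₃ := kernelize.exec σ₂ with hσ₃
  have h₃ : Ready σ₃ n k d := h₂.exec _ (by decide) (by decide)
  set σ₄ := flagAll.exec σ₃ with hσ₄
  have h₄ : Ready σ₄ n k d := h₃.exec _ (by decide) (by decide)
  have hF : flagSet n σ₄ = (Finset.range n).filter fun y => σ₃.mem 4 y < n := exec_flagAll h₃
  have hFc : (flagSet n σ₄).card ≤ w * g := by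
    have : flagSet n σ₄ ⊆ partUnion n (σ₃.mem 4) (repSet n (σ₃.mem 4)) := by
      intro y hy
      rw [hF, Finset.mem_filter, Finset.mem_range] at hy
      exact mem_partUnion.2 ⟨hy.1, mem_repSet.2 ⟨hy.2, hker.idem y hy.1 hy.2⟩⟩
    calc (flagSet n σ₄).card ≤ _ := Finset.card_le_card this
      _ ≤ _ := hker.card_partUnion_le subset_rfl
      _ ≤ w * g := Nat.mul_le_mul_right _ (hcard.trans (by omega))
  obtain ⟨e6, emem, eall⟩ := exec_enumTuples σ₄ h₄.reg_four h₄.reg_one h₄.reg_two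
  set σ₅ := enumTuples.exec σ₄ with hσ₅
  have h₅ : Ready σ₅ n k d := h₄.exec _ (by decide) (by decide)
  have hFn : ∀ y ∈ flagSet n σ₄, y < n := fun y hy => Finset.mem_range.1 (Finset.mem_filter.1 hy).1
  have m0 : σ₅.mem 0 = (init x.encode).mem 0 := by
    rw [hσ₅, Stmt.exec_mem _ _ (by decide), hσ₄, Stmt.exec_mem _ _ (by decide), hσ₃,
      Stmt.exec_mem _ _ (by decide), hσ₂, Stmt.exec_mem _ _ (by decide), hσ₁,
      Stmt.exec_mem _ _ (by decide)]
  rw [← e6] at emem eall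
  have hcheck := exec_checkTuples (I := x.game.natIdeal) h₅ (fun j hj i hi => hFn _ (emem j hj i hi))
    fun a ha c hc => by rw [m0]; exact x.getD_encode_ideal ha hc
  refine ⟨⟨setup_small i0 i1 hB hkB hnB hnnB, distances_small _ _, s₂, Stmt.fill_small _ _ _ _ _ _,
    enumTuples_small σ₄ h₄.reg_one h₄.reg_two hB hkB hnB (Nat.mul_pos (by omega) hg1) hFc hgB,
    ?_⟩, ?_⟩
  · rw [checkTuples, Stmt.Small, Expr.eval_test]
    split_ifs <;> omega
  · refine hcheck.trans (Iff.trans ?_ x.game.exists_envyFree_iff.symm)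
    constructor
    · rintro ⟨j, hj, hs⟩
      exact ⟨_, fun i hi => hFn _ (emem j hj i hi), hs⟩
    -- The stable tuple has a copy among the remaining vertices, and the copy is stable since
    -- stability depends only on distances.
    · rintro ⟨t, ht, hs⟩
      obtain ⟨t', h1, h2⟩ := hker.cover t ht
      obtain ⟨j, hj, h3⟩ := eall t' fun i hi => by
        rw [hF, Finset.mem_filter, Finset.mem_range]; exact h1 i hi
      refine ⟨j, hj, IsStable.congr (fun a ha b hb => ?_) hs⟩
      rw [h3 a ha, h3 b hb]
      exact h2 a ha b hb

end RAM

/-! ## The main theorem -/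

/-- A bound of the number of vertices that remain. -/
def kernelBound (κ : ℕ) : ℕ := κ * (κ + 3) ^ (κ * κ) + 1

/-- A bound of the number of tuples of remaining vertices. -/
def tupleBound (κ : ℕ) : ℕ := ((κ + 2) * kernelBound κ) ^ κ

theorem primrec_pow {f g : ℕ → ℕ} (hf : Primrec f) (hg : Primrec g) :
    Primrec fun κ => f κ ^ g κ :=
  (Primrec₂.unpaired'.1 Nat.Primrec.pow).comp hf hg

theorem primrec_tupleBound : Primrec tupleBound := by
  have hc : ∀ c : ℕ, Primrec fun κ : ℕ => κ + c := fun c =>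
    Primrec.nat_add.comp Primrec.id (Primrec.const c)
  have hk : Primrec kernelBound := Primrec.nat_add.comp (Primrec.nat_mul.comp Primrec.id
    (primrec_pow (hc 3) (Primrec.nat_mul.comp Primrec.id Primrec.id))) (Primrec.const 1)
  exact primrec_pow (Primrec.nat_mul.comp (hc 2) hk) Primrec.id

theorem tupleBound_pos (κ : ℕ) : 0 < tupleBound κ :=
  pow_pos (Nat.mul_pos (by omega) (Nat.succ_pos _)) _

open RAM in
theorem mainTheorem9 :
    IsFPT DPGInstance.encode DPGInstance.parameter DPGInstance.HasEnvyFree := by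
  obtain ⟨C, D, hCD⟩ := searchAllocation.polyBounded_cost
  refine ⟨searchAllocation.compile 20, fun κ => C * (2 * tupleBound κ) ^ D, D, ?_, fun x => ?_⟩
  · exact (Primrec.nat_mul.comp (Primrec.const C) (primrec_pow
      (Primrec.nat_mul.comp (Primrec.const 2) primrec_tupleBound) (Primrec.const D))).to_comp
  set κ := x.parameter with hκ
  set s := inputSize x.encode with hs
  have hκ' : κ = x.numAgents + x.game.topology.modularWidth := rfl
  have hF := tupleBound_pos κ
  have hlen := length_le_inputSize x.encode
  have hsB : s ≤ tupleBound κ * s := Nat.le_mul_of_pos_left _ hF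
  have hl := x.length_encode
  have hkk := Nat.le_mul_self x.numAgents
  have hs1 : 1 ≤ s := by omega
  -- One number `B` has to dominate the input-dependent register values, such as `n * n` and the
  -- initial length in register 0, as well as the number of tuples; the product does both. The
  -- monotone bound replaces `k` and `mw` by `κ`.
  obtain ⟨hsmall, hcorrect⟩ := exec_searchAllocation x (w := κ + 2) (g := kernelBound κ)
    (B := tupleBound κ * s) (by omega)
    (by
      refine le_trans ?_ (Nat.le_succ _)
      exact Nat.mul_le_mul (by omega) (Nat.pow_le_pow_right (by omega)
        (Nat.mul_le_mul (by omega) (by omega))))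
    (Nat.succ_pos _) (by omega) (by omega) (by omega)
    (le_trans (Nat.pow_le_pow_right (Nat.mul_pos (by omega) (Nat.succ_pos _)) (by omega))
      (Nat.le_mul_of_pos_right _ hs1))
  -- All registers of the program are below 20, so scratch space starts there.
  obtain ⟨⟨τ, t, hrun, ht, hτ, -⟩, -⟩ := searchAllocation.compile_within (B := tupleBound κ * s)
    (b₀ := 20) (by decide) (by decide) 20 le_rfl (init x.encode) (init x.encode) (fun _ _ => rfl) rfl
    (fun r _ => by simp only [init]; split_ifs <;> omega) hsmall
  refine ⟨τ, t, hrun, ht.trans ((hCD _).trans ?_), by rw [hτ 0 (by decide)]; exact hcorrect⟩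
  -- As `tupleBound κ * s` is positive, the summand 1 is absorbed by the factor 2, and the power
  -- then splits into a parameter factor and `s ^ D`.
  calc C * (tupleBound κ * s + 1) ^ D ≤ C * (2 * tupleBound κ * s) ^ D := by
        refine Nat.mul_le_mul_left _ (Nat.pow_le_pow_left ?_ _)
        rw [mul_assoc]; omega
    _ = C * (2 * tupleBound κ) ^ D * s ^ D := by rw [mul_pow, mul_assoc]
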